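/- **Setting.** Let $n\ge 2$ and let $m_i,\mathfrak m_i,\mathfrak M_i>0$ ($1\le i\le n$) be mass parameters (in the planetary problem $\mathfrak m_i=\frac{m_0m_i}{m_0+\mu m_i}$, $\mathfrak M_i=m_0+\mu m_i$). A configuration is an $n$-tuple of oriented ellipses in $\mathbb R^3$ with a common focus at the origin; the $i$-th one has semi-major axis $a_i>0$, eccentricity $e_i\in(0,1)$, unit vector $P_i$ from the focus to the perihelion and unit normal $N_i\perp P_i$. The point of the $i$-th ellipse with mean anomaly $\ell_i$ is $$x_i(\ell_i)=a_i(\cos E-e_i)P_i+a_i\sqrt{1-e_i^2}\,\sin E\;N_i\times P_i,\qquad E-e_i\sin E=\ell_i .$$ Put $y_i=\mathfrak m_i\sqrt{\mathfrak M_i/a_i^3}\,\partial_{\ell_i}x_i$, $\Lambda_i=\mathfrak m_i\sqrt{\mathfrak M_ia_i}$, $C_i=x_i\times y_i=\Lambda_i\sqrt{1-e_i^2}\,N_i$ and $S_j=\sum_{k=j}^nC_k$. Let $(k^{(1)},k^{(2)},k^{(3)})$ be the fixed orthonormal frame, and define the nodes $$\tilde\nu_1=k^{(3)}\times S_1,\quad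 \tilde\nu_{j+1}=P_j\times S_{j+1},\quad \tilde n_j=S_j\times P_j\ \ (1\le j\le n-1),\quad \tilde n_n=P_n .$$ For $u,v\perp w$ let $\alpha_w(u,v)\in\mathbb T=\mathbb R/2\pi\mathbb Z$ be the angle from $u$ to $v$, positively oriented with respect to $w$. On the set of regular configurations (all $\tilde\nu_j,\tilde n_j\neq0$) the variables ${\rm P}_*=(\Lambda,\chi,\Theta,\ell,\kappa,\vartheta)$ are given by the $\Lambda_i$, the mean anomalies $\ell_i$ and $$\chi_{j-1}=|S_j|,\qquad \kappa_{j-1}=\alpha_{S_j}(\tilde\nu_j,\tilde n_j)\qquad(1\le j\le n),$$ $$\Theta_0=S_1\cdot k^{(3)},\quad \vartheta_0=\alpha_{k^{(3)}}(k^{(1)},\tilde\nu_1),\qquad \Theta_{j}=S_{j+1}\cdot P_{j},\quad \vartheta_{j}=\alpha_{P_{j}}(\tilde n_{j},\tilde\nu_{j+1})\quad(1\le j\le n-1).$$ For $1\le i<j\le n$ let $$F^{(ij)}(\varepsilon)=-\frac{m_im_j}{(2\pi)^2}\int_{\mathbb T^2}\frac{d\ell_i\,d\ell_j}{|\varepsilon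 x_i(\ell_i)-x_j(\ell_j)|},\qquad (f^{(ij)})_{\rm av}=F^{(ij)}(1),\qquad (f^{(ij)})^{(2)}_{\rm av}=\frac1{2!}\frac{d^2}{d\varepsilon^2}F^{(ij)}(\varepsilon)\Big|_{\varepsilon=0}$$ ($(f^{(ij)})_{\rm av}$ is considered where the integral converges, in particular whenever the two orbits do not meet). "Depends only on certain variables" means: takes equal values at any two regular configurations at which these variables agree. Write $a\wedge b=\min(a,b)$. **Proposition.** For every configuration and all $1\le i<j\le n$ the function $F^{(ij)}$ is of class $C^2$ near $\varepsilon=0$, so that $(f^{(ij)})^{(2)}_{\rm av}$ is well defined, and: (i) For $1\le i<j\le n$, $(f^{(ij)})^{(2)}_{\rm av}$ and, more generally, $(f^{(ij)})_{\rm av}$ depend only on $\Lambda_i,\Lambda_j$, $\Theta_i,\dots,\Theta_{j\wedge(n-1)}$, $\chi_{i-1},\dots,\chi_{j\wedge(n-1)}$, $\kappa_i,\dots,\kappa_{j-1}$, $\vartheta_i,\dots,\vartheta_{j\wedge(n-1)}$. (ii) In particular, for $1\le i\le n-1$, $(f^{(i,i+1)})^{(2)}_{\rm av}$ and $(f^{(i,i+1)})_{\rm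 av}$ depend only on $\Lambda_i,\Lambda_{i+1}$, $\chi_{i-1},\chi_i,\chi_{(i+1)\wedge(n-1)}$, $\Theta_i,\Theta_{(i+1)\wedge(n-1)}$, $\kappa_i$, $\vartheta_i,\vartheta_{(i+1)\wedge(n-1)}$. (iii) $(f^{(n-1,n)})^{(2)}_{\rm av}$ depends only on $\Lambda_{n-1},\Lambda_n,\chi_{n-2},\chi_{n-1},\Theta_{n-1},\vartheta_{n-1}$; it does not depend on $\kappa_{n-1}$. (iv) $(f^{(n-1,n)})^{(2)}_{\rm av}$ is integrable in the sense of Liouville–Arnold. Precisely, let $K\subset\mathbb R^4$ be any compact set of values of $I=(\Lambda_{n-1},\Lambda_n,\chi_{n-2},\chi_{n-1})$ with $$0<\chi_{n-1}<\Lambda_n,\qquad 0<\chi_{n-2}-\chi_{n-1}<\Lambda_{n-1}.$$ Then there are an open set $A\supset K$ in $\mathbb R^4$, an open disc $B^2\subset\mathbb R^2$ centred at $0$, and a real-analytic, canonical change of coordinates $\phi_1$, $$\big(I,(\tilde\ell_{n-1},\tilde\ell_n,\tilde\kappa_{n-2},\tilde\kappa_{n-1}),(p,q)\big)\in A\times\mathbb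 T^4\times B^2\ \mapsto\ \big(I,(\ell_{n-1},\ell_n,\kappa_{n-2},\kappa_{n-1}),(\Theta_{n-1},\vartheta_{n-1})\big),$$ injective, leaving $I$ unchanged, acting on $\mathbb T^4$ through a lift that commutes with the translations by $2\pi\mathbb Z^4$, and satisfying $$\phi_1^*\big(d\Lambda_{n-1}\wedge d\ell_{n-1}+d\Lambda_n\wedge d\ell_n+d\chi_{n-2}\wedge d\kappa_{n-2}+d\chi_{n-1}\wedge d\kappa_{n-1}+d\Theta_{n-1}\wedge d\vartheta_{n-1}\big)$$ $$=d\Lambda_{n-1}\wedge d\tilde\ell_{n-1}+d\Lambda_n\wedge d\tilde\ell_n+d\chi_{n-2}\wedge d\tilde\kappa_{n-2}+d\chi_{n-1}\wedge d\tilde\kappa_{n-1}+dp\wedge dq ,$$ such that every point of its image is taken by the ${\rm P}_*$ variables at some regular configuration, $(p,q)=0$ holds if and only if $C_{n-1}$ and $C_n$ are parallel with the same direction, and $(f^{(n-1,n)})^{(2)}_{\rm av}\circ\phi_1$ is a function of $\Lambda_{n-1},\Lambda_n,\chi_{n-2},\chi_{n-1}$ and $\frac{p^2+q^2}{2}$ only.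 -/

import Mathlib

open Real
open scoped RealInnerProductSpace

noncomputable section

namespace PStar

/-- Physical space with its Euclidean norm and inner product. -/
abbrev E3 := EuclideanSpace ℝ (Fin 3)

/-- The vector product of Euclidean three-space. -/
def cross (u v : E3) : E3 := WithLp.toLp 2 (crossProduct u.ofLp v.ofLp)

/-- First vector of the prefixed orthonormal frame. -/
def frame1 : E3 := EuclideanSpace.single 0 1

/-- Third vector of the prefixed orthonormal frame. -/
def frame3 : E3 := EuclideanSpace.single 2 1

/-- For `u`, `v` orthogonal to `w ≠ 0`: the angle (mod `2π`) from `u` to `v`, counted positively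
according to the orientation fixed by `w`. Its cosine and sine are proportional, with the same
positive factor, to `⟪u, v⟫` and `⟪w / ‖w‖, u × v⟫`. -/
def angleAbout (w u v : E3) : Real.Angle :=
  ((Complex.arg ⟨‖w‖ * ⟪u, v⟫, ⟪w, cross u v⟫⟩ : ℝ) : Real.Angle)

/-! ### Kepler ellipses -/

/-- An oriented ellipse with a focus at the origin: semi-major axis `a`, eccentricity `e` in
`(0, 1)`, unit vector `P` from the focus to the perihelion, unit normal `N` of the orbital plane
(it gives the direction of revolution). -/
structure Ellipse where
  a : ℝ
  e : ℝ
  P : E3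
  N : E3
  a_pos : 0 < a
  e_pos : 0 < e
  e_lt_one : e < 1
  norm_P : ‖P‖ = 1
  norm_N : ‖N‖ = 1
  orth : ⟪P, N⟫ = 0

theorem exists_eccentricAnomaly (e l : ℝ) : ∃ E : ℝ, E - e * Real.sin E = l := by
  have hc : Continuous fun E : ℝ => E - e * Real.sin E := by fun_prop
  have hb : ∀ E : ℝ, |e * Real.sin E| ≤ |e| := fun E => by
    rw [abs_mul]
    exact mul_le_of_le_one_right (abs_nonneg e) (Real.abs_sin_le_one E)
  have h1 : (l - |e|) - e * Real.sin (l - |e|) ≤ l := by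
    have := (abs_le.1 (hb (l - |e|))).1
    linarith
  have h2 : l ≤ (l + |e|) - e * Real.sin (l + |e|) := by
    have := (abs_le.1 (hb (l + |e|))).2
    linarith
  exact mem_range_of_exists_le_of_exists_ge hc ⟨_, h1⟩ ⟨_, h2⟩

/-- The eccentric anomaly `E` of mean anomaly `l`: the solution of Kepler's equation
`E - e sin E = l` (it is unique for `0 ≤ e < 1`, see `kepler_strictMono`). -/
def eccentricAnomaly (e l : ℝ) : ℝ := Classical.choose (exists_eccentricAnomaly e l)

theorem eccentricAnomaly_spec (e l : ℝ) :
    eccentricAnomaly e l - e * Real.sin (eccentricAnomaly e l) = l :=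
  Classical.choose_spec (exists_eccentricAnomaly e l)

theorem kepler_hasDerivAt (e E : ℝ) :
    HasDerivAt (fun E : ℝ => E - e * Real.sin E) (1 - e * Real.cos E) E :=
  (hasDerivAt_id E).sub ((Real.hasDerivAt_sin E).const_mul e)

theorem kepler_deriv_pos {e : ℝ} (h0 : 0 ≤ e) (h1 : e < 1) (E : ℝ) :
    0 < 1 - e * Real.cos E := by
  nlinarith [Real.cos_le_one E]

theorem kepler_strictMono {e : ℝ} (h0 : 0 ≤ e) (h1 : e < 1) :
    StrictMono fun E : ℝ => E - e * Real.sin E :=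
  strictMono_of_deriv_pos fun E => by
    rw [(kepler_hasDerivAt e E).deriv]
    exact kepler_deriv_pos h0 h1 E

theorem eccentricAnomaly_continuous {e : ℝ} (h0 : 0 ≤ e) (h1 : e < 1) :
    Continuous (eccentricAnomaly e) := by
  have hs : Function.Surjective fun E : ℝ => E - e * Real.sin E :=
    fun l => exists_eccentricAnomaly e l
  let F := (kepler_strictMono h0 h1).orderIsoOfSurjective _ hs
  have hF : eccentricAnomaly e = F.symm := by
    funext l
    apply F.injective
    rw [OrderIso.apply_symm_apply]
    exact eccentricAnomaly_spec e l
  rw [hF]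
  exact F.symm.continuous

theorem eccentricAnomaly_hasDerivAt {e : ℝ} (h0 : 0 ≤ e) (h1 : e < 1) (l : ℝ) :
    HasDerivAt (eccentricAnomaly e) (1 - e * Real.cos (eccentricAnomaly e l))⁻¹ l :=
  HasDerivAt.of_local_left_inverse (eccentricAnomaly_continuous h0 h1).continuousAt
    (kepler_hasDerivAt e _) (kepler_deriv_pos h0 h1 _).ne'
    (Filter.Eventually.of_forall (eccentricAnomaly_spec e))

/-- The point of the ellipse with mean anomaly `l`. The area swept from the perihelion to it (in
the direction of revolution) is `a ^ 2 * √(1 - e ^ 2) * l / 2`, see `Ellipse.cross_pos_deriv`. -/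
def Ellipse.pos (o : Ellipse) (l : ℝ) : E3 :=
  (o.a * (Real.cos (eccentricAnomaly o.e l) - o.e)) • o.P +
    (o.a * √(1 - o.e ^ 2) * Real.sin (eccentricAnomaly o.e l)) • cross o.N o.P

/-- The law of areas: the areal velocity with respect to the mean anomaly is constant. -/
theorem Ellipse.cross_pos_deriv (o : Ellipse) (l : ℝ) :
    cross (o.pos l) (deriv o.pos l) = (o.a ^ 2 * √(1 - o.e ^ 2)) • o.N := by
  have hE := eccentricAnomaly_hasDerivAt o.e_pos.le o.e_lt_one l
  have hd := kepler_deriv_pos o.e_pos.le o.e_lt_one (eccentricAnomaly o.e l)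
  have hder := ((((hE.cos).sub_const o.e).const_mul o.a).smul_const o.P).add
    (((hE.sin).const_mul (o.a * √(1 - o.e ^ 2))).smul_const (cross o.N o.P))
  have hpos : deriv o.pos l = _ := HasDerivAt.deriv (f := o.pos) hder
  rw [hpos]
  have hP : o.P 0 ^ 2 + o.P 1 ^ 2 + o.P 2 ^ 2 = 1 := by
    have := o.norm_P
    rw [EuclideanSpace.norm_eq, Real.sqrt_eq_one] at this
    simpa [Fin.sum_univ_three] using this
  have hO : o.P 0 * o.N 0 + o.P 1 * o.N 1 + o.P 2 * o.N 2 = 0 := by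
    have := o.orth
    simp [PiLp.inner_apply, Fin.sum_univ_three] at this
    linarith
  unfold Ellipse.pos
  set E := eccentricAnomaly o.e l
  set b := √(1 - o.e ^ 2)
  have hcs := Real.sin_sq_add_cos_sq E
  have key : ∀ x y z w : ℝ, cross (x • o.P + y • cross o.N o.P) (z • o.P + w • cross o.N o.P) =
      (x * w - y * z) • o.N := by
    intro x y z w
    ext i
    fin_cases i
    · simp [cross, crossProduct, Matrix.vecHead, Matrix.vecTail]
      linear_combination ((x * w - y * z) * o.N 0) * hP - ((x * w - y * z) * o.P 0) * hO
    · simp [cross, crossProduct, Matrix.vecHead, Matrix.vecTail]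
      linear_combination ((x * w - y * z) * o.N 1) * hP - ((x * w - y * z) * o.P 1) * hO
    · simp [cross, crossProduct, Matrix.vecHead, Matrix.vecTail]
      linear_combination ((x * w - y * z) * o.N 2) * hP - ((x * w - y * z) * o.P 2) * hO
  rw [key]
  congr 1
  have hi := inv_mul_cancel₀ hd.ne'
  linear_combination (o.a ^ 2 * b * (1 - o.e * Real.cos E)⁻¹) * hcs + (o.a ^ 2 * b) * hi

/-! ### The planetary system -/

/-- The mass parameters: `m i` are the masses in the Newtonian interaction, `mr i`, `Mr i` are the
reduced masses of the two-body terms `|y|² / (2 mr) - mr Mr / |x|`. In the planetary problem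
`mr i = m₀ m i / (m₀ + μ m i)` and `Mr i = m₀ + μ m i`. The planets are numbered `1, …, n`. -/
structure MassData where
  m : ℕ → ℝ
  mr : ℕ → ℝ
  Mr : ℕ → ℝ
  m_pos : ∀ i, 0 < m i
  mr_pos : ∀ i, 0 < mr i
  Mr_pos : ∀ i, 0 < Mr i

/-- An assignment of ellipses with common focus to the planets; only those numbered `1, …, n`
are used. -/
abbrev Config := ℕ → Ellipse

namespace MassData

variable (D : MassData)

/-- The momentum conjugated to the position of the planet `i`. -/
def mom (s : Config) (i : ℕ) (l : ℝ) : E3 :=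
  (D.mr i * √(D.Mr i / (s i).a ^ 3)) • deriv (s i).pos l

/-- The action `Λ_i`. -/
def Lam (s : Config) (i : ℕ) : ℝ := D.mr i * √(D.Mr i * (s i).a)

/-- The angular momentum of the planet `i`; it is `x × y` at every mean anomaly, see
`cross_pos_mom`. -/
def angMom (s : Config) (i : ℕ) : E3 := (D.Lam s i * √(1 - (s i).e ^ 2)) • (s i).N

/-- The angular momentum is `x × y`. -/
theorem cross_pos_mom (s : Config) (i : ℕ) (l : ℝ) :
    cross ((s i).pos l) (D.mom s i l) = D.angMom s i := by
  have ha := (s i).a_pos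
  have h : cross ((s i).pos l) (D.mom s i l) =
      (D.mr i * √(D.Mr i / (s i).a ^ 3)) • cross ((s i).pos l) (deriv (s i).pos l) := by
    simp [mom, cross]
  have h2 : √(D.Mr i / (s i).a ^ 3) * (s i).a ^ 2 = √(D.Mr i * (s i).a) := by
    rw [← Real.sqrt_sq (sq_nonneg (s i).a), ← Real.sqrt_mul (by have := D.Mr_pos i; positivity)]
    congr 1
    field_simp
  rw [h, Ellipse.cross_pos_deriv, smul_smul, angMom, Lam, ← h2]
  congr 1
  ring

/-- The partial sum of the angular momenta of the planets `j, …, n`. -/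
def S (n : ℕ) (s : Config) (j : ℕ) : E3 := ∑ k ∈ Finset.Icc j n, D.angMom s k

/-- The nodes `ν_1 = k × S_1` and `ν_j = P_{j-1} × S_j` for `2 ≤ j ≤ n`. -/
def nodeNu (n : ℕ) (s : Config) (j : ℕ) : E3 :=
  if j = 1 then cross frame3 (D.S n s 1) else cross (s (j - 1)).P (D.S n s j)

/-- The nodes `n_j = S_j × P_j` for `1 ≤ j ≤ n - 1` and `n_n = P_n`. -/
def nodeN (n : ℕ) (s : Config) (j : ℕ) : E3 :=
  if j = n then (s n).P else cross (D.S n s j) (s j).P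

/-- The configurations at which the variables `P_*` are defined: no node vanishes. -/
def Regular (n : ℕ) (s : Config) : Prop :=
  ∀ j, 1 ≤ j → j ≤ n → D.nodeNu n s j ≠ 0 ∧ D.nodeN n s j ≠ 0

/-- The actions `χ_0, …, χ_{n-1}`. -/
def chi (n : ℕ) (s : Config) (j : ℕ) : ℝ := ‖D.S n s (j + 1)‖

/-- The actions `Θ_0, …, Θ_{n-1}`. -/
def Theta (n : ℕ) (s : Config) (j : ℕ) : ℝ :=
  if j = 0 then ⟪D.S n s 1, frame3⟫ else ⟪D.S n s (j + 1), (s j).P⟫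

/-- The angles `κ_0, …, κ_{n-1}`, conjugated to `χ`. -/
def kappa (n : ℕ) (s : Config) (j : ℕ) : Real.Angle :=
  angleAbout (D.S n s (j + 1)) (D.nodeNu n s (j + 1)) (D.nodeN n s (j + 1))

/-- The angles `ϑ_0, …, ϑ_{n-1}`, conjugated to `Θ`. -/
def vartheta (n : ℕ) (s : Config) (j : ℕ) : Real.Angle :=
  if j = 0 then angleAbout frame3 frame1 (D.nodeNu n s 1)
  else angleAbout (s j).P (D.nodeN n s j) (D.nodeNu n s (j + 1))

/-- The average over both mean anomalies of `- m_i m_j / |ε x_i - x_j|`. -/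
def newtonAv (s : Config) (i j : ℕ) (ε : ℝ) : ℝ :=
  -(D.m i * D.m j) / (2 * π) ^ 2 *
    ∫ li in (0 : ℝ)..2 * π, ∫ lj in (0 : ℝ)..2 * π, 1 / ‖ε • (s i).pos li - (s j).pos lj‖

/-- The averaged Newtonian interaction of the planets `i` and `j`. -/
def fAv (s : Config) (i j : ℕ) : ℝ := D.newtonAv s i j 1

/-- The term of order `k` in the expansion of the averaged interaction. -/
def fAvOrder (k : ℕ) (s : Config) (i j : ℕ) : ℝ :=
  1 / (k.factorial : ℝ) * iteratedDeriv k (D.newtonAv s i j) 0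

end MassData

/-! ### Ten-dimensional phase space of the two outermost planets -/

/-- Points `(I, φ, (u, v))`: four actions, (lifts to the line of) four angles, and a further
conjugated pair. -/
abbrev Phase := (Fin 4 → ℝ) × (Fin 4 → ℝ) × ℝ × ℝ

/-- The standard two-form `∑ dI_k ∧ dφ_k + du ∧ dv`. -/
def symplForm (z w : Phase) : ℝ :=
  (∑ k, (z.1 k * w.2.1 k - z.2.1 k * w.1 k)) + (z.2.2.1 * w.2.2.2 - z.2.2.2 * w.2.2.1)

/-- The set `A × ℝ⁴ × B`, with `B` the open disc of radius `r` about the origin (a periodic map on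
it stands for a map on `A × 𝕋⁴ × B`). -/
def phaseDomain (A : Set (Fin 4 → ℝ)) (r : ℝ) : Set Phase :=
  {z | z.1 ∈ A ∧ z.2.2.1 ^ 2 + z.2.2.2 ^ 2 < r ^ 2}

/-- Two tuples of reals represent the same point of the torus `(ℝ / 2πℤ)⁴`. -/
def SameAngles (φ ψ : Fin 4 → ℝ) : Prop := ∀ k, (φ k : Real.Angle) = (ψ k : Real.Angle)

/-- `Φ` is (the lift of) a real-analytic canonical change of coordinates
`(I, φ', (p, q)) ↦ (I, φ, (u, v))` on `A × 𝕋⁴ × B`, with the `φ` and `v` understood mod `2π`. -/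
structure IsCanonicalChange (A : Set (Fin 4 → ℝ)) (r : ℝ) (Φ : Phase → Phase) : Prop where
  analytic : AnalyticOnNhd ℝ Φ (phaseDomain A r)
  canonical : ∀ z ∈ phaseDomain A r, ∀ u v : Phase,
    symplForm (fderiv ℝ Φ z u) (fderiv ℝ Φ z v) = symplForm u v
  actions : ∀ z ∈ phaseDomain A r, (Φ z).1 = z.1
  periodic : ∀ z ∈ phaseDomain A r, ∀ k : Fin 4 → ℤ,
    Φ (z + (0, (fun i => 2 * π * (k i : ℝ)), 0, 0)) =
      Φ z + (0, (fun i => 2 * π * (k i : ℝ)), 0, 0)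
  injective : ∀ z ∈ phaseDomain A r, ∀ z' ∈ phaseDomain A r,
    (Φ z).1 = (Φ z').1 → SameAngles (Φ z).2.1 (Φ z').2.1 → (Φ z).2.2.1 = (Φ z').2.2.1 →
    ((Φ z).2.2.2 : Real.Angle) = ((Φ z').2.2.2 : Real.Angle) →
    z.1 = z'.1 ∧ SameAngles z.2.1 z'.2.1 ∧ z.2.2 = z'.2.2

/-- The variables `P_*` of the configuration `s` relative to the two outermost planets are
`w = ((Λ_{n-1}, Λ_n, χ_{n-2}, χ_{n-1}), (ℓ_{n-1}, ℓ_n, κ_{n-2}, κ_{n-1}), (Θ_{n-1}, ϑ_{n-1}))`. The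
mean anomalies `ℓ` give the places on the ellipses, so that `s` puts no condition on them. -/
def MassData.HasCoords (D : MassData) (n : ℕ) (s : Config) (w : Phase) : Prop :=
  D.Lam s (n - 1) = w.1 0 ∧ D.Lam s n = w.1 1 ∧
  D.chi n s (n - 2) = w.1 2 ∧ D.chi n s (n - 1) = w.1 3 ∧
  D.kappa n s (n - 2) = (w.2.1 2 : Real.Angle) ∧ D.kappa n s (n - 1) = (w.2.1 3 : Real.Angle) ∧
  D.Theta n s (n - 1) = w.2.2.1 ∧ D.vartheta n s (n - 1) = (w.2.2.2 : Real.Angle)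

/-- The values of `(Λ_{n-1}, Λ_n, χ_{n-2}, χ_{n-1})` for which the configuration with parallel
`C_{n-1}`, `C_n` (where `|C_{n-1}| = χ_{n-2} - χ_{n-1}` and `|C_n| = χ_{n-1}`) consists of ellipses
with eccentricities in `(0, 1)`. -/
def admissibleActions : Set (Fin 4 → ℝ) :=
  {I | 0 < I 3 ∧ I 3 < I 1 ∧ 0 < I 2 - I 3 ∧ I 2 - I 3 < I 0}

end PStar

end

/-! Dependence on few variables. The average is invariant under rotations of space, so it suffices
that the listed variables fix the two ellipses up to a common rotation. The nodes form a chain: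
`Θ_k` and `χ` give the lengths of `n_k` and `ν_{k+1}`, `ϑ_k` carries `(P_k, S_k)` to `S_{k+1}`, and
`κ_k` carries `(P_k, S_{k+1})` to `P_{k+1}`. A rotation matching `P_i` and `S_i` therefore matches
everything up to `S_{j+1}` (`exists_isRot_initial`, `map_S_succ`, `map_P_succ`, `newtonAv_eq`). The
angular momenta are differences of consecutive `S_k`, and with `Λ` they fix the ellipses.

The coefficient of order two. For a small dilation factor the orbits stay apart, the integrand is
analytic, and one may differentiate under both integrals. The quadrupole term is quadratic in the
unit vector towards the outer planet, and its average over the outer ellipse is isotropic in the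
plane of that ellipse: only the normal survives, not the perihelion (`integral_kernelDeriv₂`). Hence
`κ_{n-1}` drops out, and `fAvOrder_two_eq_quadShape` expresses the coefficient through `Λ`, `χ`,
`Θ_{n-1}` and `cos ϑ_{n-1}`.

Integrability. With the other actions as parameters this is a Hamiltonian with one degree of freedom
in `(Θ, ϑ)`. At `(0, π)`, where `C_{n-1}` and `C_n` have the same direction, it has an elliptic
equilibrium: up to a factor and an additive term depending on the actions it is `|g|²` for an
analytic local diffeomorphism `g` of the plane (`quadShape_eq`, `fiberDet_quadMap_pos`). To make the
inverse of `g` area-preserving without spoiling the circles, it is composed with the inverse of a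
map which has the same Jacobian and sends circles about the origin to circles. In polar coordinates
this map is explicit: the radius comes from the mean of the Jacobian over discs, the angle from its
primitive along circles (`areaMap`, `fiberDet_areaMap`, `exists_action_coordinates`). All of it is
analytic up to the origin and uniform over the compact set of parameters. Finally, an
area-preserving family becomes canonical in all variables after a shift of the angles conjugated to
the parameters, obtained from the Poincaré lemma along the fibres (`exists_canonical_lift`). That
the image consists of genuine configurations is `exists_hasCoords`. -/

noncomputable section

namespace PStar

/-! ### Integrals of analytic functions depending on parameters -/

section ParametricIntegral

open Set Filter Topology MeasureTheory
open scoped NNReal ENNReal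

variable {E F : Type*} [NormedAddCommGroup E] [NormedSpace ℝ E] [NormedAddCommGroup F]
  [NormedSpace ℝ F] [CompleteSpace F]

/-- The power series of `f` can be recentred at `(t, x₀)` for all `t` near `t₀`, with bounds on the
coefficients uniform in `t`. The integrals of these coefficients then form a power series for the
integral. -/
theorem analyticAt_integral_of_near {f : ℝ × E → F} {t₀ : ℝ} {x₀ : E}
    (hf : AnalyticAt ℝ f (t₀, x₀)) :
    ∃ δ > 0, ∀ a b, |a - t₀| < δ → |b - t₀| < δ →
      AnalyticAt ℝ (fun x => ∫ t in a..b, f (t, x)) x₀ := by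
  obtain ⟨p, r, hp⟩ := hf
  -- Twice `ρ` has to fit: once for moving the centre in `t`, once for the increment in `x`.
  obtain ⟨ρ, hρ0, hρ⟩ : ∃ ρ : ℝ≥0, 0 < ρ ∧ (ρ : ℝ≥0∞) + ρ < r := by
    obtain ⟨s, hs0, hs⟩ := ENNReal.lt_iff_exists_nnreal_btwn.1 hp.r_pos
    refine ⟨s / 2, by simpa using hs0, ?_⟩
    rw [← ENNReal.coe_add, add_halves]
    exact hs
  have hρp : (ρ : ℝ≥0∞) + ρ < p.radius := hρ.trans_le hp.r_le
  have hρr : (ρ : ℝ≥0∞) < p.radius := lt_of_le_of_lt le_self_add hρp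
  refine ⟨ρ, hρ0, fun a b ha hb => ?_⟩
  -- `q t` is the expansion of `f (t, ·)` at `x₀`; `c n` below bounds its coefficients for every
  -- admissible `t`.
  let q : ℝ → FormalMultilinearSeries ℝ E F := fun t n =>
    (p.changeOrigin (t - t₀, (0 : E)) n).compContinuousLinearMap
      fun _ => ContinuousLinearMap.inr ℝ ℝ E
  let c : ℕ → ℝ≥0 := fun n =>
    (∑' s : Σ l : ℕ, { s : Finset (Fin (n + l)) // s.card = l }, ‖p (n + s.1)‖₊ * ρ ^ s.1)
  have hc : Summable fun n => c n * ρ ^ n := by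
    have h := p.changeOriginSeries_summable_aux₁ hρp
    have := (NNReal.summable_sigma.1 h).2
    refine this.congr fun n => ?_
    exact NNReal.tsum_mul_right
      (fun s : Σ l : ℕ, { s : Finset (Fin (n + l)) // s.card = l } => ‖p (n + s.1)‖₊ * ρ ^ s.1)
      (ρ ^ n)
  have hnorm : ∀ t, |t - t₀| < ρ → ‖((t - t₀, (0 : E)) : ℝ × E)‖₊ ≤ ρ := by
    intro t ht
    rw [← NNReal.coe_le_coe, coe_nnnorm, Prod.norm_def]
    simpa using ht.le
  have hq : ∀ t, |t - t₀| < ρ → ∀ n, ‖q t n‖ ≤ c n := by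
    intro t ht n
    have h1 : ‖q t n‖ ≤ ‖p.changeOrigin (t - t₀, (0 : E)) n‖ := by
      refine (ContinuousMultilinearMap.norm_compContinuousLinearMap_le _ _).trans ?_
      refine mul_le_of_le_one_right (norm_nonneg _) ?_
      refine Finset.prod_le_one (fun _ _ => norm_nonneg _) fun _ _ => ?_
      exact ContinuousLinearMap.norm_inr_le_one ℝ ℝ E
    have h2 := p.nnnorm_changeOrigin_le (x := (t - t₀, (0 : E))) n
      (lt_of_le_of_lt (by exact_mod_cast hnorm t ht) hρr)
    refine h1.trans ?_
    rw [← coe_nnnorm, NNReal.coe_le_coe]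
    refine h2.trans ?_
    refine Summable.tsum_le_tsum (fun s => ?_)
      (p.changeOriginSeries_summable_aux₂ (lt_of_le_of_lt (by exact_mod_cast hnorm t ht) hρr) n)
      (p.changeOriginSeries_summable_aux₂ hρr n)
    gcongr
    exact hnorm t ht
  have huI : ∀ t ∈ uIcc a b, |t - t₀| < ρ := by
    intro t ht
    have : uIcc a b ⊆ Metric.ball t₀ ρ := by
      refine (convex_ball t₀ (ρ : ℝ)).ordConnected.uIcc_subset ?_ ?_
      · simpa [Real.dist_eq] using ha
      · simpa [Real.dist_eq] using hb
    simpa [Real.dist_eq] using this ht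
  have hqc : ∀ n, ContinuousOn (fun t => q t n) (uIcc a b) := by
    intro n
    have h1 := (p.hasFPowerSeriesOnBall_changeOrigin n (lt_of_le_of_lt zero_le hρr)).continuousOn
    have h2 : ContinuousOn (fun t : ℝ => p.changeOrigin (t - t₀, (0 : E)) n) (uIcc a b) := by
      refine h1.comp (f := fun t : ℝ => (t - t₀, (0 : E))) (by fun_prop) fun t ht => ?_
      rw [Metric.mem_eball, edist_zero_right]
      refine lt_of_le_of_lt ?_ hρr
      have := hnorm t (huI t ht)
      exact_mod_cast this
    exact (ContinuousMultilinearMap.compContinuousLinearMapL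
      (fun _ : Fin n => ContinuousLinearMap.inr ℝ ℝ E)).continuous.comp_continuousOn h2
  let Q : FormalMultilinearSeries ℝ E F := fun n => ∫ t in a..b, q t n
  have hQ : ∀ n (y : E), Q n (fun _ => y) = ∫ t in a..b, q t n (fun _ => y) := fun n y =>
    ((ContinuousMultilinearMap.apply ℝ (fun _ : Fin n => E) F
      fun _ => y).intervalIntegral_comp_comm (hqc n).intervalIntegrable).symm
  refine ⟨Q, ρ, ?_, by exact_mod_cast hρ0, fun {y} hy => ?_⟩
  · obtain ⟨C, hC⟩ : ∃ C, ∀ n, ((c n * ρ ^ n : ℝ≥0) : ℝ) ≤ C :=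
      ⟨∑' n, ((c n * ρ ^ n : ℝ≥0) : ℝ), fun n =>
        (NNReal.summable_coe.2 hc).le_tsum n fun _ _ => NNReal.coe_nonneg _⟩
    refine Q.le_radius_of_bound (C * |b - a|) fun n => ?_
    have h1 : ‖Q n‖ ≤ c n * |b - a| :=
      intervalIntegral.norm_integral_le_of_norm_le_const fun t ht =>
        hq t (huI t (uIoc_subset_uIcc ht)) n
    have h2 := hC n
    push_cast at h2
    calc ‖Q n‖ * (ρ : ℝ) ^ n ≤ (c n * |b - a|) * (ρ : ℝ) ^ n := by gcongr
      _ = (c n * (ρ : ℝ) ^ n) * |b - a| := by ring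
      _ ≤ C * |b - a| := by gcongr
  · have hy' : ‖y‖₊ < ρ := by
      rw [Metric.mem_eball, edist_zero_right] at hy
      exact_mod_cast hy
    simp_rw [hQ]
    refine intervalIntegral.hasSum_integral_of_dominated_convergence
      (fun n _ => ((c n * ρ ^ n : ℝ≥0) : ℝ)) (fun n => ?_) (fun n => ?_) ?_ ?_ ?_
    · refine ContinuousOn.aestronglyMeasurable ?_ measurableSet_uIoc
      exact ((ContinuousMultilinearMap.apply ℝ (fun _ : Fin n => E) F
        fun _ => y).continuous.comp_continuousOn (hqc n)).mono uIoc_subset_uIcc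
    · refine Eventually.of_forall fun t ht => ?_
      refine ((q t n).le_opNorm _).trans ?_
      simp only [Finset.prod_const, Finset.card_univ, Fintype.card_fin]
      push_cast
      gcongr
      · exact hq t (huI t (uIoc_subset_uIcc ht)) n
      · exact_mod_cast hy'.le
    · exact Eventually.of_forall fun t ht => NNReal.summable_coe.2 hc
    · exact intervalIntegrable_const
    · refine Eventually.of_forall fun t ht => ?_
      have hn := hnorm t (huI t (uIoc_subset_uIcc ht))
      have h1 := hp.changeOrigin (y := (t - t₀, (0 : E)))
        (lt_of_le_of_lt (by exact_mod_cast hn) (lt_of_le_of_lt le_self_add hρ))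
      have h2 := h1.hasSum (y := ((0 : ℝ), y)) (by
        rw [Metric.mem_eball, edist_zero_right]
        have e1 : ‖((0 : ℝ), y)‖ₑ ≤ ρ := by
          have : ‖((0 : ℝ), y)‖₊ ≤ ρ := by
            rw [Prod.nnnorm_def]
            simpa using hy'.le
          exact_mod_cast this
        refine lt_of_le_of_lt e1 (lt_tsub_iff_right.2 (lt_of_le_of_lt ?_ hρ))
        gcongr)
      have e : ((t₀, x₀) + (t - t₀, (0 : E)) + ((0 : ℝ), y) : ℝ × E) = (t, x₀ + y) := by
        ext <;> simp
      rw [e] at h2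
      exact h2

theorem eventually_forall_Icc_analyticAt {f : ℝ × E → F} {a b : ℝ} {x₀ : E}
    (hf : ∀ t ∈ Icc a b, AnalyticAt ℝ f (t, x₀)) :
    ∀ᶠ x in 𝓝 x₀, ∀ t ∈ Icc a b, AnalyticAt ℝ f (t, x) := by
  refine isCompact_Icc.eventually_forall_of_forall_eventually fun t ht => ?_
  have h1 := (hf t ht).eventually_analyticAt
  have h2 : Tendsto (fun z : E × ℝ => (z.2, z.1)) (𝓝 (x₀, t)) (𝓝 (t, x₀)) :=
    Continuous.tendsto' (by fun_prop) _ _ rfl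
  exact h2.eventually h1

/-- Integrating a jointly analytic function over a compact interval gives an analytic function of
the remaining variables. -/
theorem analyticAt_intervalIntegral {f : ℝ × E → F} {a b : ℝ} (hab : a ≤ b) {x₀ : E}
    (hf : ∀ t ∈ Icc a b, AnalyticAt ℝ f (t, x₀)) :
    AnalyticAt ℝ (fun x => ∫ t in a..b, f (t, x)) x₀ := by
  have hloc : ∀ t : Icc a b, ∃ δ : ℝ, 0 < δ ∧ ∀ c d : ℝ, |c - t| < δ → |d - t| < δ →
      AnalyticAt ℝ (fun x => ∫ s in c..d, f (s, x)) x₀ := fun t =>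
    analyticAt_integral_of_near (hf t t.2)
  choose δ hδ0 hδ using hloc
  -- A subdivision finer than the local cover; it is constantly `b` from the index `m` on.
  obtain ⟨t, ht0, htm, ⟨m, hm⟩, ht⟩ := exists_monotone_Icc_subset_open_cover_Icc hab
    (c := fun t : Icc a b => Metric.ball t (δ t)) (fun t => Metric.isOpen_ball)
    (fun t _ => mem_iUnion.2 ⟨t, Metric.mem_ball_self (hδ0 t)⟩)
  have hint : ∀ᶠ x in 𝓝 x₀, ∀ c ∈ Icc a b, ∀ d ∈ Icc a b,
      IntervalIntegrable (fun s => f (s, x)) volume c d := by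
    filter_upwards [eventually_forall_Icc_analyticAt hf] with x hx c hc d hd
    refine ContinuousOn.intervalIntegrable fun s hs => ?_
    have h1 := (hx s (ordConnected_Icc.uIcc_subset hc hd hs)).continuousAt
    have h2 : ContinuousAt (fun s => f (s, x)) s :=
      ContinuousAt.comp (f := fun s : ℝ => (s, x)) h1 (by fun_prop)
    exact h2.continuousWithinAt
  have key : ∀ k, AnalyticAt ℝ (fun x => ∫ s in a..(t k), f (s, x)) x₀ := by
    intro k
    induction k with
    | zero =>
      have : (t 0 : ℝ) = a := by rw [ht0]
      rw [this]
      simpa using analyticAt_const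
    | succ k ih =>
      obtain ⟨i, hi⟩ := ht k
      have h1 : AnalyticAt ℝ (fun x => ∫ s in (t k : ℝ)..(t (k + 1)), f (s, x)) x₀ := by
        refine hδ i _ _ ?_ ?_
        · exact hi (left_mem_Icc.2 (htm k.le_succ))
        · exact hi (right_mem_Icc.2 (htm k.le_succ))
      refine (ih.add h1).congr ?_
      filter_upwards [hint] with x hx
      exact intervalIntegral.integral_add_adjacent_intervals
        (hx _ (left_mem_Icc.2 hab) _ (t k).2) (hx _ (t k).2 _ (t (k + 1)).2)
  have := key m
  rwa [hm m le_rfl] at this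

/-- Differentiation under the integral sign for jointly analytic integrands. -/
theorem hasFDerivAt_intervalIntegral {f : ℝ × E → F} {a b : ℝ} (hab : a ≤ b) {x₀ : E}
    (hf : ∀ t ∈ Icc a b, AnalyticAt ℝ f (t, x₀)) :
    HasFDerivAt (fun x => ∫ t in a..b, f (t, x))
      (∫ t in a..b, (fderiv ℝ f (t, x₀)).comp (ContinuousLinearMap.inr ℝ ℝ E)) x₀ := by
  have hev := eventually_forall_Icc_analyticAt hf
  have hfd : ∀ t ∈ Icc a b, ∀ᶠ z : E × ℝ in 𝓝 (x₀, t),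
      ‖fderiv ℝ f (z.2, z.1)‖ < ‖fderiv ℝ f (t, x₀)‖ + 1 := by
    intro t ht
    have h1 : ContinuousAt (fun z => ‖fderiv ℝ f z‖) (t, x₀) := (hf t ht).fderiv.continuousAt.norm
    have h2 : Tendsto (fun z : E × ℝ => (z.2, z.1)) (𝓝 (x₀, t)) (𝓝 (t, x₀)) :=
      Continuous.tendsto' (by fun_prop) _ _ rfl
    exact h2.eventually (h1.eventually (gt_mem_nhds (by simp)))
  have hcf : ContinuousOn (fun t => fderiv ℝ f (t, x₀)) (Icc a b) := fun t ht => by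
    have h2 : ContinuousAt (fun s => fderiv ℝ f (s, x₀)) t :=
      ContinuousAt.comp (f := fun s : ℝ => (s, x₀)) (hf t ht).fderiv.continuousAt (by fun_prop)
    exact h2.continuousWithinAt
  obtain ⟨C, hC⟩ := isCompact_Icc.exists_bound_of_continuousOn hcf
  -- Compactness of the interval makes the bound, hence the dominating constant, uniform in `t` on
  -- one neighbourhood of `x₀`.
  have hbd : ∀ᶠ x in 𝓝 x₀, ∀ t ∈ Icc a b, ‖fderiv ℝ f (t, x)‖ ≤ C + 1 := by
    refine isCompact_Icc.eventually_forall_of_forall_eventually fun t ht => ?_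
    filter_upwards [hfd t ht] with z hz
    linarith [hC t ht]
  have hsub : uIoc a b ⊆ Icc a b := by
    rw [uIoc_of_le hab]
    exact Ioc_subset_Icc_self
  have hcont : ∀ x, (∀ t ∈ Icc a b, AnalyticAt ℝ f (t, x)) →
      ContinuousOn (fun s => f (s, x)) (Icc a b) := fun x hx t ht => by
    have h2 : ContinuousAt (fun s => f (s, x)) t :=
      ContinuousAt.comp (f := fun s : ℝ => (s, x)) (hx t ht).continuousAt (by fun_prop)
    exact h2.continuousWithinAt
  refine intervalIntegral.hasFDerivAt_integral_of_dominated_of_fderiv_le (𝕜 := ℝ)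
    (F := fun x t => f (t, x))
    (F' := fun x t => (fderiv ℝ f (t, x)).comp (ContinuousLinearMap.inr ℝ ℝ E))
    (bound := fun _ => C + 1) (hev.and hbd) ?_ ?_ ?_ ?_ ?_ ?_
  · filter_upwards [hev] with x hx
    exact ((hcont x hx).mono hsub).aestronglyMeasurable measurableSet_uIoc
  · refine ContinuousOn.intervalIntegrable ?_
    rw [uIcc_of_le hab]
    exact hcont x₀ hf
  · refine ContinuousOn.aestronglyMeasurable ?_ measurableSet_uIoc
    exact (hcf.mono hsub).clm_comp continuousOn_const
  · refine Eventually.of_forall fun t ht x hx => ?_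
    refine (ContinuousLinearMap.opNorm_comp_le _ _).trans ?_
    refine (mul_le_of_le_one_right (norm_nonneg _)
      (ContinuousLinearMap.norm_inr_le_one ℝ ℝ E)).trans (hx.2 t (hsub ht))
  · exact intervalIntegrable_const
  · refine Eventually.of_forall fun t ht x hx => ?_
    have h1 := (hx.1 t (hsub ht)).differentiableAt.hasFDerivAt
    have h2 : HasFDerivAt (fun x : E => (t, x)) (ContinuousLinearMap.inr ℝ ℝ E) x :=
      hasFDerivAt_prodMk_right t x
    exact h1.comp x h2

end ParametricIntegral

/-! ### Fibrewise inversion of analytic families of maps -/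

section FibrewiseInverse

open Set Filter Topology

variable {P F : Type*} [NormedAddCommGroup P] [NormedSpace ℝ P] [CompleteSpace P]
  [NormedAddCommGroup F] [NormedSpace ℝ F] [CompleteSpace F]

/-- An analytic family of maps fixing the origin, with invertible differentials, has an analytic
family of local inverses defined on balls of the same radius over a neighbourhood of a compact set
of parameters. -/
theorem exists_fibrewise_inverse {K : Set P} (hK : IsCompact K) {W : Set (P × F)}
    (hW : IsOpen W) (hKW : ∀ I ∈ K, (I, (0 : F)) ∈ W) {g : P × F → F}
    (hg : AnalyticOnNhd ℝ g W) (h0 : ∀ I, (I, (0 : F)) ∈ W → g (I, 0) = 0)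
    (hinv : ∀ z ∈ W, ∃ L : F ≃L[ℝ] F,
      (fderiv ℝ g z).comp (ContinuousLinearMap.inr ℝ P F) = L) :
    ∃ (A : Set P) (r : ℝ) (τ : P × F → F), IsOpen A ∧ K ⊆ A ∧ 0 < r ∧
      AnalyticOnNhd ℝ τ (A ×ˢ Metric.ball 0 r) ∧
      (∀ I ∈ A, ∀ w ∈ Metric.ball (0 : F) r, (I, τ (I, w)) ∈ W ∧ g (I, τ (I, w)) = w) ∧
      ∀ I ∈ A, τ (I, 0) = 0 := by
  -- The parameters are kept as coordinates, so that `dG` is block triangular and the inverse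
  -- function theorem applies to `G`.
  let G : P × F → P × F := fun z => (z.1, g z)
  have hGa : ∀ z ∈ W, AnalyticAt ℝ G z := fun z hz => analyticAt_fst.prod (hg z hz)
  have hGd : ∀ z ∈ W, ∃ e : (P × F) ≃L[ℝ] (P × F), HasFDerivAt G (e : P × F →L[ℝ] P × F) z := by
    intro z hz
    obtain ⟨L, hL⟩ := hinv z hz
    refine ⟨ContinuousLinearEquiv.skewProd (ContinuousLinearEquiv.refl ℝ P) L
      ((fderiv ℝ g z).comp (ContinuousLinearMap.inl ℝ P F)), ?_⟩
    have h1 : HasFDerivAt G ((ContinuousLinearMap.fst ℝ P F).prod (fderiv ℝ g z)) z :=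
      hasFDerivAt_fst.prodMk (hg z hz).differentiableAt.hasFDerivAt
    convert h1 using 1
    refine ContinuousLinearMap.ext fun v => Prod.ext ?_ ?_
    · simp
    · have := congrArg (fun T : F →L[ℝ] F => T v.2) hL
      obtain ⟨v1, v2⟩ := v
      simp only [ContinuousLinearMap.comp_apply, ContinuousLinearMap.inr_apply,
        ContinuousLinearEquiv.coe_coe] at this
      have e : ((v1, v2) : P × F) = (v1, 0) + (0, v2) := by simp
      have e2 : fderiv ℝ g z (v1, v2) = fderiv ℝ g z (v1, 0) + fderiv ℝ g z (0, v2) := by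
        rw [← map_add, ← e]
      simp [ContinuousLinearEquiv.skewProd_apply, e2, this, add_comm]
  have hGs : ∀ z ∈ W, ∀ e : (P × F) ≃L[ℝ] (P × F),
      HasFDerivAt G (e : P × F →L[ℝ] P × F) z →
      HasStrictFDerivAt G (e : P × F →L[ℝ] P × F) z := by
    intro z hz e he
    have := (hGa z hz).hasStrictFDerivAt
    rwa [he.fderiv] at this
  set Z : Set (P × F) := (fun I => (I, (0 : F))) '' K with hZ
  have hZc : IsCompact Z := hK.image (by fun_prop)
  have hZW : Z ⊆ W := by
    rintro _ ⟨I, hI, rfl⟩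
    exact hKW I hI
  have hZinj : InjOn G Z := by
    rintro _ ⟨I, hI, rfl⟩ _ ⟨I', hI', rfl⟩ h
    have : I = I' := congrArg Prod.fst h
    rw [this]
  -- Injectivity on the compact zero section together with local injectivity at its points gives
  -- injectivity on a whole neighbourhood.
  obtain ⟨t, htZ, htinj⟩ := hZinj.exists_mem_nhdsSet hZc
    (fun z hz => (hGa z (hZW hz)).continuousAt) (fun z hz => by
      obtain ⟨e, he⟩ := hGd z (hZW hz)
      let ph := (hGs z (hZW hz) e he).toOpenPartialHomeomorph G
      refine ⟨ph.source, ph.open_source.mem_nhds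
        (hGs z (hZW hz) e he).mem_toOpenPartialHomeomorph_source, ?_⟩
      exact ph.injOn)
  set U : Set (P × F) := W ∩ interior t with hU
  have hUo : IsOpen U := hW.inter isOpen_interior
  have hZU : Z ⊆ U := subset_inter hZW (subset_interior_iff_mem_nhdsSet.2 htZ)
  have hUinj : InjOn G U := htinj.mono fun z hz => interior_subset hz.2
  have himo : IsOpen (G '' U) := by
    rw [isOpen_iff_mem_nhds]
    rintro _ ⟨z, hz, rfl⟩
    obtain ⟨e, he⟩ := hGd z hz.1
    rw [← (hGs z hz.1 e he).map_nhds_eq_of_equiv]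
    exact image_mem_map (hUo.mem_nhds hz)
  have hsub : K ×ˢ {(0 : F)} ⊆ G '' U := by
    rintro ⟨I, w⟩ ⟨hI, hw⟩
    have hw' : w = 0 := hw
    subst hw'
    refine ⟨(I, 0), hZU ⟨I, hI, rfl⟩, ?_⟩
    simp [G, h0 I (hKW I hI)]
  -- The tube lemma yields one radius for all parameters.
  obtain ⟨A', V, hA', hV, hKA', h0V, hAV⟩ := generalized_tube_lemma hK isCompact_singleton
    himo hsub
  obtain ⟨r, hr0, hr⟩ := Metric.isOpen_iff.1 hV 0 (h0V rfl)
  let A : Set P := A' ∩ (fun I => (I, (0 : F))) ⁻¹' U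
  let H : P × F → P × F := Function.invFunOn G U
  have hH : ∀ y ∈ G '' U, H y ∈ U ∧ G (H y) = y := fun y hy =>
    ⟨Function.invFunOn_mem hy, Function.invFunOn_eq hy⟩
  have hmem : ∀ I ∈ A, ∀ w ∈ Metric.ball (0 : F) r, (I, w) ∈ G '' U := fun I hI w hw =>
    hAV ⟨hI.1, hr hw⟩
  have hHfst : ∀ y ∈ G '' U, (H y).1 = y.1 := fun y hy =>
    (congrArg Prod.fst (hH y hy).2 : (G (H y)).1 = y.1)
  refine ⟨A, r, fun y => (H y).2, hA'.inter (hUo.preimage (by fun_prop)),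
    fun I hI => ⟨hKA' hI, hZU ⟨I, hI, rfl⟩⟩, hr0, ?_, ?_, ?_⟩
  · rintro ⟨I, w⟩ ⟨hI, hw⟩
    obtain ⟨z, hz, hzy⟩ := hmem I hI w hw
    rw [← hzy]
    obtain ⟨e, he⟩ := hGd z hz.1
    -- Here `⊤` is the analytic class, so the local inverse is analytic.
    have hcd : ContDiffAt ℝ ⊤ G z := (hGa z hz.1).contDiffAt
    have hstr := hcd.hasStrictFDerivAt' he (by simp)
    have h1 : AnalyticAt ℝ (hstr.localInverse G e z) (G z) := by
      have := hcd.to_localInverse he (by simp)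
      exact this.analyticAt
    -- The inverse `H` is only chosen pointwise; injectivity of `G` on `U` identifies it with the
    -- analytic local inverse.
    have h2 : hstr.localInverse G e z =ᶠ[𝓝 (G z)] H := by
      have c1 : ContinuousAt (hstr.localInverse G e z) (G z) := h1.continuousAt
      have c2 : hstr.localInverse G e z (G z) = z := hstr.localInverse_apply_image
      have c3 : ∀ᶠ y in 𝓝 (G z), hstr.localInverse G e z y ∈ U := by
        refine c1.eventually_mem ?_
        rw [c2]
        exact hUo.mem_nhds hz
      filter_upwards [c3, hstr.eventually_right_inverse, himo.mem_nhds ⟨z, hz, rfl⟩]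
        with y hy1 hy2 hy3
      exact hUinj hy1 (hH y hy3).1 (hy2.trans (hH y hy3).2.symm)
    exact analyticAt_snd.comp (h1.congr h2)
  · intro I hI w hw
    have hy := hmem I hI w hw
    have e : ((I, (H (I, w)).2) : P × F) = H (I, w) := by
      ext
      · exact (hHfst _ hy).symm
      · rfl
    simp only [e]
    exact ⟨(hH _ hy).1.1, (congrArg Prod.snd (hH _ hy).2 : (G (H (I, w))).2 = w)⟩
  · intro I hI
    have hy := hmem I hI 0 (Metric.mem_ball_self hr0)
    have e : H (I, 0) = (I, 0) := by
      refine hUinj (hH _ hy).1 hI.2 ?_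
      rw [(hH _ hy).2]
      simp [G, h0 I hI.2.1]
    simp [e]

end FibrewiseInverse

/-! ### Analyticity of compositions -/

section AnalyticComp

variable {E : Type*} [NormedAddCommGroup E] [NormedSpace ℝ E] {f : E → ℝ} {x : E}

@[fun_prop]
theorem analyticAt_sin_comp (hf : AnalyticAt ℝ f x) : AnalyticAt ℝ (fun y => Real.sin (f y)) x :=
  Real.analyticAt_sin.comp hf

@[fun_prop]
theorem analyticAt_cos_comp (hf : AnalyticAt ℝ f x) : AnalyticAt ℝ (fun y => Real.cos (f y)) x :=
  Real.analyticAt_cos.comp hf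

@[fun_prop]
theorem analyticAt_fst_comp {F G : Type*} [NormedAddCommGroup F] [NormedSpace ℝ F]
    [NormedAddCommGroup G] [NormedSpace ℝ G] {h : E → F × G} (hh : AnalyticAt ℝ h x) :
    AnalyticAt ℝ (fun y => (h y).1) x :=
  analyticAt_fst.comp hh

@[fun_prop]
theorem analyticAt_snd_comp {F G : Type*} [NormedAddCommGroup F] [NormedSpace ℝ F]
    [NormedAddCommGroup G] [NormedSpace ℝ G] {h : E → F × G} (hh : AnalyticAt ℝ h x) :
    AnalyticAt ℝ (fun y => (h y).2) x :=
  analyticAt_snd.comp hh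

theorem analyticAt_sqrt_comp (hf : AnalyticAt ℝ f x) (h0 : f x ≠ 0) :
    AnalyticAt ℝ (fun y => √(f y)) x :=
  ((Real.contDiffAt_sqrt h0 (n := ⊤)).analyticAt).comp hf

end AnalyticComp

/-! ### Rotations of the plane and the Jacobian along the fibres -/

/-- The rotation of the plane by the angle `s`. -/
def rot (s : ℝ) (z : ℝ × ℝ) : ℝ × ℝ :=
  (Real.cos s * z.1 - Real.sin s * z.2, Real.sin s * z.1 + Real.cos s * z.2)

theorem rot_rot (s t : ℝ) (z : ℝ × ℝ) : rot s (rot t z) = rot (s + t) z := by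
  ext
  · simp only [rot, Real.cos_add, Real.sin_add]; ring
  · simp only [rot, Real.cos_add, Real.sin_add]; ring

theorem rot_zero (z : ℝ × ℝ) : rot 0 z = z := by simp [rot]

theorem rot_add_two_pi (s : ℝ) (z : ℝ × ℝ) : rot (s + 2 * π) z = rot s z := by
  simp [rot]

theorem rot_smul (s t : ℝ) (z : ℝ × ℝ) : rot s (t • z) = t • rot s z := by
  ext
  · simp [rot]; ring
  · simp [rot]; ring

theorem rot_normSq (s : ℝ) (z : ℝ × ℝ) : (rot s z).1 ^ 2 + (rot s z).2 ^ 2 = z.1 ^ 2 + z.2 ^ 2 := by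
  have := Real.sin_sq_add_cos_sq s
  simp only [rot]
  linear_combination (z.1 ^ 2 + z.2 ^ 2) * this

theorem exists_eq_rot (z : ℝ × ℝ) : ∃ s, z = rot s (√(z.1 ^ 2 + z.2 ^ 2), 0) := by
  refine ⟨Complex.arg ⟨z.1, z.2⟩, ?_⟩
  have h1 : ‖(⟨z.1, z.2⟩ : ℂ)‖ = √(z.1 ^ 2 + z.2 ^ 2) := by
    rw [Complex.norm_def, Complex.normSq_apply]
    congr 1
    ring
  ext
  · have := Complex.norm_mul_cos_arg ⟨z.1, z.2⟩
    simp only [rot]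
    rw [← h1]
    linarith
  · have := Complex.norm_mul_sin_arg ⟨z.1, z.2⟩
    simp only [rot]
    rw [← h1]
    linarith

/-- The open disc of radius `r` about the origin. -/
def disc (r : ℝ) : Set (ℝ × ℝ) := {z | z.1 ^ 2 + z.2 ^ 2 < r ^ 2}

theorem isOpen_disc (r : ℝ) : IsOpen (disc r) :=
  isOpen_lt (by fun_prop) (by fun_prop)

theorem zero_mem_disc {r : ℝ} (hr : 0 < r) : (0 : ℝ × ℝ) ∈ disc r := by
  show (0 : ℝ) ^ 2 + 0 ^ 2 < r ^ 2
  rw [zero_pow two_ne_zero, zero_add]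
  positivity

theorem disc_subset_ball {r : ℝ} (hr : 0 < r) : disc r ⊆ Metric.ball 0 r := by
  intro z hz
  have hz' : z.1 ^ 2 + z.2 ^ 2 < r ^ 2 := hz
  rw [mem_ball_zero_iff, Prod.norm_def, max_lt_iff]
  constructor
  · exact abs_lt_of_sq_lt_sq (by nlinarith [sq_nonneg z.2]) hr.le
  · exact abs_lt_of_sq_lt_sq (by nlinarith [sq_nonneg z.1]) hr.le

theorem rot_mem_disc {r s : ℝ} {z : ℝ × ℝ} (hz : z ∈ disc r) : rot s z ∈ disc r := by
  have hz' : z.1 ^ 2 + z.2 ^ 2 < r ^ 2 := hz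
  show (rot s z).1 ^ 2 + (rot s z).2 ^ 2 < r ^ 2
  rwa [rot_normSq]

theorem smul_mem_disc {r t : ℝ} {z : ℝ × ℝ} (hz : z ∈ disc r) (h0 : 0 ≤ t) (h1 : t ≤ 1) :
    t • z ∈ disc r := by
  have hz' : z.1 ^ 2 + z.2 ^ 2 < r ^ 2 := hz
  show (t * z.1) ^ 2 + (t * z.2) ^ 2 < r ^ 2
  have : t ^ 2 ≤ 1 := pow_le_one₀ h0 h1
  nlinarith [sq_nonneg z.1, sq_nonneg z.2]

section FiberDet

variable {P : Type*} [NormedAddCommGroup P] [NormedSpace ℝ P]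

/-- The Jacobian determinant of a family of maps of the plane. -/
def fiberDet (g : P × ℝ × ℝ → ℝ × ℝ) (z : P × ℝ × ℝ) : ℝ :=
  (fderiv ℝ g z (0, 1, 0)).1 * (fderiv ℝ g z (0, 0, 1)).2 -
    (fderiv ℝ g z (0, 1, 0)).2 * (fderiv ℝ g z (0, 0, 1)).1

theorem fderiv_fiber (L : P × ℝ × ℝ →L[ℝ] ℝ × ℝ) (a b : ℝ) :
    L (0, a, b) = a • L (0, 1, 0) + b • L (0, 0, 1) := by
  rw [← map_smul, ← map_smul, ← map_add]
  congr 1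
  simp

theorem exists_equiv_of_fiberDet_ne_zero {g : P × ℝ × ℝ → ℝ × ℝ} {z : P × ℝ × ℝ}
    (h : fiberDet g z ≠ 0) :
    ∃ L : (ℝ × ℝ) ≃L[ℝ] ℝ × ℝ,
      (fderiv ℝ g z).comp (ContinuousLinearMap.inr ℝ P (ℝ × ℝ)) = L := by
  set T := (fderiv ℝ g z).comp (ContinuousLinearMap.inr ℝ P (ℝ × ℝ)) with hT
  have hinj : Function.Injective T := by
    rw [injective_iff_map_eq_zero]
    rintro ⟨a, b⟩ hv
    rw [hT, ContinuousLinearMap.comp_apply, ContinuousLinearMap.inr_apply, fderiv_fiber] at hv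
    have h1 := congrArg Prod.fst hv
    have h2 := congrArg Prod.snd hv
    simp only [Prod.fst_add, Prod.smul_fst, smul_eq_mul, Prod.fst_zero, Prod.snd_add,
      Prod.smul_snd, Prod.snd_zero] at h1 h2
    unfold fiberDet at h
    set p := fderiv ℝ g z (0, 1, 0)
    set q := fderiv ℝ g z (0, 0, 1)
    have ha : a * (p.1 * q.2 - p.2 * q.1) = 0 := by linear_combination q.2 * h1 - q.1 * h2
    have hb : b * (p.1 * q.2 - p.2 * q.1) = 0 := by linear_combination p.1 * h2 - p.2 * h1
    have ha' := (mul_eq_zero.1 ha).resolve_right h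
    have hb' := (mul_eq_zero.1 hb).resolve_right h
    simp [ha', hb']
  let e := LinearEquiv.ofInjectiveEndo (T : (ℝ × ℝ) →ₗ[ℝ] ℝ × ℝ) hinj
  refine ⟨e.toContinuousLinearEquiv, ?_⟩
  ext1 <;> ext1 <;> simp [e]

theorem fiberDet_comp {g τ : P × ℝ × ℝ → ℝ × ℝ} {z : P × ℝ × ℝ}
    (hτ : DifferentiableAt ℝ τ z) (hg : DifferentiableAt ℝ g (z.1, τ z)) :
    fiberDet (fun w => g (w.1, τ w)) z = fiberDet g (z.1, τ z) * fiberDet τ z := by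
  have h1 : HasFDerivAt (fun w : P × ℝ × ℝ => (w.1, τ w))
      ((ContinuousLinearMap.fst ℝ P (ℝ × ℝ)).prod (fderiv ℝ τ z)) z :=
    hasFDerivAt_fst.prodMk hτ.hasFDerivAt
  have h2 : HasFDerivAt (fun w => g (w.1, τ w)) _ z := hg.hasFDerivAt.comp z h1
  have key : ∀ a b : ℝ, fderiv ℝ (fun w => g (w.1, τ w)) z (0, a, b) =
      (fderiv ℝ τ z (0, a, b)).1 • fderiv ℝ g (z.1, τ z) (0, 1, 0) +
        (fderiv ℝ τ z (0, a, b)).2 • fderiv ℝ g (z.1, τ z) (0, 0, 1) := by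
    intro a b
    rw [h2.fderiv, ← fderiv_fiber]
    simp
  unfold fiberDet
  rw [key, key]
  simp only [Prod.fst_add, Prod.smul_fst, smul_eq_mul, Prod.snd_add, Prod.smul_snd]
  ring

theorem fiberDet_snd (z : P × ℝ × ℝ) : fiberDet (fun w : P × ℝ × ℝ => w.2) z = 1 := by
  have : fderiv ℝ (fun w : P × ℝ × ℝ => w.2) z = ContinuousLinearMap.snd ℝ P (ℝ × ℝ) :=
    hasFDerivAt_snd.fderiv
  simp [fiberDet, this]

theorem analyticAt_fiberDet {g : P × ℝ × ℝ → ℝ × ℝ} {z : P × ℝ × ℝ} (hg : AnalyticAt ℝ g z) :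
    AnalyticAt ℝ (fiberDet g) z := by
  have h := hg.fderiv
  have ha : ∀ v, AnalyticAt ℝ (fun w => fderiv ℝ g w v) z := fun v =>
    ((ContinuousLinearMap.apply ℝ (ℝ × ℝ) v).analyticAt _).comp h
  have h1 : ∀ v, AnalyticAt ℝ (fun w => (fderiv ℝ g w v).1) z := fun v =>
    analyticAt_fst.comp (ha v)
  have h2 : ∀ v, AnalyticAt ℝ (fun w => (fderiv ℝ g w v).2) z := fun v =>
    analyticAt_snd.comp (ha v)
  exact ((h1 _).mul (h2 _)).sub ((h2 _).mul (h1 _))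

end FiberDet

/-! ### Averages over circles -/

section CircleAverages

open Set Filter Topology MeasureTheory

/-- Substituting `s - α` for `s` turns the moment into the integral of `s * k s` over `[α, α + 2π]`,
as `k` has mean zero. The boundary terms then contribute `(α + 2π) k - α k`. This computes the
derivative of `phaseShift` along circles. -/
theorem hasDerivAt_moment {k : ℝ → ℝ} (hk : Continuous k) (hp : ∀ s, k (s + 2 * π) = k s)
    (h0 : ∫ s in (0 : ℝ)..2 * π, k s = 0) :
    HasDerivAt (fun α => ∫ s in (0 : ℝ)..2 * π, s * k (s + α)) (2 * π * k 0) 0 := by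
  have e : (fun α => ∫ s in (0 : ℝ)..2 * π, s * k (s + α)) =
      fun α => (∫ s in (0 : ℝ)..(α + 2 * π), s * k s) - ∫ s in (0 : ℝ)..α, s * k s := by
    funext α
    have h1 := intervalIntegral.integral_comp_add_right (a := 0) (b := 2 * π)
      (fun s => (s - α) * k s) α
    simp only [add_sub_cancel_right, zero_add] at h1
    have hi : ∀ a b, IntervalIntegrable (fun s => s * k s) volume a b := fun a b =>
      (by fun_prop : Continuous fun s => s * k s).intervalIntegrable a b
    have h2 : ∫ s in α..2 * π + α, k s = 0 := by
      have := Function.Periodic.intervalIntegral_add_eq (f := k) (T := 2 * π) hp α 0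
      rw [zero_add, h0] at this
      rwa [add_comm]
    rw [h1]
    simp only [sub_mul]
    rw [intervalIntegral.integral_sub (hi _ _) ((by fun_prop : Continuous fun s => α * k s
      ).intervalIntegrable _ _), intervalIntegral.integral_const_mul, h2, mul_zero, sub_zero,
      add_comm, intervalIntegral.integral_interval_sub_left (hi _ _) (hi _ _)]
  rw [e]
  have hc : Continuous fun s => s * k s := by fun_prop
  have h1 : ∀ b, HasDerivAt (fun α => ∫ s in (0 : ℝ)..α, s * k s) (b * k b) b := fun b =>
    intervalIntegral.integral_hasDerivAt_right (hc.intervalIntegrable _ _)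
      (hc.stronglyMeasurableAtFilter _ _) hc.continuousAt
  have h2 : HasDerivAt (fun α => ∫ s in (0 : ℝ)..(α + 2 * π), s * k s)
      ((0 + 2 * π) * k (0 + 2 * π)) 0 := (h1 (0 + 2 * π)).comp_add_const 0 (2 * π)
  refine (h2.sub (h1 0)).congr_deriv ?_
  rw [hp]
  ring

end CircleAverages

/-! ### Maps of the disc with prescribed Jacobian that send circles to circles -/

section AreaNormalization

open Set Filter Topology MeasureTheory

variable {P : Type*} [NormedAddCommGroup P] [NormedSpace ℝ P]

/-- The mean of `J` over the circle through a point. -/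
def circleMean (J : P × ℝ × ℝ → ℝ) (z : P × ℝ × ℝ) : ℝ :=
  (2 * π)⁻¹ * ∫ s in (0 : ℝ)..2 * π, J (z.1, rot s z.2)

/-- The mean of `J` over the disc bounded by the circle through a point. -/
def discMean (J : P × ℝ × ℝ → ℝ) (z : P × ℝ × ℝ) : ℝ :=
  ∫ σ in (0 : ℝ)..1, 2 * σ * circleMean J (z.1, σ • z.2)

/-- The phase shift which makes the density `J` uniform along circles. -/
def phaseShift (J : P × ℝ × ℝ → ℝ) (z : P × ℝ × ℝ) : ℝ :=
  (2 * π)⁻¹ * ∫ s in (0 : ℝ)..2 * π, s * (J (z.1, rot s z.2) / circleMean J z - 1)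

/-- A map of the plane with Jacobian `J`, acting as a rotation on each circle up to scaling and
reparametrization. -/
def areaMap (J : P × ℝ × ℝ → ℝ) (z : P × ℝ × ℝ) : ℝ × ℝ :=
  √(discMean J z) • rot (phaseShift J z) z.2

variable {A : Set P} {r : ℝ} {J : P × ℝ × ℝ → ℝ}

theorem circleMean_analytic (hJ : AnalyticOnNhd ℝ J (A ×ˢ disc r)) :
    AnalyticOnNhd ℝ (circleMean J) (A ×ˢ disc r) := by
  rintro ⟨I, z⟩ ⟨hI, hz⟩
  refine analyticAt_const.mul (analyticAt_intervalIntegral (f := fun w : ℝ × P × ℝ × ℝ =>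
    J (w.2.1, rot w.1 w.2.2)) (by positivity) fun s _ => ?_)
  refine (hJ (I, rot s z) ⟨hI, rot_mem_disc hz⟩).comp
    (f := fun w : ℝ × P × ℝ × ℝ => (w.2.1, rot w.1 w.2.2)) ?_
  unfold rot
  fun_prop

theorem discMean_analytic (hJ : AnalyticOnNhd ℝ J (A ×ˢ disc r)) :
    AnalyticOnNhd ℝ (discMean J) (A ×ˢ disc r) := by
  rintro ⟨I, z⟩ ⟨hI, hz⟩
  refine analyticAt_intervalIntegral (f := fun w : ℝ × P × ℝ × ℝ =>
    2 * w.1 * circleMean J (w.2.1, w.1 • w.2.2)) zero_le_one fun s hs => ?_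
  have h := (circleMean_analytic hJ (I, s • z) ⟨hI, smul_mem_disc hz hs.1 hs.2⟩).comp
    (f := fun w : ℝ × P × ℝ × ℝ => (w.2.1, w.1 • w.2.2)) (x := (s, I, z)) (by fun_prop)
  exact (by fun_prop : AnalyticAt ℝ (fun w : ℝ × P × ℝ × ℝ => 2 * w.1) (s, I, z)).mul h

theorem continuous_along_circle (hJ : AnalyticOnNhd ℝ J (A ×ˢ disc r)) {I : P} {z : ℝ × ℝ}
    (hI : I ∈ A) (hz : z ∈ disc r) : Continuous fun s => J (I, rot s z) := by
  rw [continuous_iff_continuousAt]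
  intro s
  exact ContinuousAt.comp (f := fun s => (I, rot s z)) (g := J)
    (hJ (I, rot s z) ⟨hI, rot_mem_disc hz⟩).continuousAt (by unfold rot; fun_prop)

omit [NormedAddCommGroup P] [NormedSpace ℝ P] in
theorem circleMean_rot (I : P) (z : ℝ × ℝ) (α : ℝ) :
    circleMean J (I, rot α z) = circleMean J (I, z) := by
  have h1 := intervalIntegral.integral_comp_add_right (a := 0) (b := 2 * π)
      (fun s => J (I, rot s z)) α
  have h2 := Function.Periodic.intervalIntegral_add_eq (f := fun s => J (I, rot s z))
    (T := 2 * π) (fun s => by simp [rot_add_two_pi]) α 0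
  simp only [circleMean, rot_rot]
  rw [h1, zero_add, add_comm, h2, zero_add]

omit [NormedAddCommGroup P] [NormedSpace ℝ P] in
theorem discMean_rot (I : P) (z : ℝ × ℝ) (α : ℝ) :
    discMean J (I, rot α z) = discMean J (I, z) := by
  simp only [discMean, ← rot_smul, circleMean_rot]

theorem circleMean_pos (hJ : AnalyticOnNhd ℝ J (A ×ˢ disc r))
    (hpos : ∀ z ∈ A ×ˢ disc r, 0 < J z) {z : P × ℝ × ℝ} (hz : z ∈ A ×ˢ disc r) :
    0 < circleMean J z := by
  refine mul_pos (by positivity) ?_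
  refine intervalIntegral.intervalIntegral_pos_of_pos
    ((continuous_along_circle hJ hz.1 hz.2).intervalIntegrable _ _) (fun s => ?_) (by positivity)
  exact hpos _ ⟨hz.1, rot_mem_disc hz.2⟩

theorem continuousOn_circleMean_ray (hJ : AnalyticOnNhd ℝ J (A ×ˢ disc r)) {I : P} {z : ℝ × ℝ}
    (hI : I ∈ A) : ContinuousOn (fun t : ℝ => 2 * t * circleMean J (I, t • z))
      {t | t • z ∈ disc r} := by
  intro t ht
  have h : ContinuousAt (fun t : ℝ => circleMean J (I, t • z)) t :=
    ContinuousAt.comp (f := fun t : ℝ => (I, t • z)) (g := circleMean J)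
      (circleMean_analytic hJ (I, t • z) ⟨hI, ht⟩).continuousAt (by fun_prop)
  exact ((by fun_prop : ContinuousAt (fun t : ℝ => 2 * t) t).mul h).continuousWithinAt

theorem discMean_pos (hJ : AnalyticOnNhd ℝ J (A ×ˢ disc r))
    (hpos : ∀ z ∈ A ×ˢ disc r, 0 < J z) {z : P × ℝ × ℝ} (hz : z ∈ A ×ˢ disc r) :
    0 < discMean J z := by
  refine intervalIntegral.intervalIntegral_pos_of_pos_on ?_ (fun s hs => ?_) one_pos
  · refine ((continuousOn_circleMean_ray hJ hz.1).mono fun t ht => ?_).intervalIntegrable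
    rw [uIcc_of_le zero_le_one] at ht
    exact smul_mem_disc hz.2 ht.1 ht.2
  · have := circleMean_pos hJ hpos (z := (z.1, s • z.2))
      ⟨hz.1, smul_mem_disc hz.2 hs.1.le hs.2.le⟩
    have := hs.1
    positivity

theorem phaseShift_analytic (hJ : AnalyticOnNhd ℝ J (A ×ˢ disc r))
    (hpos : ∀ z ∈ A ×ˢ disc r, 0 < J z) : AnalyticOnNhd ℝ (phaseShift J) (A ×ˢ disc r) := by
  rintro ⟨I, z⟩ ⟨hI, hz⟩
  refine analyticAt_const.mul (analyticAt_intervalIntegral (f := fun w : ℝ × P × ℝ × ℝ =>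
    w.1 * (J (w.2.1, rot w.1 w.2.2) / circleMean J w.2 - 1)) (by positivity) fun s _ => ?_)
  have h1 := (hJ (I, rot s z) ⟨hI, rot_mem_disc hz⟩).comp
    (f := fun w : ℝ × P × ℝ × ℝ => (w.2.1, rot w.1 w.2.2)) (x := (s, I, z)) (by
      unfold rot
      fun_prop)
  have h2 : AnalyticAt ℝ (fun w : ℝ × P × ℝ × ℝ => circleMean J w.2) (s, I, z) :=
    (circleMean_analytic hJ (I, z) ⟨hI, hz⟩).comp (f := fun w : ℝ × P × ℝ × ℝ => w.2)
      (x := (s, I, z)) (by fun_prop)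
  exact analyticAt_fst.mul ((h1.div h2 (circleMean_pos hJ hpos ⟨hI, hz⟩).ne').sub
    analyticAt_const)

theorem hasDerivAt_rot (z : ℝ × ℝ) : HasDerivAt (fun α => rot α z) (-z.2, z.1) 0 := by
  have h1 : HasDerivAt (fun α : ℝ => Real.cos α * z.1 - Real.sin α * z.2)
      (-Real.sin 0 * z.1 - Real.cos 0 * z.2) 0 :=
    ((Real.hasDerivAt_cos 0).mul_const _).sub ((Real.hasDerivAt_sin 0).mul_const _)
  have h2 : HasDerivAt (fun α : ℝ => Real.sin α * z.1 + Real.cos α * z.2)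
      (Real.cos 0 * z.1 + -Real.sin 0 * z.2) 0 :=
    ((Real.hasDerivAt_sin 0).mul_const _).add ((Real.hasDerivAt_cos 0).mul_const _)
  refine (h1.prodMk h2).congr_deriv ?_
  simp

theorem hasDerivAt_comp_rot {f : P × ℝ × ℝ → ℝ} {I : P} {z : ℝ × ℝ}
    (hf : DifferentiableAt ℝ f (I, z)) :
    HasDerivAt (fun α => f (I, rot α z)) (fderiv ℝ f (I, z) (0, -z.2, z.1)) 0 := by
  have h1 : HasDerivAt (fun α => (I, rot α z)) ((0 : P), -z.2, z.1) 0 :=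
    (hasDerivAt_const (0 : ℝ) I).prodMk (hasDerivAt_rot z)
  have h2 : HasFDerivAt f (fderiv ℝ f (I, z)) (I, rot 0 z) := by
    rw [rot_zero]
    exact hf.hasFDerivAt
  exact h2.comp_hasDerivAt (0 : ℝ) h1

theorem fderiv_discMean_rot (hJ : AnalyticOnNhd ℝ J (A ×ˢ disc r)) {I : P} {z : ℝ × ℝ}
    (hI : I ∈ A) (hz : z ∈ disc r) :
    fderiv ℝ (discMean J) (I, z) (0, -z.2, z.1) = 0 := by
  have h1 := hasDerivAt_comp_rot (discMean_analytic hJ (I, z) ⟨hI, hz⟩).differentiableAt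
  simp only [discMean_rot] at h1
  exact h1.unique (hasDerivAt_const _ _)

/-- `circleMean J` is constant along the circle, so only the moment of the mean-zero function `J /
circleMean J - 1` varies, and `hasDerivAt_moment` applies. -/
theorem fderiv_phaseShift_rot (hJ : AnalyticOnNhd ℝ J (A ×ˢ disc r))
    (hpos : ∀ z ∈ A ×ˢ disc r, 0 < J z) {I : P} {z : ℝ × ℝ} (hI : I ∈ A) (hz : z ∈ disc r) :
    fderiv ℝ (phaseShift J) (I, z) (0, -z.2, z.1) = J (I, z) / circleMean J (I, z) - 1 := by
  have h1 := hasDerivAt_comp_rot (phaseShift_analytic hJ hpos (I, z) ⟨hI, hz⟩).differentiableAt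
  have hm := circleMean_pos hJ hpos (z := (I, z)) ⟨hI, hz⟩
  have hc := continuous_along_circle hJ hI hz
  set k : ℝ → ℝ := fun s => J (I, rot s z) / circleMean J (I, z) - 1 with hk
  have hkc : Continuous k := (hc.div_const _).sub continuous_const
  have h0 : ∫ s in (0 : ℝ)..2 * π, k s = 0 := by
    rw [hk, intervalIntegral.integral_sub ((hc.div_const _).intervalIntegrable _ _)
      intervalIntegrable_const, intervalIntegral.integral_div, intervalIntegral.integral_const]
    have : ∫ s in (0 : ℝ)..2 * π, J (I, rot s z) = 2 * π * circleMean J (I, z) := by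
      unfold circleMean
      field_simp
    rw [this, mul_div_assoc, div_self hm.ne']
    simp
  have h2 := (hasDerivAt_moment hkc (fun s => by simp [hk, rot_add_two_pi]) h0).const_mul
    (2 * π)⁻¹
  have e : (fun α => phaseShift J (I, rot α z)) =
      fun α => (2 * π)⁻¹ * ∫ s in (0 : ℝ)..2 * π, s * k (s + α) := by
    funext α
    simp only [phaseShift, circleMean_rot, rot_rot, hk]
  rw [e] at h1
  rw [h1.unique h2, hk]
  simp only [rot_zero]
  field_simp

/-- By scaling, `t² discMean (t z)` is the integral of `2σ circleMean (σ z)` over `[0, t]`;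
differentiate at `t = 1`. -/
theorem fderiv_discMean_radial (hJ : AnalyticOnNhd ℝ J (A ×ˢ disc r)) {I : P} {z : ℝ × ℝ}
    (hI : I ∈ A) (hz : z ∈ disc r) :
    2 * discMean J (I, z) + fderiv ℝ (discMean J) (I, z) (0, z.1, z.2) =
      2 * circleMean J (I, z) := by
  have hd := (discMean_analytic hJ (I, z) ⟨hI, hz⟩).differentiableAt
  have h1 : HasDerivAt (fun t : ℝ => (I, t • z)) ((0 : P), (1 : ℝ) • z) 1 :=
    (hasDerivAt_const (1 : ℝ) I).prodMk ((hasDerivAt_id (1 : ℝ)).smul_const z)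
  have h2 : HasFDerivAt (discMean J) (fderiv ℝ (discMean J) (I, z)) (I, (1 : ℝ) • z) := by
    rw [one_smul]
    exact hd.hasFDerivAt
  have h3 : HasDerivAt (fun t : ℝ => discMean J (I, t • z))
      (fderiv ℝ (discMean J) (I, z) (0, (1 : ℝ) • z)) 1 :=
    h2.comp_hasDerivAt (f := fun t : ℝ => (I, t • z)) (1 : ℝ) h1
  have h4 := ((hasDerivAt_id (1 : ℝ)).pow 2).mul h3
  have e : (fun t : ℝ => t ^ 2 * discMean J (I, t • z)) =
      fun t => ∫ σ in (0 : ℝ)..t, 2 * σ * circleMean J (I, σ • z) := by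
    funext t
    have := intervalIntegral.mul_integral_comp_mul_left (a := 0) (b := 1)
      (f := fun σ => 2 * σ * circleMean J (I, σ • z)) (c := t)
    rw [mul_zero, mul_one] at this
    rw [← this, discMean, pow_two, mul_assoc, ← intervalIntegral.integral_const_mul]
    congr 1
    refine intervalIntegral.integral_congr fun σ _ => ?_
    simp only [smul_smul, mul_comm σ t]
    ring
  have hco := continuousOn_circleMean_ray (z := z) hJ hI
  have hopen : IsOpen {t : ℝ | t • z ∈ disc r} := (isOpen_disc r).preimage (by fun_prop)
  have hmem : (1 : ℝ) ∈ {t : ℝ | t • z ∈ disc r} := by simpa using hz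
  have h5 : HasDerivAt (fun t => ∫ σ in (0 : ℝ)..t, 2 * σ * circleMean J (I, σ • z))
      (2 * 1 * circleMean J (I, (1 : ℝ) • z)) 1 := by
    refine intervalIntegral.integral_hasDerivAt_right ?_
      (hco.stronglyMeasurableAtFilter hopen 1 hmem) (hco.continuousAt (hopen.mem_nhds hmem))
    refine (hco.mono fun t ht => ?_).intervalIntegrable
    rw [uIcc_of_le zero_le_one] at ht
    exact smul_mem_disc hz ht.1 ht.2
  rw [← e] at h5
  have h6 := h5.unique h4
  simp only [one_smul, id, Pi.pow_apply] at h6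
  norm_num at h6
  linarith

theorem areaMap_analytic (hJ : AnalyticOnNhd ℝ J (A ×ˢ disc r))
    (hpos : ∀ z ∈ A ×ˢ disc r, 0 < J z) : AnalyticOnNhd ℝ (areaMap J) (A ×ˢ disc r) := by
  intro z hz
  have h1 := analyticAt_sqrt_comp (discMean_analytic hJ z hz) (discMean_pos hJ hpos hz).ne'
  have h2 := phaseShift_analytic hJ hpos z hz
  refine h1.smul (f := fun z => √(discMean J z)) ?_
  unfold rot
  fun_prop

theorem areaMap_normSq (hJ : AnalyticOnNhd ℝ J (A ×ˢ disc r))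
    (hpos : ∀ z ∈ A ×ˢ disc r, 0 < J z) {z : P × ℝ × ℝ} (hz : z ∈ A ×ˢ disc r) :
    (areaMap J z).1 ^ 2 + (areaMap J z).2 ^ 2 = discMean J z * (z.2.1 ^ 2 + z.2.2 ^ 2) := by
  have h := rot_normSq (phaseShift J z) z.2
  simp only [areaMap, Prod.smul_fst, Prod.smul_snd, smul_eq_mul, mul_pow]
  rw [Real.sq_sqrt (discMean_pos hJ hpos hz).le, ← h]
  ring

omit [NormedAddCommGroup P] [NormedSpace ℝ P] in
theorem areaMap_zero (J : P × ℝ × ℝ → ℝ) (I : P) : areaMap J (I, 0) = 0 := by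
  simp [areaMap, rot]

/-- With `D` and `M` the disc and circle means and `u` the phase shift, in polar coordinates the map
is `(R, θ) ↦ (R √D, θ + u)` with `D` independent of `θ`. The area form pulls back with density `½
∂_R(R² D) (1 + ∂_θ u) = R M · (J / M) = R J`. The proof is this computation in Cartesian form, valid
also at the origin. -/
theorem fiberDet_areaMap (hJ : AnalyticOnNhd ℝ J (A ×ˢ disc r))
    (hpos : ∀ z ∈ A ×ˢ disc r, 0 < J z) {z : P × ℝ × ℝ} (hz : z ∈ A ×ˢ disc r) :
    fiberDet (areaMap J) z = J z := by
  obtain ⟨I, X, Y⟩ := z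
  have hD := discMean_pos hJ hpos hz
  have hM := circleMean_pos hJ hpos hz
  have e1 := fderiv_discMean_rot hJ hz.1 hz.2
  have e2 := fderiv_phaseShift_rot hJ hpos hz.1 hz.2
  have e3 := fderiv_discMean_radial hJ hz.1 hz.2
  have hdD := (discMean_analytic hJ _ hz).differentiableAt.hasFDerivAt
  have hdu := (phaseShift_analytic hJ hpos _ hz).differentiableAt.hasFDerivAt
  have hlin : ∀ (L : P × ℝ × ℝ →L[ℝ] ℝ) (a b : ℝ),
      L (0, a, b) = a * L (0, 1, 0) + b * L (0, 0, 1) := by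
    intro L a b
    rw [← smul_eq_mul, ← smul_eq_mul, ← map_smul, ← map_smul, ← map_add]
    congr 1
    simp
  rw [hlin] at e1 e2 e3
  have hX : HasFDerivAt (fun z : P × ℝ × ℝ => z.2.1) ((ContinuousLinearMap.fst ℝ ℝ ℝ).comp
    (ContinuousLinearMap.snd ℝ P (ℝ × ℝ))) (I, X, Y) :=
    (hasFDerivAt_fst).comp (I, X, Y) hasFDerivAt_snd
  have hY : HasFDerivAt (fun z : P × ℝ × ℝ => z.2.2) ((ContinuousLinearMap.snd ℝ ℝ ℝ).comp
    (ContinuousLinearMap.snd ℝ P (ℝ × ℝ))) (I, X, Y) :=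
    (hasFDerivAt_snd).comp (I, X, Y) hasFDerivAt_snd
  have hp := (hdD.sqrt hD.ne').mul ((hdu.cos.mul hX).sub (hdu.sin.mul hY))
  have hq := (hdD.sqrt hD.ne').mul ((hdu.sin.mul hX).add (hdu.cos.mul hY))
  have hA : HasFDerivAt (areaMap J) _ (I, X, Y) := hp.prodMk hq
  unfold fiberDet
  rw [hA.fderiv]
  simp only [ContinuousLinearMap.prod_apply, add_apply,
    sub_apply, smul_apply, smul_eq_mul,
    ContinuousLinearMap.comp_apply, ContinuousLinearMap.coe_fst', ContinuousLinearMap.coe_snd']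
  have hcs := Real.sin_sq_add_cos_sq (phaseShift J (I, X, Y))
  have hρ := Real.sq_sqrt hD.le
  have hρ0 := (Real.sqrt_pos.2 hD).ne'
  set c := Real.cos (phaseShift J (I, X, Y))
  set s := Real.sin (phaseShift J (I, X, Y))
  set Dx := fderiv ℝ (discMean J) (I, X, Y) (0, 1, 0)
  set Dy := fderiv ℝ (discMean J) (I, X, Y) (0, 0, 1)
  set ux := fderiv ℝ (phaseShift J) (I, X, Y) (0, 1, 0)
  set uy := fderiv ℝ (phaseShift J) (I, X, Y) (0, 0, 1)
  set ρ := √(discMean J (I, X, Y))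
  set Dv := discMean J (I, X, Y)
  set M := circleMean J (I, X, Y)
  set j := J (I, X, Y)
  have hw : ρ * (1 / (2 * ρ)) = 1 / 2 := by field_simp
  simp only [Pi.sub_apply, Pi.add_apply, Pi.mul_apply]
  set w := 1 / (2 * ρ)
  have hj : j = (1 + (X * uy - Y * ux)) * M := by
    have : X * uy - Y * ux = j / M - 1 := by linear_combination e2
    rw [this]
    field_simp
    ring
  -- The left side is the Jacobian before the factor `cos² + sin²` is inserted; `w` is the
  -- derivative factor of the square root.
  have key : ρ ^ 2 * (1 + (X * uy - Y * ux)) + ρ * w * (X * Dx + Y * Dy) +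
      ρ * w * ((X ^ 2 + Y ^ 2) * (Dx * uy - Dy * ux)) = j := by
    rw [hw, hρ, hj]
    simp only at e1 e3
    linear_combination (1 / 2 * (1 + (X * uy - Y * ux))) * e3 - 1 / 2 * (Y * uy + X * ux) * e1
  rw [← key]
  linear_combination (ρ ^ 2 * (1 + (X * uy - Y * ux)) + ρ * w * (X * Dx + Y * Dy) +
      ρ * w * ((X ^ 2 + Y ^ 2) * (Dx * uy - Dy * ux))) * hcs

/-- The derivative is `2t` times a circle mean, which is positive. So the radius of an image circle
determines the radius of the circle. -/
theorem areaMap_normSq_strictMono (hJ : AnalyticOnNhd ℝ J (A ×ˢ disc r))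
    (hpos : ∀ z ∈ A ×ˢ disc r, 0 < J z) {I : P} (hI : I ∈ A) (hr : 0 < r) :
    StrictMonoOn (fun t : ℝ => t ^ 2 * discMean J (I, t, 0)) (Ico 0 r) := by
  have hmem : ∀ t ∈ Ico 0 r, ((t, 0) : ℝ × ℝ) ∈ disc r := by
    intro t ht
    show t ^ 2 + 0 ^ 2 < r ^ 2
    nlinarith [ht.1, ht.2]
  have hd : ∀ t ∈ Ico 0 r, HasDerivAt (fun t : ℝ => t ^ 2 * discMean J (I, t, 0))
      (t * (2 * circleMean J (I, t, 0))) t := by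
    intro t ht
    have h1 : HasDerivAt (fun t : ℝ => (I, t, (0 : ℝ))) ((0 : P), (1 : ℝ), (0 : ℝ)) t :=
      (hasDerivAt_const t I).prodMk ((hasDerivAt_id t).prodMk (hasDerivAt_const t 0))
    have h2 := (discMean_analytic hJ (I, t, 0) ⟨hI, hmem t ht⟩).differentiableAt.hasFDerivAt
    have h3 : HasDerivAt (fun t : ℝ => discMean J (I, t, 0))
      (fderiv ℝ (discMean J) (I, t, 0) (0, 1, 0)) t :=
      h2.comp_hasDerivAt (f := fun t : ℝ => (I, t, (0 : ℝ))) t h1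
    refine (((hasDerivAt_id t).pow 2).mul h3).congr_deriv ?_
    have h4 := fderiv_discMean_radial hJ hI (hmem t ht)
    have h5 : ((0 : P), t, (0 : ℝ)) = t • ((0 : P), (1 : ℝ), (0 : ℝ)) := by simp
    simp only at h4
    rw [h5, map_smul, smul_eq_mul] at h4
    rw [← h4]
    simp
    ring
  refine strictMonoOn_of_deriv_pos (convex_Ico 0 r)
    (fun t ht => (hd t ht).continuousAt.continuousWithinAt) fun t ht => ?_
  rw [interior_Ico] at ht
  have ht' : t ∈ Ico 0 r := ⟨ht.1.le, ht.2⟩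
  rw [(hd t ht').deriv]
  have := circleMean_pos hJ hpos (z := (I, t, 0)) ⟨hI, hmem t ht'⟩
  have := ht.1
  positivity

theorem normSq_eq_of_areaMap_normSq_eq (hJ : AnalyticOnNhd ℝ J (A ×ˢ disc r))
    (hpos : ∀ z ∈ A ×ˢ disc r, 0 < J z) (hr : 0 < r) {I : P} (hI : I ∈ A) {z w : ℝ × ℝ}
    (hz : z ∈ disc r) (hw : w ∈ disc r)
    (h : (areaMap J (I, z)).1 ^ 2 + (areaMap J (I, z)).2 ^ 2 =
      (areaMap J (I, w)).1 ^ 2 + (areaMap J (I, w)).2 ^ 2) :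
    z.1 ^ 2 + z.2 ^ 2 = w.1 ^ 2 + w.2 ^ 2 := by
  rw [areaMap_normSq hJ hpos ⟨hI, hz⟩, areaMap_normSq hJ hpos ⟨hI, hw⟩] at h
  have key : ∀ z ∈ disc r, discMean J (I, z) * (z.1 ^ 2 + z.2 ^ 2) =
      √(z.1 ^ 2 + z.2 ^ 2) ^ 2 * discMean J (I, √(z.1 ^ 2 + z.2 ^ 2), 0) := by
    intro z hz
    obtain ⟨s, hs⟩ := exists_eq_rot z
    conv_lhs => rw [hs, discMean_rot, rot_normSq]
    ring
  simp only at h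
  rw [key z hz, key w hw] at h
  have hm : ∀ z ∈ disc r, √(z.1 ^ 2 + z.2 ^ 2) ∈ Ico 0 r := fun z hz =>
    ⟨Real.sqrt_nonneg _, (Real.sqrt_lt' hr).2 hz⟩
  have := (areaMap_normSq_strictMono hJ hpos hI hr).injOn (hm z hz) (hm w hw) h
  rwa [Real.sqrt_inj (by positivity) (by positivity)] at this

/-- Near an elliptic equilibrium of a family of Hamiltonians `|g|²` with one degree of freedom
there are area-preserving coordinates in which the Hamiltonian depends on the distance from the
equilibrium only. -/
theorem exists_action_coordinates [CompleteSpace P] {K : Set P} (hK : IsCompact K)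
    {W : Set (P × ℝ × ℝ)} (hW : IsOpen W) (hKW : ∀ I ∈ K, (I, (0 : ℝ × ℝ)) ∈ W)
    {g : P × ℝ × ℝ → ℝ × ℝ} (hg : AnalyticOnNhd ℝ g W)
    (h0 : ∀ I, (I, (0 : ℝ × ℝ)) ∈ W → g (I, 0) = 0) (hdet : ∀ z ∈ W, 0 < fiberDet g z) :
    ∃ (A : Set P) (r : ℝ) (σ ρ : P × ℝ × ℝ → ℝ × ℝ), IsOpen A ∧ K ⊆ A ∧ 0 < r ∧
      AnalyticOnNhd ℝ σ (A ×ˢ disc r) ∧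
      (∀ z ∈ A ×ˢ disc r, (z.1, σ z) ∈ W ∧ fiberDet σ z = 1 ∧ ρ (z.1, σ z) = z.2) ∧
      (∀ I ∈ A, σ (I, 0) = 0) ∧
      ∀ I ∈ A, ∀ z ∈ disc r, ∀ w ∈ disc r, z.1 ^ 2 + z.2 ^ 2 = w.1 ^ 2 + w.2 ^ 2 →
        (g (I, σ (I, z))).1 ^ 2 + (g (I, σ (I, z))).2 ^ 2 =
          (g (I, σ (I, w))).1 ^ 2 + (g (I, σ (I, w))).2 ^ 2 := by
  obtain ⟨A₁, r₁, τ₁, hA₁, hKA₁, hr₁, hτ₁, hinv₁, hz₁⟩ := exists_fibrewise_inverse hK hW hKW hg h0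
    fun z hz => exists_equiv_of_fiberDet_ne_zero (hdet z hz).ne'
  have hprod : ∀ {A : Set P} {r : ℝ}, 0 < r → A ×ˢ disc r ⊆ A ×ˢ Metric.ball (0 : ℝ × ℝ) r :=
    fun hr => prod_mono_right (disc_subset_ball hr)
  have hcomp : ∀ {A : Set P} {r : ℝ} {f τ : P × ℝ × ℝ → ℝ × ℝ} {V : Set (P × ℝ × ℝ)},
      IsOpen A → AnalyticOnNhd ℝ f V → AnalyticOnNhd ℝ τ (A ×ˢ Metric.ball 0 r) →
      (∀ I ∈ A, ∀ w ∈ Metric.ball (0 : ℝ × ℝ) r, (I, τ (I, w)) ∈ V ∧ f (I, τ (I, w)) = w) →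
      ∀ z ∈ A ×ˢ Metric.ball (0 : ℝ × ℝ) r, fiberDet f (z.1, τ z) * fiberDet τ z = 1 := by
    intro A r f τ V hA hf hτ h z hz
    rw [← fiberDet_comp (hτ z hz).differentiableAt
      (hf _ (h z.1 hz.1 z.2 hz.2).1).differentiableAt]
    have : (fun w : P × ℝ × ℝ => f (w.1, τ w)) =ᶠ[𝓝 z] fun w => w.2 := by
      filter_upwards [(hA.prod Metric.isOpen_ball).mem_nhds hz] with w hw
      exact (h w.1 hw.1 w.2 hw.2).2
    rw [fiberDet, this.fderiv_eq]
    exact fiberDet_snd z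
  have hτ₁' : AnalyticOnNhd ℝ τ₁ (A₁ ×ˢ disc r₁) := hτ₁.mono (hprod hr₁)
  -- After inverting `g` the Hamiltonian is the squared distance from the origin, but areas are
  -- distorted by `J`.
  set J : P × ℝ × ℝ → ℝ := fiberDet τ₁ with hJdef
  have hJ : AnalyticOnNhd ℝ J (A₁ ×ˢ disc r₁) := fun z hz => analyticAt_fiberDet (hτ₁' z hz)
  have hJpos : ∀ z ∈ A₁ ×ˢ disc r₁, 0 < J z := by
    intro z hz
    have h1 := hcomp hA₁ hg hτ₁ hinv₁ z (hprod hr₁ hz)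
    have h2 := hdet _ (hinv₁ z.1 hz.1 z.2 (disc_subset_ball hr₁ hz.2)).1
    exact pos_of_mul_pos_right (by rw [h1]; exact one_pos) h2.le
  have hNa := areaMap_analytic hJ hJpos
  obtain ⟨A, r, τ, hA, hKA, hr, hτ, hinv, hz⟩ := exists_fibrewise_inverse hK
    (hA₁.prod (isOpen_disc r₁)) (fun I hI => ⟨hKA₁ hI, zero_mem_disc hr₁⟩) hNa
    (fun I _ => areaMap_zero J I) fun z hz => exists_equiv_of_fiberDet_ne_zero (by
      rw [fiberDet_areaMap hJ hJpos hz]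
      exact (hJpos z hz).ne')
  have hτ' : AnalyticOnNhd ℝ τ (A ×ˢ disc r) := hτ.mono (hprod hr)
  have hinv' : ∀ z ∈ A ×ˢ disc r, (z.1, τ z) ∈ A₁ ×ˢ disc r₁ ∧ areaMap J (z.1, τ z) = z.2 :=
    fun z hz => hinv z.1 hz.1 z.2 (disc_subset_ball hr hz.2)
  have hinv₁' : ∀ z ∈ A₁ ×ˢ disc r₁, (z.1, τ₁ z) ∈ W ∧ g (z.1, τ₁ z) = z.2 :=
    fun z hz => hinv₁ z.1 hz.1 z.2 (disc_subset_ball hr₁ hz.2)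
  -- `τ` inverts `areaMap J`, so the Jacobians of `τ₁` and `τ` cancel. In these coordinates `g`
  -- becomes `τ`, whose length depends on the distance from the origin only. The left inverse undoes
  -- the two maps in turn.
  refine ⟨A, r, fun z => τ₁ (z.1, τ z), fun z => areaMap J (z.1, g z), hA, hKA, hr,
    fun z hz => ?_, fun z hz => ⟨?_, ?_, ?_⟩, fun I hI => ?_, fun I hI z hz w hw h => ?_⟩
  · exact (hτ₁' _ (hinv' z hz).1).comp (f := fun z : P × ℝ × ℝ => (z.1, τ z))
      (analyticAt_fst.prod (hτ' z hz))
  · exact (hinv₁' _ (hinv' z hz).1).1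
  · rw [fiberDet_comp (hτ' z hz).differentiableAt (hτ₁' _ (hinv' z hz).1).differentiableAt]
    have h1 := hcomp hA hNa hτ hinv z (hprod hr hz)
    rwa [fiberDet_areaMap hJ hJpos (hinv' z hz).1] at h1
  · have h1 : g (z.1, τ₁ (z.1, τ z)) = τ z := (hinv₁' _ (hinv' z hz).1).2
    simp only [h1]
    exact (hinv' z hz).2
  · have h1 : (I, (0 : ℝ × ℝ)) ∈ A ×ˢ disc r := ⟨hI, zero_mem_disc hr⟩
    have h2 := (hinv' _ h1).1.1
    simp only [hz I hI]
    exact hz₁ I h2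
  · have h1 := hinv' (I, z) ⟨hI, hz⟩
    have h2 := hinv' (I, w) ⟨hI, hw⟩
    have e1 : g (I, τ₁ (I, τ (I, z))) = τ (I, z) := (hinv₁' _ h1.1).2
    have e2 : g (I, τ₁ (I, τ (I, w))) = τ (I, w) := (hinv₁' _ h2.1).2
    simp only [e1, e2]
    refine normSq_eq_of_areaMap_normSq_eq hJ hJpos hr₁ h1.1.1 h1.1.2 h2.1.2 ?_
    have f1 : areaMap J (I, τ (I, z)) = z := h1.2
    have f2 : areaMap J (I, τ (I, w)) = w := h2.2
    rw [f1, f2]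
    exact h

end AreaNormalization

/-! ### Lifting families of area-preserving maps to canonical maps -/

section CanonicalLift

open Set Filter Topology MeasureTheory

variable {P : Type*} [NormedAddCommGroup P] [NormedSpace ℝ P]

theorem apply_fiber (L : P × ℝ × ℝ →L[ℝ] ℝ) (a b : ℝ) :
    L (0, a, b) = a * L (0, 1, 0) + b * L (0, 0, 1) := by
  rw [← smul_eq_mul, ← smul_eq_mul, ← map_smul, ← map_smul, ← map_add]
  congr 1
  simp

/-- The Poincaré lemma for analytic one-forms along the fibres of a bundle of discs. -/
theorem exists_fiber_primitive {A : Set P} {r : ℝ} {a₁ a₂ : P × ℝ × ℝ → ℝ}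
    (h₁ : AnalyticOnNhd ℝ a₁ (A ×ˢ disc r)) (h₂ : AnalyticOnNhd ℝ a₂ (A ×ˢ disc r))
    (hclosed : ∀ z ∈ A ×ˢ disc r, fderiv ℝ a₁ z (0, 0, 1) = fderiv ℝ a₂ z (0, 1, 0)) :
    ∃ S : P × ℝ × ℝ → ℝ, AnalyticOnNhd ℝ S (A ×ˢ disc r) ∧
      ∀ z ∈ A ×ˢ disc r, ∀ a b : ℝ, fderiv ℝ S z (0, a, b) = a * a₁ z + b * a₂ z := by
  -- The primitive is the integral of the one-form along the ray from the centre of the disc.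
  let f : ℝ × P × ℝ × ℝ → ℝ := fun y =>
    y.2.2.1 * a₁ (y.2.1, y.1 • y.2.2) + y.2.2.2 * a₂ (y.2.1, y.1 • y.2.2)
  have hm : ∀ {I : P} {z : ℝ × ℝ}, (I, z) ∈ A ×ˢ disc r → ∀ t ∈ Icc (0 : ℝ) 1,
      (I, t • z) ∈ A ×ˢ disc r := fun hz t ht => ⟨hz.1, smul_mem_disc hz.2 ht.1 ht.2⟩
  have hf : ∀ z ∈ A ×ˢ disc r, ∀ t ∈ Icc (0 : ℝ) 1, AnalyticAt ℝ f (t, z) := by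
    rintro ⟨I, z⟩ hz t ht
    have hmap : AnalyticAt ℝ (fun y : ℝ × P × ℝ × ℝ => (y.2.1, y.1 • y.2.2)) (t, I, z) := by
      fun_prop
    have e1 := (h₁ _ (hm hz t ht)).comp (f := fun y : ℝ × P × ℝ × ℝ => (y.2.1, y.1 • y.2.2))
      (x := (t, I, z)) hmap
    have e2 := (h₂ _ (hm hz t ht)).comp (f := fun y : ℝ × P × ℝ × ℝ => (y.2.1, y.1 • y.2.2))
      (x := (t, I, z)) hmap
    exact ((by fun_prop : AnalyticAt ℝ (fun y : ℝ × P × ℝ × ℝ => y.2.2.1) (t, I, z)).mul e1).add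
      ((by fun_prop : AnalyticAt ℝ (fun y : ℝ × P × ℝ × ℝ => y.2.2.2) (t, I, z)).mul e2)
  refine ⟨fun z => ∫ t in (0 : ℝ)..1, f (t, z),
    fun z hz => analyticAt_intervalIntegral zero_le_one (hf z hz), ?_⟩
  rintro ⟨I, w₁, w₂⟩ hz v₁ v₂
  have hcont : ContinuousOn (fun t => fderiv ℝ f (t, I, w₁, w₂)) (Icc (0 : ℝ) 1) :=
    fun t ht => ContinuousAt.continuousWithinAt <|
      ContinuousAt.comp (f := fun t : ℝ => (t, I, w₁, w₂)) (hf _ hz t ht).fderiv.continuousAt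
        (by fun_prop)
  have hcont' : ContinuousOn (fun t => (fderiv ℝ f (t, I, w₁, w₂)).comp
      (ContinuousLinearMap.inr ℝ ℝ (P × ℝ × ℝ))) (uIcc (0 : ℝ) 1) := by
    rw [uIcc_of_le zero_le_one]
    exact hcont.clm_comp continuousOn_const
  rw [(hasFDerivAt_intervalIntegral zero_le_one (hf _ hz)).fderiv,
    ContinuousLinearMap.intervalIntegral_apply hcont'.intervalIntegrable]
  -- By closedness, the derivative of the integrand in the direction `v` is the `t`-derivative of
  -- `t` times the form at `t w` applied to `v`. Its integral is thus the form at `w`.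
  have key : ∀ t ∈ Icc (0 : ℝ) 1,
      HasDerivAt (fun t : ℝ => t * (v₁ * a₁ (I, t • (w₁, w₂)) + v₂ * a₂ (I, t • (w₁, w₂))))
        ((fderiv ℝ f (t, I, w₁, w₂)).comp (ContinuousLinearMap.inr ℝ ℝ (P × ℝ × ℝ))
          (0, v₁, v₂)) t := by
    intro t ht
    have hmt := hm hz t ht
    have d1 := (h₁ _ hmt).differentiableAt.hasFDerivAt
    have d2 := (h₂ _ hmt).differentiableAt.hasFDerivAt
    have hline : HasDerivAt (fun s : ℝ => (t, I, w₁ + s * v₁, w₂ + s * v₂))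
        ((0 : ℝ), (0 : P), v₁, v₂) 0 := by
      have l1 : ∀ w v : ℝ, HasDerivAt (fun s : ℝ => w + s * v) v 0 := fun w v => by
        simpa using ((hasDerivAt_id (0 : ℝ)).mul_const v).const_add w
      exact (hasDerivAt_const (0 : ℝ) t).prodMk ((hasDerivAt_const (0 : ℝ) I).prodMk
        ((l1 w₁ v₁).prodMk (l1 w₂ v₂)))
    have hline' : HasDerivAt (fun s : ℝ => (I, t • (w₁ + s * v₁, w₂ + s * v₂)))
        ((0 : P), t • (v₁, v₂)) 0 := by
      have l1 : ∀ w v : ℝ, HasDerivAt (fun s : ℝ => w + s * v) v 0 := fun w v => by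
        simpa using ((hasDerivAt_id (0 : ℝ)).mul_const v).const_add w
      exact (hasDerivAt_const (0 : ℝ) I).prodMk
        (((l1 w₁ v₁).prodMk (l1 w₂ v₂)).const_smul t)
    have hz0 : (t, I, w₁, w₂) = (t, I, w₁ + 0 * v₁, w₂ + 0 * v₂) := by simp
    have hz1 : (I, t • (w₁, w₂)) = (I, t • (w₁ + 0 * v₁, w₂ + 0 * v₂)) := by simp
    have hfd : HasFDerivAt f (fderiv ℝ f (t, I, w₁, w₂)) (t, I, w₁ + 0 * v₁, w₂ + 0 * v₂) := by
      rw [← hz0]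
      exact (hf _ hz t ht).differentiableAt.hasFDerivAt
    have c0 := hfd.comp_hasDerivAt (0 : ℝ) hline
    have l1 : ∀ w v : ℝ, HasDerivAt (fun s : ℝ => w + s * v) v 0 := fun w v => by
      simpa using ((hasDerivAt_id (0 : ℝ)).mul_const v).const_add w
    have c1 := (hz1 ▸ d1 : HasFDerivAt a₁ (fderiv ℝ a₁ (I, t • (w₁, w₂)))
      (I, t • (w₁ + 0 * v₁, w₂ + 0 * v₂))).comp_hasDerivAt (0 : ℝ) hline'
    have c2 := (hz1 ▸ d2 : HasFDerivAt a₂ (fderiv ℝ a₂ (I, t • (w₁, w₂)))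
      (I, t • (w₁ + 0 * v₁, w₂ + 0 * v₂))).comp_hasDerivAt (0 : ℝ) hline'
    have c3 := ((l1 w₁ v₁).mul c1).add ((l1 w₂ v₂).mul c2)
    have e0 := c0.unique c3
    rw [ContinuousLinearMap.comp_apply, ContinuousLinearMap.inr_apply, e0]
    have hray : HasDerivAt (fun t : ℝ => (I, t • (w₁, w₂))) ((0 : P), (1 : ℝ) • (w₁, w₂)) t :=
      (hasDerivAt_const t I).prodMk ((hasDerivAt_id t).smul_const (w₁, w₂))
    have r1 := d1.comp_hasDerivAt (f := fun t : ℝ => (I, t • (w₁, w₂))) t hray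
    have r2 := d2.comp_hasDerivAt (f := fun t : ℝ => (I, t • (w₁, w₂))) t hray
    refine ((hasDerivAt_id t).mul ((r1.const_mul v₁).add (r2.const_mul v₂))).congr_deriv ?_
    have hcl := hclosed _ hmt
    simp only [id, Function.comp_def, one_smul, Pi.add_apply, zero_mul, add_zero, Prod.smul_mk,
      smul_eq_mul] at hcl ⊢
    rw [apply_fiber (fderiv ℝ a₁ _) w₁ w₂, apply_fiber (fderiv ℝ a₂ _) w₁ w₂,
      apply_fiber (fderiv ℝ a₁ _) (t * v₁) (t * v₂), apply_fiber (fderiv ℝ a₂ _) (t * v₁) (t * v₂)]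
    linear_combination t * (v₁ * w₂ - v₂ * w₁) * hcl
  have hint : IntervalIntegrable (fun t => (fderiv ℝ f (t, I, w₁, w₂)).comp
      (ContinuousLinearMap.inr ℝ ℝ (P × ℝ × ℝ)) (0, v₁, v₂)) volume 0 1 :=
    (hcont'.clm_apply continuousOn_const).intervalIntegrable
  rw [intervalIntegral.integral_eq_sub_of_hasDerivAt (fun t ht => key t (by
    rwa [uIcc_of_le zero_le_one] at ht)) hint]
  simp

theorem fderiv_fderiv_symm {f : P × ℝ × ℝ → ℝ} {z : P × ℝ × ℝ} (hf : AnalyticAt ℝ f z)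
    (u v : P × ℝ × ℝ) :
    fderiv ℝ (fun y => fderiv ℝ f y u) z v = fderiv ℝ (fun y => fderiv ℝ f y v) z u := by
  have h1 : ∀ u v, fderiv ℝ (fun y => fderiv ℝ f y u) z v = fderiv ℝ (fderiv ℝ f) z v u := by
    intro u v
    have h := hf.fderiv.differentiableAt.hasFDerivAt.clm_apply (hasFDerivAt_const u z)
    rw [h.fderiv]
    simp
  rw [h1, h1]
  have : IsSymmSndFDerivAt ℝ f z :=
    (hf.contDiffAt (n := ⊤)).isSymmSndFDerivAt (by simp)
  exact this v u

/-- A family of area-preserving maps lifts to a canonical map by an action-dependent shift of the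
angles conjugated to the parameters. -/
theorem exists_canonical_lift {A : Set (Fin 4 → ℝ)} (hA : IsOpen A) {r : ℝ}
    {σ : (Fin 4 → ℝ) × ℝ × ℝ → ℝ × ℝ} (hσ : AnalyticOnNhd ℝ σ (A ×ˢ disc r))
    (hdet : ∀ z ∈ A ×ˢ disc r, fiberDet σ z = 1) :
    ∃ β : (Fin 4 → ℝ) × ℝ × ℝ → Fin 4 → ℝ, AnalyticOnNhd ℝ β (A ×ˢ disc r) ∧
      ∀ z ∈ A ×ˢ disc r, ∀ u v : (Fin 4 → ℝ) × ℝ × ℝ,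
        (∑ k, (u.1 k * fderiv ℝ β z v k - fderiv ℝ β z u k * v.1 k)) +
          ((fderiv ℝ σ z u).1 * (fderiv ℝ σ z v).2 - (fderiv ℝ σ z u).2 * (fderiv ℝ σ z v).1) =
          u.2.1 * v.2.2 - u.2.2 * v.2.1 := by
  set Ω := A ×ˢ disc r with hΩ
  have hΩo : IsOpen Ω := hA.prod (isOpen_disc r)
  let x : (Fin 4 → ℝ) × ℝ × ℝ → ℝ := fun z => (σ z).1
  let y : (Fin 4 → ℝ) × ℝ × ℝ → ℝ := fun z => (σ z).2
  have hx : AnalyticOnNhd ℝ x Ω := fun z hz => analyticAt_fst.comp (hσ z hz)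
  have hy : AnalyticOnNhd ℝ y Ω := fun z hz => analyticAt_snd.comp (hσ z hz)
  have hfx : ∀ z ∈ Ω, ∀ u, fderiv ℝ x z u = (fderiv ℝ σ z u).1 := fun z hz u => by
    have : HasFDerivAt x _ z := (hσ z hz).differentiableAt.hasFDerivAt.fst
    rw [this.fderiv]
    rfl
  have hfy : ∀ z ∈ Ω, ∀ u, fderiv ℝ y z u = (fderiv ℝ σ z u).2 := fun z hz u => by
    have : HasFDerivAt y _ z := (hσ z hz).differentiableAt.hasFDerivAt.snd
    rw [this.fderiv]
    rfl
  -- `α` is the one-form `x dy - p dq`, evaluated on constant vectors. Its differential `dx ∧ dy -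
  -- dp ∧ dq` vanishes on the fibres because the Jacobian is `1`.
  let α : (Fin 4 → ℝ) × ℝ × ℝ → (Fin 4 → ℝ) × ℝ × ℝ → ℝ := fun u z =>
    x z * fderiv ℝ y z u - z.2.1 * u.2.2
  have hyu : ∀ z ∈ Ω, ∀ u, AnalyticAt ℝ (fun z => fderiv ℝ y z u) z := fun z hz u =>
    ((ContinuousLinearMap.apply ℝ ℝ u).analyticAt _).comp (hy z hz).fderiv
  have hα : ∀ u, AnalyticOnNhd ℝ (α u) Ω := fun u z hz =>
    ((hx z hz).mul (hyu z hz u)).sub (by fun_prop)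
  have hαd : ∀ z ∈ Ω, ∀ u v, fderiv ℝ (α u) z v = fderiv ℝ x z v * fderiv ℝ y z u +
      x z * fderiv ℝ (fun z => fderiv ℝ y z u) z v - v.2.1 * u.2.2 := by
    intro z hz u v
    have h1 := (hx z hz).differentiableAt.hasFDerivAt
    have h2 := (hyu z hz u).differentiableAt.hasFDerivAt
    have h3 : HasFDerivAt (fun z : (Fin 4 → ℝ) × ℝ × ℝ => z.2.1)
        ((ContinuousLinearMap.fst ℝ ℝ ℝ).comp (ContinuousLinearMap.snd ℝ (Fin 4 → ℝ) (ℝ × ℝ))) z :=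
      hasFDerivAt_fst.comp z hasFDerivAt_snd
    have h4 : HasFDerivAt (α u) _ z := (h1.mul h2).sub (h3.mul_const u.2.2)
    rw [h4.fderiv]
    simp
    ring
  have hanti : ∀ z ∈ Ω, ∀ u v, fderiv ℝ (α u) z v - fderiv ℝ (α v) z u =
      fderiv ℝ x z v * fderiv ℝ y z u - fderiv ℝ x z u * fderiv ℝ y z v -
        (v.2.1 * u.2.2 - u.2.1 * v.2.2) := by
    intro z hz u v
    rw [hαd z hz, hαd z hz, fderiv_fderiv_symm (hy z hz) u v]
    ring
  have hαadd : ∀ z, ∀ u v, α (u + v) z = α u z + α v z := by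
    intro z u v
    simp only [α, map_add, Prod.snd_add]
    ring
  have hαsmul : ∀ z, ∀ (c : ℝ) u, α (c • u) z = c * α u z := by
    intro z c u
    simp only [α, map_smul, Prod.smul_snd, smul_eq_mul]
    ring
  obtain ⟨S, hS, hSd⟩ := exists_fiber_primitive (hα (0, 1, 0)) (hα (0, 0, 1)) (fun z hz => by
    have h1 := hanti z hz (0, 1, 0) (0, 0, 1)
    have h2 := hdet z hz
    rw [hfx z hz, hfx z hz, hfy z hz, hfy z hz] at h1
    rw [fiberDet] at h2
    simp only at h1
    linarith)
  let e : Fin 4 → (Fin 4 → ℝ) × ℝ × ℝ := fun k => (Pi.single k 1, 0, 0)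
  have hdecomp : ∀ u : (Fin 4 → ℝ) × ℝ × ℝ, u = (∑ k, u.1 k • e k) + (0, u.2.1, u.2.2) := by
    intro u
    ext k
    · simp [e, Prod.fst_sum, Finset.sum_apply, Pi.single_apply]
    · simp [e, Prod.snd_sum]
    · simp [e, Prod.snd_sum]
  have hSe : ∀ z ∈ Ω, ∀ u, AnalyticAt ℝ (fun z => fderiv ℝ S z u) z := fun z hz u =>
    ((ContinuousLinearMap.apply ℝ ℝ u).analyticAt _).comp (hS z hz).fderiv
  -- Since `S` is a primitive along the fibres, `α - dS = ∑ β_k dI_k`. Taking differentials gives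
  -- `dx ∧ dy + ∑ dI_k ∧ dβ_k = dp ∧ dq`.
  let β : (Fin 4 → ℝ) × ℝ × ℝ → Fin 4 → ℝ := fun z k => α (e k) z - fderiv ℝ S z (e k)
  have hβk : ∀ k, AnalyticOnNhd ℝ (fun z => β z k) Ω := fun k z hz =>
    (hα (e k) z hz).sub (hSe z hz (e k))
  have hβ : AnalyticOnNhd ℝ β Ω := fun z hz => AnalyticAt.pi fun k => hβk k z hz
  have hβd : ∀ z ∈ Ω, ∀ u k, fderiv ℝ β z u k = fderiv ℝ (fun z => β z k) z u := by
    intro z hz u k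
    have h1 := hasFDerivAt_pi'.1 (hβ z hz).differentiableAt.hasFDerivAt k
    rw [h1.fderiv]
    rfl
  have hmain : ∀ z ∈ Ω, ∀ u, α u z = fderiv ℝ S z u + ∑ k, β z k * u.1 k := by
    intro z hz u
    have h1 : α u z = (∑ k, u.1 k * α (e k) z) +
        (u.2.1 * α (0, 1, 0) z + u.2.2 * α (0, 0, 1) z) := by
      conv_lhs => rw [hdecomp u]
      have h2 : ((0, u.2.1, u.2.2) : (Fin 4 → ℝ) × ℝ × ℝ) =
          u.2.1 • (0, 1, 0) + u.2.2 • (0, 0, 1) := by simp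
      rw [hαadd, h2, hαadd, hαsmul, hαsmul]
      congr 1
      simp only [Fin.sum_univ_four, hαadd, hαsmul]
    have h3 : fderiv ℝ S z u = (∑ k, u.1 k * fderiv ℝ S z (e k)) +
        (u.2.1 * α (0, 1, 0) z + u.2.2 * α (0, 0, 1) z) := by
      conv_lhs => rw [hdecomp u]
      rw [map_add, hSd z hz, map_sum]
      simp only [map_smul, smul_eq_mul]
    rw [h1, h3]
    simp only [β, sub_mul, Finset.sum_sub_distrib]
    simp only [mul_comm (u.1 _)]
    ring
  refine ⟨β, hβ, fun z hz u v => ?_⟩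
  have hder : ∀ u v, fderiv ℝ (α u) z v =
      fderiv ℝ (fun z => fderiv ℝ S z u) z v + ∑ k, fderiv ℝ β z v k * u.1 k := by
    intro u v
    have h1 : α u =ᶠ[𝓝 z] fun z => fderiv ℝ S z u + ∑ k, β z k * u.1 k := by
      filter_upwards [hΩo.mem_nhds hz] with w hw
      exact hmain w hw u
    rw [h1.fderiv_eq]
    have h2 := (hSe z hz u).differentiableAt.hasFDerivAt
    have h3 : HasFDerivAt (fun z => ∑ k, β z k * u.1 k)
        (∑ k, u.1 k • fderiv ℝ (fun z => β z k) z) z :=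
      HasFDerivAt.fun_sum fun k _ =>
        ((hβk k z hz).differentiableAt.hasFDerivAt).mul_const (u.1 k)
    have h4 : HasFDerivAt (fun z => fderiv ℝ S z u + ∑ k, β z k * u.1 k) _ z := h2.add h3
    rw [h4.fderiv]
    simp only [add_apply, sum_apply, smul_apply, smul_eq_mul, hβd z hz,
      mul_comm (u.1 _)]
  have h1 := hanti z hz u v
  rw [hder, hder, fderiv_fderiv_symm (hS z hz) u v, hfx z hz, hfx z hz, hfy z hz, hfy z hz] at h1
  simp only [Finset.sum_sub_distrib, mul_comm (u.1 _)]
  linarith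

end CanonicalLift

/-! ### The canonical change of coordinates assembled from its pieces -/

section ActionAngleMap

open Set Filter Topology

/-- The change of coordinates of the ten-dimensional phase space assembled from a family `σ` of
maps of the plane, centred at `(0, π)`, and a shift `β` of the angles. -/
def actionAngleMap (σ : (Fin 4 → ℝ) × ℝ × ℝ → ℝ × ℝ) (β : (Fin 4 → ℝ) × ℝ × ℝ → Fin 4 → ℝ)
    (z : Phase) : Phase :=
  (z.1, z.2.1 + β (z.1, z.2.2), (σ (z.1, z.2.2)).1, π + (σ (z.1, z.2.2)).2)

theorem eq_of_coe_angle_eq {x y : ℝ} (h : (x : Real.Angle) = (y : Real.Angle))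
    (hxy : |x - y| < 2 * π) : x = y := by
  obtain ⟨k, hk⟩ := Real.Angle.angle_eq_iff_two_pi_dvd_sub.1 h
  have hpi := Real.pi_pos
  rw [hk, abs_mul, abs_of_pos (by positivity : (0 : ℝ) < 2 * π)] at hxy
  have h1 : |(k : ℝ)| < 1 := by
    by_contra! hc
    nlinarith
  have h2 : k = 0 := by
    rw [← Int.cast_abs] at h1
    have : |k| < 1 := by exact_mod_cast h1
    exact Int.abs_lt_one_iff.1 this
  rw [h2] at hk
  simp at hk
  linarith

/-- Neither `σ` nor `β` involves the angles, whence the periodicity. For injectivity, the bound by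
`π` lets `σ` be recovered from its second component mod `2π`; then `ρ` gives `(p, q)`, and the shift
of the angles is known. -/
theorem isCanonicalChange_actionAngleMap {A : Set (Fin 4 → ℝ)} {r : ℝ}
    {σ ρ : (Fin 4 → ℝ) × ℝ × ℝ → ℝ × ℝ} {β : (Fin 4 → ℝ) × ℝ × ℝ → Fin 4 → ℝ}
    (hσ : AnalyticOnNhd ℝ σ (A ×ˢ disc r)) (hβ : AnalyticOnNhd ℝ β (A ×ˢ disc r))
    (hinv : ∀ z ∈ A ×ˢ disc r, ρ (z.1, σ z) = z.2) (hbd : ∀ z ∈ A ×ˢ disc r, |(σ z).2| < π)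
    (hcan : ∀ z ∈ A ×ˢ disc r, ∀ u v : (Fin 4 → ℝ) × ℝ × ℝ,
        (∑ k, (u.1 k * fderiv ℝ β z v k - fderiv ℝ β z u k * v.1 k)) +
          ((fderiv ℝ σ z u).1 * (fderiv ℝ σ z v).2 - (fderiv ℝ σ z u).2 * (fderiv ℝ σ z v).1) =
          u.2.1 * v.2.2 - u.2.2 * v.2.1) :
    IsCanonicalChange A r (actionAngleMap σ β) := by
  have hmem : ∀ z ∈ phaseDomain A r, (z.1, z.2.2) ∈ A ×ˢ disc r := fun z hz => hz
  have hpr : ∀ z : Phase, HasFDerivAt (fun z : Phase => (z.1, z.2.2))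
      ((ContinuousLinearMap.fst ℝ (Fin 4 → ℝ) ((Fin 4 → ℝ) × ℝ × ℝ)).prod
        ((ContinuousLinearMap.snd ℝ (Fin 4 → ℝ) (ℝ × ℝ)).comp
          (ContinuousLinearMap.snd ℝ (Fin 4 → ℝ) ((Fin 4 → ℝ) × ℝ × ℝ)))) z := fun z =>
    hasFDerivAt_fst.prodMk (hasFDerivAt_snd.comp z hasFDerivAt_snd)
  refine ⟨fun z hz => ?_, fun z hz u v => ?_, fun z _ => rfl, fun z hz k => ?_,
    fun z hz z' hz' h1 h2 h3 h4 => ?_⟩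
  · have hp : AnalyticAt ℝ (fun z : Phase => (z.1, z.2.2)) z := by fun_prop
    have a1 : AnalyticAt ℝ (fun z : Phase => σ (z.1, z.2.2)) z :=
      (hσ _ (hmem z hz)).comp (f := fun z : Phase => (z.1, z.2.2)) hp
    have a2 : AnalyticAt ℝ (fun z : Phase => β (z.1, z.2.2)) z :=
      (hβ _ (hmem z hz)).comp (f := fun z : Phase => (z.1, z.2.2)) hp
    exact analyticAt_fst.prod (((by fun_prop : AnalyticAt ℝ (fun z : Phase => z.2.1) z).add
      a2).prod ((analyticAt_fst_comp a1).prod (analyticAt_const.add (analyticAt_snd_comp a1))))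
  · have d1 := (hσ _ (hmem z hz)).differentiableAt.hasFDerivAt.comp z (hpr z)
    have d2 := (hβ _ (hmem z hz)).differentiableAt.hasFDerivAt.comp z (hpr z)
    have d3 : HasFDerivAt (fun z : Phase => z.2.1) _ z :=
      (hasFDerivAt_fst (𝕜 := ℝ)).comp z hasFDerivAt_snd
    have hd : HasFDerivAt (actionAngleMap σ β) _ z := hasFDerivAt_fst.prodMk
      ((d3.add d2).prodMk (d1.fst.prodMk (d1.snd.const_add π)))
    rw [hd.fderiv]
    have h := hcan _ (hmem z hz) (u.1, u.2.2) (v.1, v.2.2)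
    simp only [symplForm, ContinuousLinearMap.prod_apply, ContinuousLinearMap.comp_apply,
      ContinuousLinearMap.coe_fst', ContinuousLinearMap.coe_snd', add_apply, Pi.add_apply] at h ⊢
    rw [← h, ← add_assoc, ← Finset.sum_add_distrib]
    congr 1
    exact Finset.sum_congr rfl fun k _ => by ring
  · ext i
    · simp [actionAngleMap]
    · simp only [actionAngleMap, Prod.fst_add, Prod.snd_add, Prod.mk_zero_zero, add_zero,
        Pi.add_apply]
      ring
    · simp [actionAngleMap, Prod.mk_zero_zero]
    · simp [actionAngleMap, Prod.mk_zero_zero]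
  · have hI : z.1 = z'.1 := h1
    have e2 : (σ (z.1, z.2.2)).2 = (σ (z'.1, z'.2.2)).2 := by
      have h5 := eq_of_coe_angle_eq h4 (by
        have b1 := abs_lt.1 (hbd _ (hmem z hz))
        have b2 := abs_lt.1 (hbd _ (hmem z' hz'))
        simp only [actionAngleMap]
        rw [abs_lt]
        constructor <;> linarith [b1.1, b1.2, b2.1, b2.2])
      simp only [actionAngleMap] at h5
      linarith
    have e1 : σ (z.1, z.2.2) = σ (z'.1, z'.2.2) := Prod.ext h3 e2
    have hpq : z.2.2 = z'.2.2 := by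
      have i1 : ρ (z.1, σ (z.1, z.2.2)) = z.2.2 := hinv _ (hmem z hz)
      have i2 : ρ (z'.1, σ (z'.1, z'.2.2)) = z'.2.2 := hinv _ (hmem z' hz')
      rw [e1, hI] at i1
      exact i1.symm.trans i2
    refine ⟨hI, fun k => ?_, hpq⟩
    have h5 := h2 k
    simp only [actionAngleMap, Pi.add_apply, hI, hpq, Real.Angle.coe_add] at h5
    exact add_right_cancel h5

end ActionAngleMap

/-! ### The vector product -/

section VectorProduct

theorem inner_coord (u v : E3) : ⟪u, v⟫ = u 0 * v 0 + u 1 * v 1 + u 2 * v 2 := by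
  simp [PiLp.inner_apply, Fin.sum_univ_three]
  ring

theorem cross_coord (u v : E3) : cross u v 0 = u 1 * v 2 - u 2 * v 1 ∧
    cross u v 1 = u 2 * v 0 - u 0 * v 2 ∧ cross u v 2 = u 0 * v 1 - u 1 * v 0 := by
  simp [cross, crossProduct]

theorem ext_coord {u v : E3} (h0 : u 0 = v 0) (h1 : u 1 = v 1) (h2 : u 2 = v 2) : u = v := by
  ext i
  fin_cases i
  · exact h0
  · exact h1
  · exact h2

theorem normSq_eq (u : E3) : ‖u‖ ^ 2 = ⟪u, u⟫ := (real_inner_self_eq_norm_sq u).symm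

theorem cross_add_left (u v w : E3) : cross (u + v) w = cross u w + cross v w := by
  simp [cross]

theorem cross_add_right (u v w : E3) : cross u (v + w) = cross u v + cross u w := by
  simp [cross]

theorem cross_sub_right (u v w : E3) : cross u (v - w) = cross u v - cross u w := by
  simp [cross]

theorem cross_smul_left (c : ℝ) (u v : E3) : cross (c • u) v = c • cross u v := by
  simp [cross]

theorem cross_smul_right (c : ℝ) (u v : E3) : cross u (c • v) = c • cross u v := by
  simp [cross]

theorem cross_self (u : E3) : cross u u = 0 := by
  simp [cross]

theorem cross_zero_right (u : E3) : cross u 0 = 0 := by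
  simp [cross]

theorem cross_comm (u v : E3) : cross u v = -cross v u := by
  obtain ⟨a0, a1, a2⟩ := cross_coord u v
  obtain ⟨b0, b1, b2⟩ := cross_coord v u
  refine ext_coord ?_ ?_ ?_
  · rw [a0, PiLp.neg_apply, b0]; ring
  · rw [a1, PiLp.neg_apply, b1]; ring
  · rw [a2, PiLp.neg_apply, b2]; ring

theorem inner_cross_cross (a b c d : E3) :
    ⟪cross a b, cross c d⟫ = ⟪a, c⟫ * ⟪b, d⟫ - ⟪a, d⟫ * ⟪b, c⟫ := by
  obtain ⟨a0, a1, a2⟩ := cross_coord a b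
  obtain ⟨b0, b1, b2⟩ := cross_coord c d
  simp only [inner_coord, a0, a1, a2, b0, b1, b2]
  ring

theorem inner_cross_self_left (u v : E3) : ⟪cross u v, u⟫ = 0 := by
  obtain ⟨a0, a1, a2⟩ := cross_coord u v
  simp only [inner_coord, a0, a1, a2]
  ring

theorem inner_cross_self_right (u v : E3) : ⟪cross u v, v⟫ = 0 := by
  obtain ⟨a0, a1, a2⟩ := cross_coord u v
  simp only [inner_coord, a0, a1, a2]
  ring

theorem inner_cross_rotate (u v w : E3) : ⟪u, cross v w⟫ = ⟪cross u v, w⟫ := by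
  obtain ⟨a0, a1, a2⟩ := cross_coord v w
  obtain ⟨b0, b1, b2⟩ := cross_coord u v
  simp only [inner_coord, a0, a1, a2, b0, b1, b2]
  ring

theorem cross_cross_left (u v w : E3) : cross (cross u v) w = ⟪u, w⟫ • v - ⟪v, w⟫ • u := by
  obtain ⟨a0, a1, a2⟩ := cross_coord u v
  obtain ⟨b0, b1, b2⟩ := cross_coord (cross u v) w
  refine ext_coord ?_ ?_ ?_
  · rw [b0, a1, a2]; simp [inner_coord]; ring
  · rw [b1, a0, a2]; simp [inner_coord]; ring
  · rw [b2, a0, a1]; simp [inner_coord]; ring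

theorem cross_cross_right (u v w : E3) : cross u (cross v w) = ⟪u, w⟫ • v - ⟪u, v⟫ • w := by
  rw [cross_comm, cross_cross_left, real_inner_comm u w, real_inner_comm u v]
  simp

theorem norm_cross_sq (u v : E3) : ‖cross u v‖ ^ 2 = ‖u‖ ^ 2 * ‖v‖ ^ 2 - ⟪u, v⟫ ^ 2 := by
  rw [normSq_eq, inner_cross_cross, normSq_eq, normSq_eq, real_inner_comm u v]
  ring

theorem norm_cross_of_orth {u v : E3} (h : ⟪u, v⟫ = 0) : ‖cross u v‖ = ‖u‖ * ‖v‖ := by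
  have h1 := norm_cross_sq u v
  rw [h] at h1
  exact (sq_eq_sq₀ (norm_nonneg _) (by positivity)).1 (by rw [h1]; ring)

/-- The expansion of `v` in the orthogonal vectors `u`, `w × u` of the plane normal to `w`,
multiplied out so that degenerate cases need no exception. -/
theorem decompose_orth {w u v : E3} (hu : ⟪w, u⟫ = 0) (hv : ⟪w, v⟫ = 0) :
    (‖w‖ ^ 2 * ‖u‖ ^ 2) • v = (‖w‖ ^ 2 * ⟪u, v⟫) • u + ⟪w, cross u v⟫ • cross w u := by
  have h1 : cross (cross w u) (cross v (cross w u)) =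
      (‖w‖ ^ 2 * ‖u‖ ^ 2) • v - ⟪w, cross u v⟫ • cross w u := by
    rw [cross_cross_right, ← normSq_eq, norm_cross_sq, hu, ← inner_cross_rotate]
    simp
  have h2 : cross v (cross w u) = ⟪u, v⟫ • w := by
    rw [cross_cross_right, real_inner_comm w v, hv, real_inner_comm u v]
    simp
  rw [h2, cross_smul_right, cross_cross_left, real_inner_comm w u, hu, ← normSq_eq] at h1
  rw [sub_eq_iff_eq_add.1 h1.symm, zero_smul, sub_zero, smul_smul, mul_comm (‖w‖ ^ 2) ⟪u, v⟫]

/-! ### Oriented angles -/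

/-- The cross product of `u` and `v` is parallel to `w`, so the complex number defining the angle
has modulus `‖w‖ ‖u‖ ‖v‖`. -/
theorem angleAbout_spec {w u v : E3} (hu : ⟪w, u⟫ = 0) (hv : ⟪w, v⟫ = 0) :
    ‖w‖ * ⟪u, v⟫ = ‖w‖ * ‖u‖ * ‖v‖ * (angleAbout w u v).cos ∧
      ⟪w, cross u v⟫ = ‖w‖ * ‖u‖ * ‖v‖ * (angleAbout w u v).sin := by
  have hwc : ⟪w, cross u v⟫ ^ 2 = ‖w‖ ^ 2 * ‖cross u v‖ ^ 2 := by
    have h := norm_cross_sq w (cross u v)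
    rw [cross_cross_right, hu, hv] at h
    simp at h
    linarith
  have hn : ‖(⟨‖w‖ * ⟪u, v⟫, ⟪w, cross u v⟫⟩ : ℂ)‖ = ‖w‖ * ‖u‖ * ‖v‖ := by
    refine (sq_eq_sq₀ (norm_nonneg _) (by positivity)).1 ?_
    rw [Complex.sq_norm, Complex.normSq_apply]
    have h := norm_cross_sq u v
    linear_combination hwc + ‖w‖ ^ 2 * h
  have h1 := Complex.norm_mul_cos_arg ⟨‖w‖ * ⟪u, v⟫, ⟪w, cross u v⟫⟩
  have h2 := Complex.norm_mul_sin_arg ⟨‖w‖ * ⟪u, v⟫, ⟪w, cross u v⟫⟩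
  rw [hn] at h1 h2
  simp only [angleAbout, Real.Angle.cos_coe, Real.Angle.sin_coe]
  exact ⟨h1.symm, h2.symm⟩

theorem eq_of_angleAbout {w u v : E3} (hu : ⟪w, u⟫ = 0) (hv : ⟪w, v⟫ = 0) :
    (‖w‖ ^ 2 * ‖u‖ ^ 2) • v = (‖w‖ ^ 2 * ‖u‖ * ‖v‖ * (angleAbout w u v).cos) • u +
      (‖w‖ * ‖u‖ * ‖v‖ * (angleAbout w u v).sin) • cross w u := by
  obtain ⟨h1, h2⟩ := angleAbout_spec hu hv
  rw [decompose_orth hu hv, h2]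
  congr 2
  linear_combination ‖w‖ * h1

theorem inner_eq_of_angleAbout {w u v : E3} (hu : ⟪w, u⟫ = 0) (hv : ⟪w, v⟫ = 0) (hw0 : w ≠ 0) :
    ⟪u, v⟫ = ‖u‖ * ‖v‖ * (angleAbout w u v).cos := by
  have h1 := (angleAbout_spec hu hv).1
  have : ‖w‖ ≠ 0 := norm_ne_zero_iff.2 hw0
  exact mul_left_cancel₀ this (by rw [h1]; ring)

theorem angleAbout_eq {w u : E3} (hu : ⟪w, u⟫ = 0) (hw0 : w ≠ 0) (hu0 : u ≠ 0) {c : ℝ} (hc : 0 < c)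
    (θ : Real.Angle) :
    angleAbout w u (c • ((‖w‖ * θ.cos) • u + θ.sin • cross w u)) = θ := by
  have hw := norm_pos_iff.2 hw0
  have hun := norm_pos_iff.2 hu0
  have e1 : ⟪u, cross w u⟫ = 0 := by rw [real_inner_comm, inner_cross_self_right]
  have e2 : ⟪w, cross u (cross w u)⟫ = ‖w‖ ^ 2 * ‖u‖ ^ 2 := by
    rw [cross_cross_right, real_inner_comm w u, hu, ← normSq_eq]
    simp [inner_smul_right]
    ring
  have h := Complex.arg_mul_cos_add_sin_mul_I_coe_angle
    (r := c * ‖w‖ ^ 2 * ‖u‖ ^ 2) (by positivity) θ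
  have e : (⟨‖w‖ * ⟪u, c • ((‖w‖ * θ.cos) • u + θ.sin • cross w u)⟫,
      ⟪w, cross u (c • ((‖w‖ * θ.cos) • u + θ.sin • cross w u))⟫⟩ : ℂ) =
      ((c * ‖w‖ ^ 2 * ‖u‖ ^ 2 : ℝ) : ℂ) * (θ.cos + θ.sin * Complex.I) := by
    have r1 : ⟪u, c • ((‖w‖ * θ.cos) • u + θ.sin • cross w u)⟫ =
        c * ‖w‖ * ‖u‖ ^ 2 * θ.cos := by
      rw [inner_smul_right, inner_add_right, inner_smul_right, inner_smul_right, e1, ← normSq_eq]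
      ring
    have r2 : ⟪w, cross u (c • ((‖w‖ * θ.cos) • u + θ.sin • cross w u))⟫ =
        c * ‖w‖ ^ 2 * ‖u‖ ^ 2 * θ.sin := by
      rw [cross_smul_right, cross_add_right, cross_smul_right, cross_smul_right, cross_self,
        smul_zero, zero_add, inner_smul_right, inner_smul_right, e2]
      ring
    rw [r1, r2]
    apply Complex.ext
    · simp [-Complex.ofReal_mul, -Complex.ofReal_pow]
      ring
    · simp [-Complex.ofReal_mul, -Complex.ofReal_pow]
  rw [angleAbout, e]
  exact h

/-! ### Rotations of space -/

/-- Linear maps preserving the inner and the vector product. -/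
structure IsRot (R : E3 →ₗ[ℝ] E3) : Prop where
  inner_map : ∀ u v, ⟪R u, R v⟫ = ⟪u, v⟫
  map_cross : ∀ u v, R (cross u v) = cross (R u) (R v)

theorem IsRot.norm_map {R : E3 →ₗ[ℝ] E3} (hR : IsRot R) (u : E3) : ‖R u‖ = ‖u‖ := by
  refine (sq_eq_sq₀ (norm_nonneg _) (norm_nonneg _)).1 ?_
  rw [normSq_eq, normSq_eq, hR.inner_map]

theorem frame_expand {p q : E3} (hp : ‖p‖ = 1) (hq : ‖q‖ = 1) (hpq : ⟪p, q⟫ = 0) (v : E3) :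
    v = ⟪p, v⟫ • p + ⟪q, v⟫ • q + ⟪cross p q, v⟫ • cross p q := by
  have h0 : ⟪p, v - ⟪p, v⟫ • p⟫ = 0 := by
    rw [inner_sub_right, inner_smul_right, ← normSq_eq, hp]
    ring
  have h := decompose_orth hpq h0
  rw [hp, hq, inner_sub_right, inner_smul_right, real_inner_comm p q, hpq, cross_sub_right,
    cross_smul_right, inner_sub_right, inner_smul_right, inner_cross_rotate p q v,
    real_inner_comm (cross q p) p, inner_cross_self_right] at h
  simp only [one_pow, one_mul, one_smul, mul_zero, sub_zero] at h
  rw [add_assoc, ← h]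
  abel

theorem frame_cross {p q : E3} (hp : ‖p‖ = 1) (hq : ‖q‖ = 1) (hpq : ⟪p, q⟫ = 0)
    (x₁ x₂ x₃ y₁ y₂ y₃ : ℝ) :
    cross (x₁ • p + x₂ • q + x₃ • cross p q) (y₁ • p + y₂ • q + y₃ • cross p q) =
      (x₂ * y₃ - x₃ * y₂) • p + (x₃ * y₁ - x₁ * y₃) • q + (x₁ * y₂ - x₂ * y₁) • cross p q := by
  have h1 : cross p (cross p q) = -q := by
    rw [cross_cross_right, hpq, ← normSq_eq, hp]; simp
  have h2 : cross q (cross p q) = p := by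
    rw [cross_cross_right, real_inner_comm p q, hpq, ← normSq_eq, hq]; simp
  have h3 : cross (cross p q) p = q := by rw [cross_comm, h1, neg_neg]
  have h4 : cross (cross p q) q = -p := by rw [cross_comm, h2]
  have h5 : cross q p = -cross p q := cross_comm _ _
  simp only [cross_add_left, cross_add_right, cross_smul_left, cross_smul_right, cross_self, h1, h2,
    h3, h4, h5]
  module

/-- Each orthonormal pair is completed by its vector product. Inner and vector products have the
same coordinate expressions in both frames. -/
theorem exists_isRot {p q p' q' : E3} (hp : ‖p‖ = 1) (hq : ‖q‖ = 1) (hpq : ⟪p, q⟫ = 0)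
    (hp' : ‖p'‖ = 1) (hq' : ‖q'‖ = 1) (hpq' : ⟪p', q'⟫ = 0) :
    ∃ R : E3 →ₗ[ℝ] E3, IsRot R ∧ R p = p' ∧ R q = q' := by
  let R : E3 →ₗ[ℝ] E3 := (innerₛₗ ℝ p).smulRight p' + (innerₛₗ ℝ q).smulRight q' +
    (innerₛₗ ℝ (cross p q)).smulRight (cross p' q')
  have hR : ∀ v, R v = ⟪p, v⟫ • p' + ⟪q, v⟫ • q' + ⟪cross p q, v⟫ • cross p' q' := fun v => by
    simp [R]
  have hpp : ⟪p, p⟫ = 1 := by rw [← normSq_eq, hp, one_pow]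
  have hqq : ⟪q, q⟫ = 1 := by rw [← normSq_eq, hq, one_pow]
  have hpp' : ⟪p', p'⟫ = 1 := by rw [← normSq_eq, hp', one_pow]
  have hqq' : ⟪q', q'⟫ = 1 := by rw [← normSq_eq, hq', one_pow]
  have hqp : ⟪q, p⟫ = 0 := by rw [real_inner_comm, hpq]
  have hqp' : ⟪q', p'⟫ = 0 := by rw [real_inner_comm, hpq']
  have hgram : ∀ {p q : E3}, ⟪p, p⟫ = 1 → ⟪q, q⟫ = 1 → ⟪p, q⟫ = 0 → ⟪q, p⟫ = 0 →
      ∀ x₁ x₂ x₃ y₁ y₂ y₃ : ℝ,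
      ⟪x₁ • p + x₂ • q + x₃ • cross p q, y₁ • p + y₂ • q + y₃ • cross p q⟫ =
        x₁ * y₁ + x₂ * y₂ + x₃ * y₃ := by
    intro p q a b c d x₁ x₂ x₃ y₁ y₂ y₃
    have e1 := inner_cross_self_left p q
    have e2 := inner_cross_self_right p q
    have e3 : ⟪p, cross p q⟫ = 0 := by rw [real_inner_comm, e1]
    have e4 : ⟪q, cross p q⟫ = 0 := by rw [real_inner_comm, e2]
    have e5 : ⟪cross p q, cross p q⟫ = 1 := by
      rw [inner_cross_cross, a, b, c]; ring
    simp only [inner_add_left, inner_add_right, real_inner_smul_left, inner_smul_right, a, b, c, d,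
      e1, e2, e3, e4, e5]
    ring
  refine ⟨R, ⟨fun u v => ?_, fun u v => ?_⟩, ?_, ?_⟩
  · rw [hR, hR, hgram hpp' hqq' hpq' hqp']
    conv_rhs => rw [frame_expand hp hq hpq u, frame_expand hp hq hpq v]
    rw [hgram hpp hqq hpq hqp]
  · have h1 : ∀ x y z : ℝ, R (x • p + y • q + z • cross p q) =
        x • p' + y • q' + z • cross p' q' := by
      intro x y z
      have i1 := hgram hpp hqq hpq hqp 1 0 0 x y z
      have i2 := hgram hpp hqq hpq hqp 0 1 0 x y z
      have i3 := hgram hpp hqq hpq hqp 0 0 1 x y z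
      simp only [one_smul, zero_smul, add_zero, zero_add, one_mul, zero_mul] at i1 i2 i3
      rw [hR, i1, i2, i3]
    conv_lhs => rw [frame_expand hp hq hpq u, frame_expand hp hq hpq v]
    rw [frame_cross hp hq hpq, h1, hR u, hR v, frame_cross hp' hq' hpq']
  · rw [hR, hpp, hqp, inner_cross_self_left]
    simp
  · rw [hR, hqq, hpq, inner_cross_self_right]
    simp

/-- A vector normal to `w` is determined by its length and its angle from a given nonzero `u`, by
`eq_of_angleAbout`. -/
theorem IsRot.map_eq_of_angleAbout {R : E3 →ₗ[ℝ] E3} (hR : IsRot R) {w u v v' : E3}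
    (hw0 : w ≠ 0) (hu0 : u ≠ 0) (hu : ⟪w, u⟫ = 0) (hv : ⟪w, v⟫ = 0) (hv' : ⟪R w, v'⟫ = 0)
    (hn : ‖v‖ = ‖v'‖) (ha : angleAbout w u v = angleAbout (R w) (R u) v') : R v = v' := by
  have hw := norm_pos_iff.2 hw0
  have hun := norm_pos_iff.2 hu0
  have h1 := congrArg R (eq_of_angleAbout hu hv)
  have h2 := eq_of_angleAbout (w := R w) (u := R u) (v := v') (by rw [hR.inner_map, hu]) hv'
  rw [hR.norm_map, hR.norm_map, ← ha, ← hn] at h2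
  simp only [map_add, map_smul, hR.map_cross] at h1
  rw [← h2] at h1
  exact smul_right_injective E3 (by positivity : ‖w‖ ^ 2 * ‖u‖ ^ 2 ≠ 0) h1

end VectorProduct

/-! ### Configurations with the same outer variables differ by a rotation -/

namespace MassData

variable (D : MassData) {n : ℕ} {s s' : Config}

theorem Lam_pos (s : Config) (i : ℕ) : 0 < D.Lam s i := by
  have := D.mr_pos i
  have := D.Mr_pos i
  have := (s i).a_pos
  unfold Lam
  positivity

theorem one_sub_e_sq_pos (o : Ellipse) : 0 < 1 - o.e ^ 2 := by
  nlinarith [o.e_pos, o.e_lt_one]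

theorem norm_angMom (s : Config) (i : ℕ) : ‖D.angMom s i‖ = D.Lam s i * √(1 - (s i).e ^ 2) := by
  have := (D.Lam_pos s i).le
  rw [angMom, norm_smul, (s i).norm_N, mul_one, Real.norm_of_nonneg (by positivity)]

theorem norm_angMom_pos (s : Config) (i : ℕ) : 0 < ‖D.angMom s i‖ := by
  have := D.Lam_pos s i
  have := one_sub_e_sq_pos (s i)
  rw [norm_angMom]
  positivity

theorem inner_angMom_P (s : Config) (i : ℕ) : ⟪D.angMom s i, (s i).P⟫ = 0 := by
  rw [angMom, real_inner_smul_left, real_inner_comm, (s i).orth, mul_zero]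

theorem S_eq_add (s : Config) {j : ℕ} (hj : j ≤ n) :
    D.S n s j = D.angMom s j + D.S n s (j + 1) := by
  unfold S
  have h : Finset.Ioc j n = Finset.Icc (j + 1) n := by
    ext k
    simp
  rw [← Finset.add_sum_Ioc_eq_sum_Icc hj, h]

theorem S_succ_self (s : Config) : D.S n s (n + 1) = 0 := by
  simp [S]

theorem S_self (s : Config) : D.S n s n = D.angMom s n := by
  rw [S_eq_add D s le_rfl, S_succ_self, add_zero]

/-- The perihelion is orthogonal to its own angular momentum. Therefore `Θ_j` is the component along
`P_j` of both `S_j` and `S_{j+1}`, and with `χ` it fixes the lengths of both nodes adjacent to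
`P_j`. -/
theorem inner_S_P (s : Config) {j : ℕ} (hj : j ≤ n) :
    ⟪D.S n s j, (s j).P⟫ = ⟪D.S n s (j + 1), (s j).P⟫ := by
  rw [S_eq_add D s hj, inner_add_left, inner_angMom_P, zero_add]

variable {D}

theorem Regular.S_ne_zero (h : D.Regular n s) {j : ℕ} (h1 : 1 ≤ j) (hj : j ≤ n) :
    D.S n s j ≠ 0 := by
  intro h0
  refine (h j h1 hj).1 ?_
  unfold nodeNu
  split_ifs with hj1
  · rw [← hj1, h0, cross_zero_right]
  · rw [h0, cross_zero_right]

theorem nodeNu_succ {k : ℕ} (hk : 1 ≤ k) :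
    D.nodeNu n s (k + 1) = cross (s k).P (D.S n s (k + 1)) := by
  rw [nodeNu, if_neg (by omega), Nat.add_sub_cancel]

theorem nodeN_of_lt {k : ℕ} (hk : k < n) :
    D.nodeN n s k = cross (D.S n s k) (s k).P := by
  rw [nodeN, if_neg hk.ne]

theorem Theta_of_pos {k : ℕ} (hk : 1 ≤ k) : D.Theta n s k = ⟪D.S n s (k + 1), (s k).P⟫ := by
  rw [Theta, if_neg (by omega)]

theorem vartheta_of_pos {k : ℕ} (hk : 1 ≤ k) :
    D.vartheta n s k = angleAbout (s k).P (D.nodeN n s k) (D.nodeNu n s (k + 1)) := by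
  rw [vartheta, if_neg (by omega)]

theorem norm_nodeNu_succ_sq {k : ℕ} (hk : 1 ≤ k) :
    ‖D.nodeNu n s (k + 1)‖ ^ 2 = D.chi n s k ^ 2 - D.Theta n s k ^ 2 := by
  rw [nodeNu_succ hk, norm_cross_sq, (s k).norm_P, Theta_of_pos hk, real_inner_comm, chi]
  ring

theorem norm_nodeN_sq {k : ℕ} (hk : 1 ≤ k) (hkn : k < n) :
    ‖D.nodeN n s k‖ ^ 2 = D.chi n s (k - 1) ^ 2 - D.Theta n s k ^ 2 := by
  rw [nodeN_of_lt hkn, norm_cross_sq, (s k).norm_P, Theta_of_pos hk, inner_S_P D s hkn.le, chi,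
    Nat.sub_add_cancel hk]
  ring

theorem norm_nodeNu_succ_eq {k : ℕ} (hk : 1 ≤ k) (hT : D.Theta n s k = D.Theta n s' k)
    (hc : D.chi n s k = D.chi n s' k) :
    ‖D.nodeNu n s (k + 1)‖ = ‖D.nodeNu n s' (k + 1)‖ := by
  refine (sq_eq_sq₀ (norm_nonneg _) (norm_nonneg _)).1 ?_
  rw [norm_nodeNu_succ_sq hk, norm_nodeNu_succ_sq hk, hT, hc]

theorem norm_nodeN_eq {k : ℕ} (hk : 1 ≤ k) (hkn : k < n) (hT : D.Theta n s k = D.Theta n s' k)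
    (hc : D.chi n s (k - 1) = D.chi n s' (k - 1)) : ‖D.nodeN n s k‖ = ‖D.nodeN n s' k‖ := by
  refine (sq_eq_sq₀ (norm_nonneg _) (norm_nonneg _)).1 ?_
  rw [norm_nodeN_sq hk hkn, norm_nodeN_sq hk hkn, hT, hc]

theorem P_ne_zero (o : Ellipse) : o.P ≠ 0 := by
  rw [← norm_ne_zero_iff, o.norm_P]
  exact one_ne_zero

/-- The rotation is chosen to match `P_i` and the normalized node `n_i`, which are orthonormal. The
nodes have equal length, and `S_i = Θ_i P_i + P_i × n_i`. -/
theorem exists_isRot_initial (h : D.Regular n s) (h' : D.Regular n s') {i : ℕ} (hi : 1 ≤ i)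
    (hin : i < n) (hT : D.Theta n s i = D.Theta n s' i)
    (hc : D.chi n s (i - 1) = D.chi n s' (i - 1)) :
    ∃ R : E3 →ₗ[ℝ] E3, IsRot R ∧ R (s i).P = (s' i).P ∧ R (D.S n s i) = D.S n s' i := by
  have hn := norm_nodeN_eq hi hin hT hc
  have h0 := (h i hi hin.le).2
  have h0' := (h' i hi hin.le).2
  have e : ∀ s : Config, D.S n s i = D.Theta n s i • (s i).P +
      cross (s i).P (D.nodeN n s i) := by
    intro s
    rw [nodeN_of_lt hin, cross_cross_right, ← normSq_eq, (s i).norm_P, Theta_of_pos hi,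
      ← inner_S_P D s hin.le, real_inner_comm]
    simp
  have horth : ∀ s : Config, ⟪(s i).P, (‖D.nodeN n s i‖⁻¹) • D.nodeN n s i⟫ = 0 := by
    intro s
    rw [inner_smul_right, nodeN_of_lt hin, real_inner_comm, inner_cross_self_right, mul_zero]
  obtain ⟨R, hR, hRP, hRq⟩ := exists_isRot (s i).norm_P (norm_smul_inv_norm (𝕜 := ℝ) h0) (horth s)
    (s' i).norm_P (norm_smul_inv_norm (𝕜 := ℝ) h0') (horth s')
  refine ⟨R, hR, hRP, ?_⟩
  have hRn : R (D.nodeN n s i) = D.nodeN n s' i := by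
    rw [map_smul, ← hn] at hRq
    exact smul_right_injective E3 (inv_ne_zero (norm_ne_zero_iff.2 h0)) hRq
  rw [e s, e s', map_add, map_smul, hR.map_cross, hRP, hRn, hT]

/-- In the plane normal to `P_k`, the angle `ϑ_k` leads from `n_k` to `ν_{k+1}`; then `S_{k+1} = Θ_k
P_k + ν_{k+1} × P_k`. -/
theorem map_S_succ {R : E3 →ₗ[ℝ] E3} (hR : IsRot R) (h : D.Regular n s) {k : ℕ}
    (hk : 1 ≤ k) (hkn : k < n) (hP : R (s k).P = (s' k).P) (hS : R (D.S n s k) = D.S n s' k)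
    (hT : D.Theta n s k = D.Theta n s' k) (hc : D.chi n s k = D.chi n s' k)
    (hv : D.vartheta n s k = D.vartheta n s' k) :
    R (D.S n s (k + 1)) = D.S n s' (k + 1) := by
  have hN : R (D.nodeN n s k) = D.nodeN n s' k := by
    rw [nodeN_of_lt hkn, nodeN_of_lt hkn, hR.map_cross, hP, hS]
  have hnu : R (D.nodeNu n s (k + 1)) = D.nodeNu n s' (k + 1) := by
    refine hR.map_eq_of_angleAbout (w := (s k).P) (u := D.nodeN n s k) (P_ne_zero _)
      (h k hk hkn.le).2 ?_ ?_ ?_ (norm_nodeNu_succ_eq hk hT hc) ?_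
    · rw [nodeN_of_lt hkn, real_inner_comm, inner_cross_self_right]
    · rw [nodeNu_succ hk, real_inner_comm, inner_cross_self_left]
    · rw [hP, nodeNu_succ hk, real_inner_comm, inner_cross_self_left]
    · rw [hP, hN, ← vartheta_of_pos hk, ← vartheta_of_pos hk, hv]
  have e : ∀ s : Config, D.S n s (k + 1) = D.Theta n s k • (s k).P +
      cross (D.nodeNu n s (k + 1)) (s k).P := by
    intro s
    rw [nodeNu_succ hk, cross_cross_left, ← normSq_eq, (s k).norm_P, Theta_of_pos hk]
    simp
  rw [e s, e s', map_add, map_smul, hR.map_cross, hP, hnu, hT]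

/-- In the plane normal to `S_{k+1}`, the angle `κ_k` leads from `ν_{k+1}` to `n_{k+1}`. Below the
last index the perihelion is recovered from `χ_k² P_{k+1} = Θ_{k+1} S_{k+1} + n_{k+1} × S_{k+1}`. At
the last index the node is the perihelion itself, so no `Θ` is needed. -/
theorem map_P_succ {R : E3 →ₗ[ℝ] E3} (hR : IsRot R) (h : D.Regular n s) {k : ℕ}
    (hk : 1 ≤ k) (hkn : k < n) (hP : R (s k).P = (s' k).P)
    (hS : R (D.S n s (k + 1)) = D.S n s' (k + 1))
    (hT : k + 1 < n → D.Theta n s (k + 1) = D.Theta n s' (k + 1))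
    (hc : D.chi n s k = D.chi n s' k) (hκ : D.kappa n s k = D.kappa n s' k) :
    R (s (k + 1)).P = (s' (k + 1)).P := by
  have hS0 := h.S_ne_zero (by omega : 1 ≤ k + 1) hkn
  have horth : ∀ s : Config, ⟪D.S n s (k + 1), D.nodeN n s (k + 1)⟫ = 0 := by
    intro s
    rcases (Nat.succ_le_of_lt hkn).lt_or_eq with hlt | heq
    · rw [nodeN_of_lt hlt, real_inner_comm, inner_cross_self_left]
    · have hkn' : k + 1 = n := heq
      rw [nodeN, if_pos hkn', hkn', S_self, inner_angMom_P]
  have horth' : ∀ s : Config, ⟪D.S n s (k + 1), D.nodeNu n s (k + 1)⟫ = 0 := fun s => by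
    rw [nodeNu_succ hk, real_inner_comm, inner_cross_self_right]
  have hnu : R (D.nodeNu n s (k + 1)) = D.nodeNu n s' (k + 1) := by
    rw [nodeNu_succ hk, nodeNu_succ hk, hR.map_cross, hP, hS]
  have hN : R (D.nodeN n s (k + 1)) = D.nodeN n s' (k + 1) := by
    refine hR.map_eq_of_angleAbout (w := D.S n s (k + 1)) (u := D.nodeNu n s (k + 1)) hS0
      (h (k + 1) (by omega) hkn).1 (horth' s) (horth s) ?_ ?_ ?_
    · rw [hS]
      exact horth s'
    · rcases (Nat.succ_le_of_lt hkn).lt_or_eq with hlt | heq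
      · exact norm_nodeN_eq (by omega) hlt (hT hlt) hc
      · have hkn' : k + 1 = n := heq
        rw [nodeN, nodeN, if_pos hkn', if_pos hkn', (s n).norm_P, (s' n).norm_P]
    · rw [hS, hnu]
      exact hκ
  rcases (Nat.succ_le_of_lt hkn).lt_or_eq with hlt | heq
  · have hlt' : k + 1 < n := hlt
    have e : ∀ s : Config, (D.chi n s k ^ 2) • (s (k + 1)).P =
        D.Theta n s (k + 1) • D.S n s (k + 1) +
          cross (D.nodeN n s (k + 1)) (D.S n s (k + 1)) := by
      intro s
      rw [nodeN_of_lt hlt', cross_cross_left, ← normSq_eq, Theta_of_pos (by omega),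
        ← inner_S_P D s hlt'.le, chi, real_inner_comm (D.S n s (k + 1))]
      abel
    have h1 := congrArg R (e s)
    rw [map_smul, map_add, map_smul, hR.map_cross, hN, hS, hT hlt', ← e s', hc] at h1
    refine smul_right_injective E3 ?_ h1
    rw [← hc]
    exact pow_ne_zero 2 (norm_ne_zero_iff.2 hS0)
  · have hkn' : k + 1 = n := heq
    rw [nodeN, nodeN, if_pos hkn', if_pos hkn'] at hN
    rw [hkn']
    exact hN

/-- The elements of an ellipse are determined by its action, its angular momentum and the
direction of its perihelion. -/
theorem elements_eq {R : E3 →ₗ[ℝ] E3} (hR : IsRot R) {i : ℕ} (hL : D.Lam s i = D.Lam s' i)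
    (hC : R (D.angMom s i) = D.angMom s' i) :
    (s i).a = (s' i).a ∧ (s i).e = (s' i).e ∧ R (s i).N = (s' i).N := by
  have hLp := D.Lam_pos s i
  have h1 : (s i).a = (s' i).a := by
    have h := mul_left_cancel₀ (D.mr_pos i).ne' hL
    rw [Real.sqrt_inj (mul_pos (D.Mr_pos i) (s i).a_pos).le
      (mul_pos (D.Mr_pos i) (s' i).a_pos).le] at h
    exact mul_left_cancel₀ (D.Mr_pos i).ne' h
  have hn : ‖D.angMom s i‖ = ‖D.angMom s' i‖ := by rw [← hC, hR.norm_map]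
  have h2 : (s i).e = (s' i).e := by
    rw [norm_angMom, norm_angMom, ← hL] at hn
    have h := mul_left_cancel₀ hLp.ne' hn
    rw [Real.sqrt_inj (one_sub_e_sq_pos _).le (one_sub_e_sq_pos _).le] at h
    have h' : (s i).e ^ 2 = (s' i).e ^ 2 := by linarith
    exact (sq_eq_sq₀ (s i).e_pos.le (s' i).e_pos.le).1 h'
  refine ⟨h1, h2, ?_⟩
  rw [angMom, angMom, map_smul, ← h2, ← hL] at hC
  have h3 : D.Lam s i * √(1 - (s i).e ^ 2) ≠ 0 := by
    rw [← norm_angMom]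
    exact (D.norm_angMom_pos s i).ne'
  exact smul_right_injective E3 h3 hC

theorem map_ellipse_pos {R : E3 →ₗ[ℝ] E3} (hR : IsRot R) {o o' : Ellipse} (ha : o.a = o'.a)
    (he : o.e = o'.e) (hP : R o.P = o'.P) (hN : R o.N = o'.N) (l : ℝ) :
    R (o.pos l) = o'.pos l := by
  simp only [Ellipse.pos, map_add, map_smul, hR.map_cross, hP, hN, ha, he]

theorem newtonAv_eq_of_isRot {R : E3 →ₗ[ℝ] E3} (hR : IsRot R) {i j : ℕ}
    (hi : ∀ l, R ((s i).pos l) = (s' i).pos l) (hj : ∀ l, R ((s j).pos l) = (s' j).pos l) :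
    D.newtonAv s i j = D.newtonAv s' i j := by
  funext ε
  unfold newtonAv
  simp only [← hi, ← hj, ← map_smul, ← map_sub, hR.norm_map]

theorem newtonAv_eq (h : D.Regular n s) (h' : D.Regular n s') {i j : ℕ} (hi : 1 ≤ i) (hij : i < j)
    (hjn : j ≤ n) (hLi : D.Lam s i = D.Lam s' i) (hLj : D.Lam s j = D.Lam s' j)
    (hT : ∀ k, i ≤ k → k ≤ min j (n - 1) → D.Theta n s k = D.Theta n s' k)
    (hc : ∀ k, i - 1 ≤ k → k ≤ min j (n - 1) → D.chi n s k = D.chi n s' k)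
    (hκ : ∀ k, i ≤ k → k ≤ j - 1 → D.kappa n s k = D.kappa n s' k)
    (hv : ∀ k, i ≤ k → k ≤ min j (n - 1) → D.vartheta n s k = D.vartheta n s' k) :
    D.newtonAv s i j = D.newtonAv s' i j := by
  obtain ⟨R, hR, hP, hS⟩ := exists_isRot_initial h h' hi (by omega) (hT i le_rfl (by omega))
    (hc (i - 1) le_rfl (by omega))
  have key : ∀ k, i ≤ k → k ≤ j → R (s k).P = (s' k).P ∧ R (D.S n s k) = D.S n s' k := by
    intro k hk
    induction k, hk using Nat.le_induction with
    | base => exact fun _ => ⟨hP, hS⟩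
    | succ k hk ih =>
      intro hkj
      obtain ⟨ihP, ihS⟩ := ih (by omega)
      have hS1 := map_S_succ hR h (by omega) (by omega) ihP ihS (hT k hk (by omega))
        (hc k (by omega) (by omega)) (hv k hk (by omega))
      exact ⟨map_P_succ hR h (by omega) (by omega) ihP hS1
        (fun hlt => hT (k + 1) (by omega) (by omega)) (hc k (by omega) (by omega))
        (hκ k hk (by omega)), hS1⟩
  -- `C_j` requires `S_{j+1}`. For `j = n` this vanishes, which is why the indices stop at `min j (n
  -- - 1)`.
  have hSj : R (D.S n s (j + 1)) = D.S n s' (j + 1) := by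
    rcases hjn.lt_or_eq with hlt | rfl
    · obtain ⟨h1, h2⟩ := key j hij.le le_rfl
      exact map_S_succ hR h (by omega) hlt h1 h2 (hT j hij.le (by omega))
        (hc j (by omega) (by omega)) (hv j hij.le (by omega))
    · rw [S_succ_self, S_succ_self, map_zero]
  have hC : ∀ k, k ≤ n → R (D.S n s k) = D.S n s' k → R (D.S n s (k + 1)) = D.S n s' (k + 1) →
      R (D.angMom s k) = D.angMom s' k := by
    intro k hk h1 h2
    rw [S_eq_add D s hk, S_eq_add D s' hk, map_add, h2] at h1
    exact add_right_cancel h1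
  have hSi := (key (i + 1) (by omega) hij).2
  obtain ⟨a1, e1, N1⟩ := elements_eq hR hLi (hC i (by omega) hS hSi)
  obtain ⟨a2, e2, N2⟩ := elements_eq hR hLj (hC j hjn (key j hij.le le_rfl).2 hSj)
  exact newtonAv_eq_of_isRot hR (map_ellipse_pos hR a1 e1 hP N1)
    (map_ellipse_pos hR a2 e2 (key j hij.le le_rfl).1 N2)

theorem fAv_eq_of_newtonAv_eq {i j : ℕ} (h : D.newtonAv s i j = D.newtonAv s' i j) :
    D.fAvOrder 2 s i j = D.fAvOrder 2 s' i j ∧ D.fAv s i j = D.fAv s' i j := by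
  unfold fAvOrder fAv
  rw [h]
  exact ⟨rfl, rfl⟩

end MassData

/-! ### Averages along Kepler ellipses -/

section Averages

open Set Filter Topology MeasureTheory

/-- The point of an ellipse with eccentric anomaly `E`. -/
def Ellipse.orb (o : Ellipse) (E : ℝ) : E3 :=
  (o.a * (Real.cos E - o.e)) • o.P + (o.a * √(1 - o.e ^ 2) * Real.sin E) • cross o.N o.P

theorem Ellipse.pos_eq_orb (o : Ellipse) (l : ℝ) : o.pos l = o.orb (eccentricAnomaly o.e l) := rfl

theorem Ellipse.norm_cross_N_P (o : Ellipse) : ‖cross o.N o.P‖ = 1 := by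
  rw [norm_cross_of_orth (by rw [real_inner_comm, o.orth]), o.norm_N, o.norm_P, one_mul]

theorem Ellipse.inner_P_cross (o : Ellipse) : ⟪o.P, cross o.N o.P⟫ = 0 := by
  rw [real_inner_comm, inner_cross_self_right]

theorem Ellipse.normSq_orb (o : Ellipse) (E : ℝ) :
    ‖o.orb E‖ ^ 2 = (o.a * (1 - o.e * Real.cos E)) ^ 2 := by
  have h1 : ⟪o.P, o.P⟫ = 1 := by rw [← normSq_eq, o.norm_P, one_pow]
  have h2 : ⟪cross o.N o.P, cross o.N o.P⟫ = 1 := by rw [← normSq_eq, o.norm_cross_N_P, one_pow]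
  have h3 := o.inner_P_cross
  have h4 : ⟪cross o.N o.P, o.P⟫ = 0 := by rw [real_inner_comm, h3]
  have h5 := Real.sq_sqrt (MassData.one_sub_e_sq_pos o).le
  have h6 := Real.sin_sq_add_cos_sq E
  rw [normSq_eq, Ellipse.orb]
  simp only [inner_add_left, inner_add_right, real_inner_smul_left, inner_smul_right, h1, h2, h3,
    h4]
  linear_combination o.a ^ 2 * Real.sin E ^ 2 * h5 + o.a ^ 2 * (1 - o.e ^ 2) * h6

theorem Ellipse.one_sub_pos (o : Ellipse) (E : ℝ) : 0 < 1 - o.e * Real.cos E :=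
  kepler_deriv_pos o.e_pos.le o.e_lt_one E

theorem Ellipse.norm_orb (o : Ellipse) (E : ℝ) : ‖o.orb E‖ = o.a * (1 - o.e * Real.cos E) := by
  have := o.a_pos
  have := o.one_sub_pos E
  exact (sq_eq_sq₀ (norm_nonneg _) (by positivity)).1 (o.normSq_orb E)

theorem Ellipse.norm_orb_lt (o : Ellipse) (E : ℝ) : ‖o.orb E‖ < 2 * o.a := by
  have h : 1 - o.e * Real.cos E < 2 := by
    nlinarith [o.e_pos, o.e_lt_one, Real.neg_one_le_cos E]
  rw [o.norm_orb, mul_comm 2]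
  exact mul_lt_mul_of_pos_left h o.a_pos

theorem Ellipse.le_norm_orb (o : Ellipse) (E : ℝ) : o.a * (1 - o.e) ≤ ‖o.orb E‖ := by
  rw [o.norm_orb]
  have := o.a_pos
  have := o.e_pos
  gcongr
  exact mul_le_of_le_one_right o.e_pos.le (Real.cos_le_one E)

theorem Ellipse.continuous_orb (o : Ellipse) : Continuous o.orb := by
  unfold Ellipse.orb
  fun_prop

/-- Kepler's equation as a change of variables; it fixes both endpoints since the sine vanishes
there. -/
theorem integral_eccentricAnomaly {e : ℝ} (h0 : 0 ≤ e) (h1 : e < 1) {g : ℝ → ℝ}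
    (hg : Continuous g) :
    ∫ l in (0 : ℝ)..2 * π, g (eccentricAnomaly e l) =
      ∫ E in (0 : ℝ)..2 * π, g E * (1 - e * Real.cos E) := by
  have hinv : ∀ E, eccentricAnomaly e (E - e * Real.sin E) = E := fun E =>
    (kepler_strictMono h0 h1).injective (eccentricAnomaly_spec e _)
  have h := intervalIntegral.integral_comp_mul_deriv (a := 0) (b := 2 * π)
    (f := fun E => E - e * Real.sin E) (g := fun l => g (eccentricAnomaly e l))
    (fun E _ => kepler_hasDerivAt e E) (by fun_prop)
    (hg.comp (eccentricAnomaly_continuous h0 h1))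
  simp only [Function.comp_def, hinv, Real.sin_zero, mul_zero, sub_zero, Real.sin_two_pi] at h
  exact h.symm

/-- The integral of a function over the square `[0, 2π]²`, depending on a parameter. -/
def squareIntegral (k : ℝ × ℝ × ℝ → ℝ) (ε : ℝ) : ℝ :=
  ∫ E in (0 : ℝ)..2 * π, ∫ E' in (0 : ℝ)..2 * π, k (E', E, ε)

theorem fderiv_intervalIntegral_apply {X : Type*} [NormedAddCommGroup X] [NormedSpace ℝ X]
    {f : ℝ × X → ℝ} {a b : ℝ} (hab : a ≤ b) {x₀ : X}
    (hf : ∀ t ∈ Icc a b, AnalyticAt ℝ f (t, x₀)) (v : X) :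
    fderiv ℝ (fun x => ∫ t in a..b, f (t, x)) x₀ v =
      ∫ t in a..b, fderiv ℝ f (t, x₀) (0, v) := by
  have hcont : ContinuousOn (fun t => (fderiv ℝ f (t, x₀)).comp
      (ContinuousLinearMap.inr ℝ ℝ X)) (uIcc a b) := by
    rw [uIcc_of_le hab]
    refine ContinuousOn.clm_comp (fun t ht => ContinuousAt.continuousWithinAt ?_) continuousOn_const
    exact ContinuousAt.comp (f := fun t : ℝ => (t, x₀)) (g := fderiv ℝ f)
      (hf t ht).fderiv.continuousAt (by fun_prop)
  rw [(hasFDerivAt_intervalIntegral hab hf).fderiv,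
    ContinuousLinearMap.intervalIntegral_apply hcont.intervalIntegrable]
  rfl

theorem analyticAt_squareIntegral {k : ℝ × ℝ × ℝ → ℝ} {ε : ℝ}
    (hk : ∀ E E', AnalyticAt ℝ k (E', E, ε)) : AnalyticAt ℝ (squareIntegral k) ε :=
  analyticAt_intervalIntegral (f := fun y : ℝ × ℝ => ∫ E' in (0 : ℝ)..2 * π, k (E', y.1, y.2))
    (by positivity) fun E _ => analyticAt_intervalIntegral (f := k) (x₀ := (E, ε)) (by positivity)
      fun E' _ => hk E E'

theorem hasDerivAt_squareIntegral {k k' : ℝ × ℝ × ℝ → ℝ} {ε : ℝ}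
    (hk : ∀ E E', AnalyticAt ℝ k (E', E, ε))
    (hd : ∀ E E', HasDerivAt (fun ε => k (E', E, ε)) (k' (E', E, ε)) ε) :
    HasDerivAt (squareIntegral k) (squareIntegral k' ε) ε := by
  have h2pi : (0 : ℝ) ≤ 2 * π := by positivity
  have hG : ∀ E, AnalyticAt ℝ (fun y : ℝ × ℝ => ∫ E' in (0 : ℝ)..2 * π, k (E', y.1, y.2))
      (E, ε) := fun E => analyticAt_intervalIntegral (f := k) (x₀ := (E, ε)) h2pi
        fun E' _ => hk E E'
  have h := (analyticAt_squareIntegral hk).differentiableAt.hasDerivAt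
  have e : deriv (squareIntegral k) ε = squareIntegral k' ε := by
    rw [← fderiv_apply_one_eq_deriv]
    have h1 : fderiv ℝ (squareIntegral k) ε 1 = _ := fderiv_intervalIntegral_apply
      (f := fun y : ℝ × ℝ =>
      ∫ E' in (0 : ℝ)..2 * π, k (E', y.1, y.2)) (a := 0) (b := 2 * π) h2pi (fun E _ => hG E) 1
    rw [h1, squareIntegral]
    refine intervalIntegral.integral_congr fun E _ => ?_
    have h2 := fderiv_intervalIntegral_apply (f := k) (x₀ := (E, ε)) (a := 0) (b := 2 * π) h2pi
      (fun E' _ => hk E E') (0, 1)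
    refine h2.trans (intervalIntegral.integral_congr fun E' _ => ?_)
    have h3 : HasDerivAt (fun ε : ℝ => (E', E, ε)) ((0 : ℝ), (0 : ℝ), (1 : ℝ)) ε :=
      (hasDerivAt_const _ _).prodMk ((hasDerivAt_const _ _).prodMk (hasDerivAt_id ε))
    have h4 := (hk E E').differentiableAt.hasFDerivAt.comp_hasDerivAt
      (f := fun ε : ℝ => (E', E, ε)) ε h3
    exact h4.unique (hd E E')
  rwa [e] at h

/-- The square of the distance between the dilated point of an ellipse and the point of another,
as a function of the eccentric anomalies and the dilation factor. -/
def distSq (o o' : Ellipse) (y : ℝ × ℝ × ℝ) : ℝ :=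
  y.2.2 ^ 2 * (o.a * (1 - o.e * Real.cos y.2.1)) ^ 2 -
    2 * y.2.2 * ⟪o.orb y.2.1, o'.orb y.1⟫ + (o'.a * (1 - o'.e * Real.cos y.1)) ^ 2

theorem inner_orb (o o' : Ellipse) (E E' : ℝ) : ⟪o.orb E, o'.orb E'⟫ =
    (o.a * (Real.cos E - o.e)) * (o'.a * (Real.cos E' - o'.e)) * ⟪o.P, o'.P⟫ +
    (o.a * (Real.cos E - o.e)) * (o'.a * √(1 - o'.e ^ 2) * Real.sin E') *
      ⟪o.P, cross o'.N o'.P⟫ +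
    (o.a * √(1 - o.e ^ 2) * Real.sin E) * (o'.a * (Real.cos E' - o'.e)) *
      ⟪cross o.N o.P, o'.P⟫ +
    (o.a * √(1 - o.e ^ 2) * Real.sin E) * (o'.a * √(1 - o'.e ^ 2) * Real.sin E') *
      ⟪cross o.N o.P, cross o'.N o'.P⟫ := by
  unfold Ellipse.orb
  simp only [inner_add_left, inner_add_right, real_inner_smul_left, inner_smul_right]
  ring

theorem distSq_eq (o o' : Ellipse) (E E' ε : ℝ) :
    distSq o o' (E', E, ε) = ‖ε • o.orb E - o'.orb E'‖ ^ 2 := by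
  rw [norm_sub_sq_real, norm_smul, mul_pow, o.normSq_orb, o'.normSq_orb, real_inner_smul_left,
    Real.norm_eq_abs, sq_abs, distSq]
  ring

theorem analyticAt_inner_orb (o o' : Ellipse) (y : ℝ × ℝ × ℝ) :
    AnalyticAt ℝ (fun y : ℝ × ℝ × ℝ => ⟪o.orb y.2.1, o'.orb y.1⟫) y := by
  simp only [inner_orb]
  fun_prop

theorem analyticAt_distSq (o o' : Ellipse) (y : ℝ × ℝ × ℝ) : AnalyticAt ℝ (distSq o o') y := by
  have := analyticAt_inner_orb o o' y
  unfold distSq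
  fun_prop

/-- The hypothesis keeps the dilated inner orbit closer to the focus than the perihelion of the
outer one, so collisions are excluded. -/
theorem smul_orb_ne (o o' : Ellipse) {ε : ℝ} (hε : |ε| * (2 * o.a) < o'.a * (1 - o'.e))
    (E E' : ℝ) : ε • o.orb E - o'.orb E' ≠ 0 := by
  intro h
  have h1 : ‖ε • o.orb E‖ = ‖o'.orb E'‖ := by rw [sub_eq_zero.1 h]
  rw [norm_smul, Real.norm_eq_abs] at h1
  have h2 := o'.le_norm_orb E'
  have h3 : |ε| * ‖o.orb E‖ ≤ |ε| * (2 * o.a) := by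
    gcongr
    exact (o.norm_orb_lt E).le
  linarith

theorem distSq_pos (o o' : Ellipse) {ε : ℝ} (hε : |ε| * (2 * o.a) < o'.a * (1 - o'.e))
    (E E' : ℝ) : 0 < distSq o o' (E', E, ε) := by
  rw [distSq_eq]
  have := norm_pos_iff.2 (smul_orb_ne o o' hε E E')
  positivity

/-- The Jacobian of the passage from the mean to the eccentric anomalies. -/
def weight (o o' : Ellipse) (y : ℝ × ℝ × ℝ) : ℝ :=
  (1 - o.e * Real.cos y.2.1) * (1 - o'.e * Real.cos y.1)

/-- The Newtonian kernel, weighted by the Jacobian. -/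
def kernel (o o' : Ellipse) (y : ℝ × ℝ × ℝ) : ℝ := weight o o' y / √(distSq o o' y)

/-- The derivative of the weighted Newtonian kernel with respect to the dilation factor. -/
def kernelDeriv (o o' : Ellipse) (y : ℝ × ℝ × ℝ) : ℝ :=
  weight o o' y * ((⟪o.orb y.2.1, o'.orb y.1⟫ - y.2.2 * (o.a * (1 - o.e * Real.cos y.2.1)) ^ 2) /
    √(distSq o o' y) ^ 3)

/-- The second derivative of the weighted Newtonian kernel with respect to the dilation factor. -/
def kernelDeriv₂ (o o' : Ellipse) (y : ℝ × ℝ × ℝ) : ℝ :=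
  weight o o' y * ((3 * (⟪o.orb y.2.1, o'.orb y.1⟫ -
      y.2.2 * (o.a * (1 - o.e * Real.cos y.2.1)) ^ 2) ^ 2 -
    (o.a * (1 - o.e * Real.cos y.2.1)) ^ 2 * distSq o o' y) / √(distSq o o' y) ^ 5)

theorem integral_mean_anomalies (o o' : Ellipse) {ε : ℝ}
    (hε : |ε| * (2 * o.a) < o'.a * (1 - o'.e)) :
    ∫ li in (0 : ℝ)..2 * π, ∫ lj in (0 : ℝ)..2 * π, 1 / ‖ε • o.pos li - o'.pos lj‖ =
      squareIntegral (kernel o o') ε := by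
  have hc : Continuous fun y : ℝ × ℝ => 1 / ‖ε • o.orb y.1 - o'.orb y.2‖ := by
    have := o.continuous_orb
    have := o'.continuous_orb
    refine Continuous.div continuous_const (by fun_prop) fun y => ?_
    exact norm_ne_zero_iff.2 (smul_orb_ne o o' hε _ _)
  simp only [Ellipse.pos_eq_orb]
  have h1 : ∀ x, ∫ lj in (0 : ℝ)..2 * π,
      1 / ‖ε • o.orb x - o'.orb (eccentricAnomaly o'.e lj)‖ =
      ∫ E' in (0 : ℝ)..2 * π, 1 / ‖ε • o.orb x - o'.orb E'‖ * (1 - o'.e * Real.cos E') := by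
    intro x
    have hcx : Continuous fun E' : ℝ => 1 / ‖ε • o.orb x - o'.orb E'‖ := by
      have := o'.continuous_orb
      refine Continuous.div continuous_const (by fun_prop) fun E' => ?_
      exact norm_ne_zero_iff.2 (smul_orb_ne o o' hε _ _)
    exact integral_eccentricAnomaly o'.e_pos.le o'.e_lt_one hcx
  simp only [h1]
  have hc2 : Continuous fun x => ∫ E' in (0 : ℝ)..2 * π,
      1 / ‖ε • o.orb x - o'.orb E'‖ * (1 - o'.e * Real.cos E') := by
    have hcw : Continuous fun y : ℝ × ℝ => 1 - o'.e * Real.cos y.2 := by fun_prop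
    exact intervalIntegral.continuous_parametric_intervalIntegral_of_continuous'
      (f := fun x E' => 1 / ‖ε • o.orb x - o'.orb E'‖ * (1 - o'.e * Real.cos E'))
      (hc.mul hcw) _ _
  rw [integral_eccentricAnomaly o.e_pos.le o.e_lt_one hc2, squareIntegral]
  refine intervalIntegral.integral_congr fun E _ => ?_
  rw [← intervalIntegral.integral_mul_const]
  refine intervalIntegral.integral_congr fun E' _ => ?_
  simp only [kernel, weight, distSq_eq, Real.sqrt_sq (norm_nonneg _)]
  ring

theorem analyticAt_weight (o o' : Ellipse) (y : ℝ × ℝ × ℝ) : AnalyticAt ℝ (weight o o') y := by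
  unfold weight
  fun_prop

theorem analyticAt_kernel (o o' : Ellipse) {y : ℝ × ℝ × ℝ} (hy : 0 < distSq o o' y) :
    AnalyticAt ℝ (kernel o o') y := by
  have h := analyticAt_sqrt_comp (analyticAt_distSq o o' y) hy.ne'
  exact (analyticAt_weight o o' y).fun_div h (Real.sqrt_pos.2 hy).ne'

theorem analyticAt_kernelDeriv (o o' : Ellipse) {y : ℝ × ℝ × ℝ} (hy : 0 < distSq o o' y) :
    AnalyticAt ℝ (kernelDeriv o o') y := by
  have h := analyticAt_sqrt_comp (analyticAt_distSq o o' y) hy.ne'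
  have h2 := analyticAt_inner_orb o o' y
  have h3 : AnalyticAt ℝ (fun y : ℝ × ℝ × ℝ => ⟪o.orb y.2.1, o'.orb y.1⟫ -
      y.2.2 * (o.a * (1 - o.e * Real.cos y.2.1)) ^ 2) y := h2.fun_sub (by fun_prop)
  exact (analyticAt_weight o o' y).fun_mul (h3.fun_div (h.fun_pow 3)
    (pow_pos (Real.sqrt_pos.2 hy) 3).ne')

theorem hasDerivAt_distSq (o o' : Ellipse) (E E' ε : ℝ) :
    HasDerivAt (fun ε => distSq o o' (E', E, ε))
      (2 * (ε * (o.a * (1 - o.e * Real.cos E)) ^ 2 - ⟪o.orb E, o'.orb E'⟫)) ε := by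
  have h1 := ((hasDerivAt_id ε).pow 2).mul_const ((o.a * (1 - o.e * Real.cos E)) ^ 2)
  have h2 := ((hasDerivAt_id ε).const_mul 2).mul_const ⟪o.orb E, o'.orb E'⟫
  refine ((h1.sub h2).add_const ((o'.a * (1 - o'.e * Real.cos E')) ^ 2)).congr_deriv ?_
  simp
  ring

theorem hasDerivAt_kernel (o o' : Ellipse) {E E' ε : ℝ} (h : 0 < distSq o o' (E', E, ε)) :
    HasDerivAt (fun ε => kernel o o' (E', E, ε)) (kernelDeriv o o' (E', E, ε)) ε := by
  have hs := Real.sqrt_pos.2 h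
  have h1 := ((hasDerivAt_distSq o o' E E' ε).sqrt h.ne').inv hs.ne'
  have h2 := h1.const_mul (weight o o' (E', E, ε))
  refine (h2.congr_deriv ?_)
  simp only [kernelDeriv]
  field_simp
  ring

theorem hasDerivAt_kernelDeriv (o o' : Ellipse) {E E' ε : ℝ} (h : 0 < distSq o o' (E', E, ε)) :
    HasDerivAt (fun ε => kernelDeriv o o' (E', E, ε)) (kernelDeriv₂ o o' (E', E, ε)) ε := by
  have hs := Real.sqrt_pos.2 h
  have h1 := ((hasDerivAt_distSq o o' E E' ε).sqrt h.ne').pow 3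
  have h2 : HasDerivAt (fun ε : ℝ => ⟪o.orb E, o'.orb E'⟫ -
      ε * (o.a * (1 - o.e * Real.cos E)) ^ 2) (-(1 * (o.a * (1 - o.e * Real.cos E)) ^ 2)) ε :=
    ((hasDerivAt_id ε).mul_const _).const_sub _
  have h3 := (h2.div h1 (pow_pos hs 3).ne').const_mul (weight o o' (E', E, ε))
  refine (h3.congr_deriv ?_)
  simp only [kernelDeriv₂]
  have hq := Real.sq_sqrt h.le
  set r := √(distSq o o' (E', E, ε))
  rw [← hq]
  simp only [Pi.pow_apply]
  field_simp
  ring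

end Averages

/-! ### The averaged interaction near dilation factor zero -/

namespace MassData

open Set Filter Topology

variable (D : MassData)

theorem eventually_small (o o' : Ellipse) :
    ∀ᶠ ε : ℝ in 𝓝 0, |ε| * (2 * o.a) < o'.a * (1 - o'.e) := by
  have hc : ContinuousAt (fun ε : ℝ => |ε| * (2 * o.a)) 0 := by fun_prop
  refine hc.eventually (gt_mem_nhds ?_)
  have := o'.a_pos
  have := o'.e_lt_one
  simp only [abs_zero, zero_mul]
  exact mul_pos o'.a_pos (by linarith)

theorem newtonAv_eventuallyEq (s : Config) (i j : ℕ) :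
    D.newtonAv s i j =ᶠ[𝓝 0] fun ε => -(D.m i * D.m j) / (2 * π) ^ 2 *
      squareIntegral (kernel (s i) (s j)) ε := by
  filter_upwards [eventually_small (s i) (s j)] with ε hε
  rw [newtonAv, integral_mean_anomalies (s i) (s j) hε]

theorem analyticAt_newtonAv (s : Config) (i j : ℕ) : AnalyticAt ℝ (D.newtonAv s i j) 0 := by
  refine AnalyticAt.congr ?_ (newtonAv_eventuallyEq D s i j).symm
  have h0 := (eventually_small (s i) (s j)).self_of_nhds
  exact analyticAt_const.mul (analyticAt_squareIntegral fun E E' =>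
    analyticAt_kernel _ _ (distSq_pos _ _ h0 E E'))

/-- The first derivative is computed on a whole neighbourhood of zero, so that it can be
differentiated once more under the integral at zero. -/
theorem fAvOrder_two (s : Config) (i j : ℕ) :
    D.fAvOrder 2 s i j = 1 / 2 * (-(D.m i * D.m j) / (2 * π) ^ 2 *
      squareIntegral (kernelDeriv₂ (s i) (s j)) 0) := by
  have h0 := (eventually_small (s i) (s j)).self_of_nhds
  have e1 : deriv (fun ε => -(D.m i * D.m j) / (2 * π) ^ 2 *
      squareIntegral (kernel (s i) (s j)) ε) =ᶠ[𝓝 0] fun ε => -(D.m i * D.m j) / (2 * π) ^ 2 *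
      squareIntegral (kernelDeriv (s i) (s j)) ε := by
    filter_upwards [eventually_small (s i) (s j)] with ε hε
    exact ((hasDerivAt_squareIntegral
      (fun E E' => analyticAt_kernel _ _ (distSq_pos _ _ hε E E'))
      (fun E E' => hasDerivAt_kernel _ _ (distSq_pos _ _ hε E E'))).const_mul _).deriv
  have e2 := ((hasDerivAt_squareIntegral
      (fun E E' => analyticAt_kernelDeriv (s i) (s j) (distSq_pos _ _ h0 E E'))
      (fun E E' => hasDerivAt_kernelDeriv _ _ (distSq_pos _ _ h0 E E'))).const_mul
        (-(D.m i * D.m j) / (2 * π) ^ 2)).deriv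
  rw [fAvOrder, iteratedDeriv_succ, iteratedDeriv_one,
    (((newtonAv_eventuallyEq D s i j).deriv).trans e1).deriv_eq, e2]
  simp

end MassData

/-! ### Closed forms of integrals over a Kepler period -/

section KeplerIntegrals

open Set MeasureTheory

/-- The integrand is the derivative of the true anomaly, which grows by `2π` over a period. Writing
it as `E + 2 arctan(β sin E / (1 - β cos E))` gives a primitive without jumps, unlike the half-angle
tangent. -/
theorem integral_inv_one_sub_mul_cos {e : ℝ} (h0 : 0 < e) (h1 : e < 1) :
    ∫ E in (0 : ℝ)..2 * π, √(1 - e ^ 2) / (1 - e * Real.cos E) = 2 * π := by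
  set η := √(1 - e ^ 2) with hη
  have hpos : 0 < 1 - e ^ 2 := by nlinarith
  have hη0 : 0 < η := Real.sqrt_pos.2 hpos
  have hη2 : η ^ 2 = 1 - e ^ 2 := Real.sq_sqrt hpos.le
  set β := e / (1 + η) with hβ
  have hβ1 : β * (1 + η) = e := by rw [hβ]; field_simp
  have hβlt : β < 1 := by
    rw [hβ, div_lt_one (by positivity)]
    linarith
  have hβ0 : 0 < β := by positivity
  have hβ2 : β ^ 2 * (1 + η) = 1 - η := by
    have : β ^ 2 * (1 + η) * (1 + η) = (1 - η) * (1 + η) := by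
      linear_combination (β * (1 + η) + e) * hβ1 + hη2
    exact mul_right_cancel₀ (by positivity) this
  have hd : ∀ E, HasDerivAt
      (fun E => E + 2 * Real.arctan (β * Real.sin E / (1 - β * Real.cos E)))
      (η / (1 - e * Real.cos E)) E := by
    intro E
    have hq : 0 < 1 - β * Real.cos E := kepler_deriv_pos hβ0.le hβlt E
    have hk : 0 < 1 - e * Real.cos E := kepler_deriv_pos h0.le h1 E
    have d1 := ((Real.hasDerivAt_sin E).const_mul β).div
      (((Real.hasDerivAt_cos E).const_mul β).const_sub 1) hq.ne'
    refine ((hasDerivAt_id E).add ((d1.arctan).const_mul 2)).congr_deriv ?_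
    have hcs := Real.sin_sq_add_cos_sq E
    simp only [Pi.div_apply]
    set c := Real.cos E
    set s := Real.sin E
    have hden : 0 < (1 - β * c) ^ 2 + (β * s) ^ 2 := by positivity
    have e1 : 1 + 2 * (1 / (1 + (β * s / (1 - β * c)) ^ 2) *
        ((β * c * (1 - β * c) - β * s * -(β * -s)) / (1 - β * c) ^ 2)) =
        1 + 2 * ((β * c * (1 - β * c) - β * s * -(β * -s)) /
          ((1 - β * c) ^ 2 + (β * s) ^ 2)) := by
      field_simp
    rw [e1, eq_div_iff hk.ne']
    field_simp
    have hden2 : (1 - β * c) ^ 2 + (β * s) ^ 2 = 1 - 2 * β * c + β ^ 2 := by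
      linear_combination β ^ 2 * hcs
    have hnum : (1 - β * c) ^ 2 + (β * s) ^ 2 + 2 * β * (c * (1 - β * c) - β * s ^ 2) =
        1 - β ^ 2 := by
      linear_combination (- β ^ 2) * hcs
    have h4 : 1 - β ^ 2 = η * (1 + β ^ 2) := by linear_combination -hβ2
    have h5 : e * (1 + β ^ 2) = 2 * β := by
      linear_combination (-(1 + β ^ 2)) * hβ1 + β * hβ2
    linear_combination (1 - c * e) * hnum - η * hden2 + (1 - c * e) * h4 - c * η * h5
  have hc : Continuous fun E => η / (1 - e * Real.cos E) :=
    continuous_const.div (by fun_prop) fun E => (kepler_deriv_pos h0.le h1 E).ne'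
  rw [intervalIntegral.integral_eq_sub_of_hasDerivAt (fun E _ => hd E)
    (hc.intervalIntegrable _ _)]
  simp

/-- If `G'` is the derivative of a function with equal values at `0` and `2π`, its integral over a
period vanishes. -/
theorem integral_eq_zero_of_hasDerivAt {G G' : ℝ → ℝ} (hG : ∀ E, HasDerivAt G (G' E) E)
    (hc : Continuous G') (h : G (2 * π) = G 0) : ∫ E in (0 : ℝ)..2 * π, G' E = 0 := by
  rw [intervalIntegral.integral_eq_sub_of_hasDerivAt (fun E _ => hG E)
    (hc.intervalIntegrable _ _), h, sub_self]

/-- The quotient is the cosine of the true anomaly; the one in `hasDerivAt_sin_trueAnomaly` is its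
sine divided by `√(1 - e ^ 2)`. -/
theorem hasDerivAt_cos_trueAnomaly {e : ℝ} (h0 : 0 < e) (h1 : e < 1) (E : ℝ) :
    HasDerivAt (fun E => (Real.cos E - e) / (1 - e * Real.cos E))
      (-((1 - e ^ 2) * Real.sin E) / (1 - e * Real.cos E) ^ 2) E := by
  have hk : 0 < 1 - e * Real.cos E := kepler_deriv_pos h0.le h1 E
  refine (((Real.hasDerivAt_cos E).sub_const e).div
    (((Real.hasDerivAt_cos E).const_mul e).const_sub 1) hk.ne').congr_deriv ?_
  field_simp
  ring

theorem hasDerivAt_sin_trueAnomaly {e : ℝ} (h0 : 0 < e) (h1 : e < 1) (E : ℝ) :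
    HasDerivAt (fun E => Real.sin E / (1 - e * Real.cos E))
      ((Real.cos E - e) / (1 - e * Real.cos E) ^ 2) E := by
  have hk : 0 < 1 - e * Real.cos E := kepler_deriv_pos h0.le h1 E
  refine ((Real.hasDerivAt_sin E).div
    (((Real.hasDerivAt_cos E).const_mul e).const_sub 1) hk.ne').congr_deriv ?_
  congr 1
  linear_combination (-e) * Real.sin_sq_add_cos_sq E

theorem continuous_div_kepler {e : ℝ} (h0 : 0 < e) (h1 : e < 1) {f : ℝ → ℝ} (hf : Continuous f)
    (k : ℕ) : Continuous fun E => f E / (1 - e * Real.cos E) ^ k :=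
  hf.div (by fun_prop) fun E => (pow_pos (kepler_deriv_pos h0.le h1 E) k).ne'

theorem hasDerivAt_cos_mul_sin_trueAnomaly {e : ℝ} (h0 : 0 < e) (h1 : e < 1) (E : ℝ) :
    HasDerivAt (fun E => (Real.cos E - e) / (1 - e * Real.cos E) *
      (Real.sin E / (1 - e * Real.cos E)))
      (((Real.cos E - e) ^ 2 - (1 - e ^ 2) * Real.sin E ^ 2) / (1 - e * Real.cos E) ^ 3) E := by
  have hk := (kepler_deriv_pos h0.le h1 E).ne'
  refine ((hasDerivAt_cos_trueAnomaly h0 h1 E).mul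
    (hasDerivAt_sin_trueAnomaly h0 h1 E)).congr_deriv ?_
  field_simp
  ring

theorem hasDerivAt_sin_cube_trueAnomaly {e : ℝ} (h0 : 0 < e) (h1 : e < 1) (E : ℝ) :
    HasDerivAt (fun E => (Real.sin E / (1 - e * Real.cos E)) ^ 3)
      (3 * Real.sin E ^ 2 * (Real.cos E - e) / (1 - e * Real.cos E) ^ 4) E := by
  have hk := (kepler_deriv_pos h0.le h1 E).ne'
  refine ((hasDerivAt_sin_trueAnomaly h0 h1 E).pow 3).congr_deriv ?_
  norm_num
  field_simp

/-- A multiple of the derivative of the true anomaly is split off, so that the remainder has a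
periodic primitive `G`. -/
theorem integral_of_hasDerivAt_sub {G f : ℝ → ℝ} {e c : ℝ} (h0 : 0 < e) (h1 : e < 1)
    (hf : Continuous f)
    (hG : ∀ E, HasDerivAt G (f E - c * (√(1 - e ^ 2) / (1 - e * Real.cos E))) E)
    (h : G (2 * π) = G 0) : ∫ E in (0 : ℝ)..2 * π, f E = c * (2 * π) := by
  have hc : Continuous fun E => √(1 - e ^ 2) / (1 - e * Real.cos E) := by
    simpa using continuous_div_kepler h0 h1 (continuous_const (y := √(1 - e ^ 2))) 1
  have hz := integral_eq_zero_of_hasDerivAt hG (hf.sub (hc.const_mul c)) h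
  rw [intervalIntegral.integral_sub (hf.intervalIntegrable _ _)
    ((hc.const_mul c).intervalIntegrable _ _), intervalIntegral.integral_const_mul,
    integral_inv_one_sub_mul_cos h0 h1] at hz
  linarith

theorem integral_cos_sq_div {e : ℝ} (h0 : 0 < e) (h1 : e < 1) :
    ∫ E in (0 : ℝ)..2 * π, (Real.cos E - e) ^ 2 / (1 - e * Real.cos E) ^ 4 =
      π / √(1 - e ^ 2) ^ 3 := by
  have hpos : 0 < 1 - e ^ 2 := by nlinarith
  have hη0 : 0 < √(1 - e ^ 2) := Real.sqrt_pos.2 hpos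
  have hη2 : √(1 - e ^ 2) ^ 2 = 1 - e ^ 2 := Real.sq_sqrt hpos.le
  -- In the true anomaly `f` the integral is that of `cos² f (1 + e cos f) / √(1 - e²)³`. `G` is the
  -- periodic part of the primitive and `c` the mean.
  rw [integral_of_hasDerivAt_sub (G := fun E => (1 - e ^ 2)⁻¹ * (1 / 2 *
      ((Real.cos E - e) / (1 - e * Real.cos E) * (Real.sin E / (1 - e * Real.cos E))) +
      e * (Real.sin E / (1 - e * Real.cos E)) -
      e * (1 - e ^ 2) / 3 * (Real.sin E / (1 - e * Real.cos E)) ^ 3))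
    (c := 1 / 2 / √(1 - e ^ 2) ^ 3) h0 h1 (continuous_div_kepler h0 h1 (by fun_prop) 4)
    (fun E => ?_) (by simp)]
  · field_simp
  · have hk := (kepler_deriv_pos h0.le h1 E).ne'
    refine (((((hasDerivAt_cos_mul_sin_trueAnomaly h0 h1 E).const_mul (1 / 2)).add
      ((hasDerivAt_sin_trueAnomaly h0 h1 E).const_mul e)).sub
      ((hasDerivAt_sin_cube_trueAnomaly h0 h1 E).const_mul (e * (1 - e ^ 2) / 3))).const_mul
        (1 - e ^ 2)⁻¹).congr_deriv ?_
    have e1 : 1 / 2 / √(1 - e ^ 2) ^ 3 * (√(1 - e ^ 2) / (1 - e * Real.cos E)) =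
        1 / (2 * (1 - e ^ 2) * (1 - e * Real.cos E)) := by
      conv_rhs => rw [← hη2]
      field_simp
    rw [e1, Real.sin_sq]
    field_simp
    ring

theorem integral_sin_sq_div {e : ℝ} (h0 : 0 < e) (h1 : e < 1) :
    ∫ E in (0 : ℝ)..2 * π, Real.sin E ^ 2 / (1 - e * Real.cos E) ^ 4 =
      π / √(1 - e ^ 2) ^ 5 := by
  have hpos : 0 < 1 - e ^ 2 := by nlinarith
  have hη0 : 0 < √(1 - e ^ 2) := Real.sqrt_pos.2 hpos
  have hη2 : √(1 - e ^ 2) ^ 2 = 1 - e ^ 2 := Real.sq_sqrt hpos.le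
  -- As in `integral_cos_sq_div`, now with the integrand `sin² f (1 + e cos f) / √(1 - e²)⁵`.
  rw [integral_of_hasDerivAt_sub (G := fun E => -((1 - e ^ 2)⁻¹ ^ 2 / 2) *
      ((Real.cos E - e) / (1 - e * Real.cos E) * (Real.sin E / (1 - e * Real.cos E))) +
      e * (1 - e ^ 2)⁻¹ / 3 * (Real.sin E / (1 - e * Real.cos E)) ^ 3)
    (c := 1 / 2 / √(1 - e ^ 2) ^ 5) h0 h1 (continuous_div_kepler h0 h1 (by fun_prop) 4)
    (fun E => ?_) (by simp)]
  · field_simp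
  · have hk := (kepler_deriv_pos h0.le h1 E).ne'
    refine (((hasDerivAt_cos_mul_sin_trueAnomaly h0 h1 E).const_mul _).add
      ((hasDerivAt_sin_cube_trueAnomaly h0 h1 E).const_mul _)).congr_deriv ?_
    have e1 : 1 / 2 / √(1 - e ^ 2) ^ 5 * (√(1 - e ^ 2) / (1 - e * Real.cos E)) =
        1 / (2 * (1 - e ^ 2) ^ 2 * (1 - e * Real.cos E)) := by
      conv_rhs => rw [← hη2]
      field_simp
    rw [e1, Real.sin_sq]
    field_simp
    ring

theorem integral_sin_mul_cos_div {e : ℝ} (h0 : 0 < e) (h1 : e < 1) :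
    ∫ E in (0 : ℝ)..2 * π, Real.sin E * (Real.cos E - e) / (1 - e * Real.cos E) ^ 4 = 0 := by
  have hpos : 0 < 1 - e ^ 2 := by nlinarith
  have hd : ∀ E, HasDerivAt (fun E => -((1 - e ^ 2)⁻¹ ^ 2) *
      (((Real.cos E - e) / (1 - e * Real.cos E)) ^ 2 / 2 +
        e * ((Real.cos E - e) / (1 - e * Real.cos E)) ^ 3 / 3))
      (Real.sin E * (Real.cos E - e) / (1 - e * Real.cos E) ^ 4) E := by
    intro E
    have hk := (kepler_deriv_pos h0.le h1 E).ne'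
    have d := hasDerivAt_cos_trueAnomaly h0 h1 E
    refine ((((d.pow 2).div_const 2).add (((d.pow 3).const_mul e).div_const 3)).const_mul
      (-((1 - e ^ 2)⁻¹ ^ 2))).congr_deriv ?_
    norm_num
    field_simp
    ring
  exact integral_eq_zero_of_hasDerivAt hd (continuous_div_kepler h0 h1 (by fun_prop) 4) (by simp)

theorem integral_of_hasDerivAt_sub_const {G f : ℝ → ℝ} {c : ℝ} (hf : Continuous f)
    (hG : ∀ E, HasDerivAt G (f E - c) E) (h : G (2 * π) = G 0) :
    ∫ E in (0 : ℝ)..2 * π, f E = c * (2 * π) := by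
  have hz := integral_eq_zero_of_hasDerivAt hG (hf.sub continuous_const) h
  rw [intervalIntegral.integral_sub (hf.intervalIntegrable _ _) intervalIntegrable_const,
    intervalIntegral.integral_const, smul_eq_mul] at hz
  linarith

theorem integral_kepler_cos_sq (e : ℝ) :
    ∫ E in (0 : ℝ)..2 * π, (1 - e * Real.cos E) * (Real.cos E - e) ^ 2 = π * (1 + 4 * e ^ 2) := by
  rw [integral_of_hasDerivAt_sub_const (c := (1 + 4 * e ^ 2) / 2) (G := fun E =>
    (1 + 2 * e ^ 2) / 2 * (Real.sin E * Real.cos E) - (3 * e + e ^ 3) * Real.sin E +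
      e / 3 * Real.sin E ^ 3) (by fun_prop) (fun E => ?_) (by simp)]
  · ring
  · have hs := Real.hasDerivAt_sin E
    refine ((((hs.mul (Real.hasDerivAt_cos E)).const_mul _).sub (hs.const_mul _)).add
      ((hs.pow 3).const_mul _)).congr_deriv ?_
    norm_num
    linear_combination (-(1 + 2 * e ^ 2) / 2 + e * Real.cos E) * Real.sin_sq_add_cos_sq E

theorem integral_kepler_sin_sq (e : ℝ) :
    ∫ E in (0 : ℝ)..2 * π, (1 - e * Real.cos E) * Real.sin E ^ 2 = π := by
  rw [integral_of_hasDerivAt_sub_const (c := 1 / 2) (G := fun E =>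
    -(1 / 2) * (Real.sin E * Real.cos E) - e / 3 * Real.sin E ^ 3) (by fun_prop)
    (fun E => ?_) (by simp)]
  · ring
  · have hs := Real.hasDerivAt_sin E
    refine (((hs.mul (Real.hasDerivAt_cos E)).const_mul _).sub
      ((hs.pow 3).const_mul _)).congr_deriv ?_
    norm_num
    linear_combination (-1 / 2) * Real.sin_sq_add_cos_sq E

theorem integral_kepler_sin_mul_cos (e : ℝ) :
    ∫ E in (0 : ℝ)..2 * π, (1 - e * Real.cos E) * (Real.sin E * (Real.cos E - e)) = 0 := by
  refine integral_eq_zero_of_hasDerivAt (G := fun E => -((1 + e ^ 2) / 2) * Real.cos E ^ 2 +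
    e * Real.cos E + e / 3 * Real.cos E ^ 3) (fun E => ?_) (by fun_prop) (by simp)
  have hs := Real.hasDerivAt_cos E
  refine ((((hs.pow 2).const_mul _).add (hs.const_mul _)).add
    ((hs.pow 3).const_mul _)).congr_deriv ?_
  norm_num
  ring

end KeplerIntegrals

theorem integral_linear_combination {f g h : ℝ → ℝ} (hf : Continuous f) (hg : Continuous g)
    (hh : Continuous h) (p q r a b : ℝ) :
    ∫ x in a..b, (p * f x + q * g x + r * h x) =
      p * (∫ x in a..b, f x) + q * (∫ x in a..b, g x) + r * ∫ x in a..b, h x := by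
  have h1 : Continuous fun x => p * f x + q * g x := by fun_prop
  rw [intervalIntegral.integral_add (h1.intervalIntegrable _ _)
      ((hh.const_mul r).intervalIntegrable _ _),
    intervalIntegral.integral_add ((hf.const_mul p).intervalIntegrable _ _)
      ((hg.const_mul q).intervalIntegrable _ _)]
  simp only [intervalIntegral.integral_const_mul]

theorem normSq_eq_frame (o : Ellipse) (x : E3) :
    ‖x‖ ^ 2 = ⟪x, o.P⟫ ^ 2 + ⟪x, cross o.N o.P⟫ ^ 2 + ⟪x, o.N⟫ ^ 2 := by
  have h := frame_expand o.norm_N o.norm_P (by rw [real_inner_comm, o.orth]) x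
  have h2 : ‖x‖ ^ 2 =
      ⟪x, ⟪o.N, x⟫ • o.N + ⟪o.P, x⟫ • o.P + ⟪cross o.N o.P, x⟫ • cross o.N o.P⟫ := by
    rw [← h, normSq_eq]
  rw [h2]
  simp only [inner_add_right, inner_smul_right, real_inner_comm x]
  ring

theorem Ellipse.inner_orb_right (o' : Ellipse) (x : E3) (E' : ℝ) :
    ⟪x, o'.orb E'⟫ = o'.a * (Real.cos E' - o'.e) * ⟪x, o'.P⟫ +
      o'.a * √(1 - o'.e ^ 2) * Real.sin E' * ⟪x, cross o'.N o'.P⟫ := by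
  unfold Ellipse.orb
  rw [inner_add_right, inner_smul_right, inner_smul_right]

theorem Ellipse.inner_orb_left (o : Ellipse) (x : E3) (E : ℝ) :
    ⟪o.orb E, x⟫ = o.a * (Real.cos E - o.e) * ⟪o.P, x⟫ +
      o.a * √(1 - o.e ^ 2) * Real.sin E * ⟪cross o.N o.P, x⟫ := by
  rw [real_inner_comm, o.inner_orb_right, real_inner_comm o.P, real_inner_comm (cross o.N o.P)]

theorem Ellipse.one_sub_sq (o : Ellipse) (E : ℝ) : (1 - o.e * Real.cos E) ^ 2 =
    (Real.cos E - o.e) ^ 2 + √(1 - o.e ^ 2) ^ 2 * Real.sin E ^ 2 := by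
  have h5 := Real.sq_sqrt (MassData.one_sub_e_sq_pos o).le
  have h6 := Real.sin_sq_add_cos_sq E
  linear_combination - Real.sin E ^ 2 * h5 - (1 - o.e ^ 2) * h6

/-- The average of the quadrupole term over the outer ellipse. -/
theorem integral_kernelDeriv₂ (o o' : Ellipse) (E : ℝ) :
    ∫ E' in (0 : ℝ)..2 * π, kernelDeriv₂ o o' (E', E, 0) =
      π / (o'.a ^ 3 * √(1 - o'.e ^ 2) ^ 3) * (1 - o.e * Real.cos E) *
        (‖o.orb E‖ ^ 2 - 3 * ⟪o.orb E, o'.N⟫ ^ 2) := by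
  have ha := o'.a_pos
  have hη : 0 < √(1 - o'.e ^ 2) := Real.sqrt_pos.2 (MassData.one_sub_e_sq_pos o')
  set η := √(1 - o'.e ^ 2) with hηd
  set x := o.orb E with hx
  -- At zero dilation the kernel is the weight times `(3⟪x, x'⟫² - ‖x‖²‖x'‖²) / ‖x'‖⁵`, expanded
  -- here in the axes of the outer ellipse.
  have hk : ∀ E', kernelDeriv₂ o o' (E', E, 0) =
      ((1 - o.e * Real.cos E) / o'.a ^ 3 * (3 * ⟪x, o'.P⟫ ^ 2 - ‖x‖ ^ 2)) *
          ((Real.cos E' - o'.e) ^ 2 / (1 - o'.e * Real.cos E') ^ 4) +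
        ((1 - o.e * Real.cos E) / o'.a ^ 3 * η ^ 2 * (3 * ⟪x, cross o'.N o'.P⟫ ^ 2 - ‖x‖ ^ 2)) *
          (Real.sin E' ^ 2 / (1 - o'.e * Real.cos E') ^ 4) +
        ((1 - o.e * Real.cos E) / o'.a ^ 3 * (6 * η * ⟪x, o'.P⟫ * ⟪x, cross o'.N o'.P⟫)) *
          (Real.sin E' * (Real.cos E' - o'.e) / (1 - o'.e * Real.cos E') ^ 4) := by
    intro E'
    have hw := o'.one_sub_pos E'
    have hs : √((o'.a * (1 - o'.e * Real.cos E')) ^ 2) = o'.a * (1 - o'.e * Real.cos E') :=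
      Real.sqrt_sq (by positivity)
    have hd : distSq o o' (E', E, 0) = (o'.a * (1 - o'.e * Real.cos E')) ^ 2 := by
      rw [distSq_eq, zero_smul, zero_sub, norm_neg, o'.norm_orb]
    simp only [kernelDeriv₂, weight, hd, hs, ← o.normSq_orb, ← hx, o'.inner_orb_right, zero_mul,
      sub_zero, ← hηd]
    have hq := o'.one_sub_sq E'
    rw [← hηd] at hq
    set w := 1 - o'.e * Real.cos E'
    field_simp
    rw [hq]
    ring
  simp only [hk]
  rw [integral_linear_combination (continuous_div_kepler o'.e_pos o'.e_lt_one (by fun_prop) 4)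
    (continuous_div_kepler o'.e_pos o'.e_lt_one (by fun_prop) 4)
    (continuous_div_kepler o'.e_pos o'.e_lt_one (by fun_prop) 4),
    integral_cos_sq_div o'.e_pos o'.e_lt_one, integral_sin_sq_div o'.e_pos o'.e_lt_one,
    integral_sin_mul_cos_div o'.e_pos o'.e_lt_one, ← hηd]
  -- The mixed term has integrated to zero and the two squares carry equal weights. Hence `⟪x, P'⟫²
  -- + ⟪x, N' × P'⟫²` can be replaced by `‖x‖² - ⟪x, N'⟫²`, and the outer perihelion disappears.
  have hn := normSq_eq_frame o' x
  field_simp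
  linear_combination (-3) * π * (1 - o.e * Real.cos E) * hn

theorem squareIntegral_kernelDeriv₂ (o o' : Ellipse) :
    squareIntegral (kernelDeriv₂ o o') 0 =
      π ^ 2 * o.a ^ 2 / (o'.a ^ 3 * √(1 - o'.e ^ 2) ^ 3) *
        ((1 - 3 * ⟪o.P, o'.N⟫ ^ 2) * (1 + 4 * o.e ^ 2) +
          (1 - 3 * ⟪cross o.N o.P, o'.N⟫ ^ 2) * (1 - o.e ^ 2)) := by
  have hη2 := Real.sq_sqrt (MassData.one_sub_e_sq_pos o).le
  set k := π / (o'.a ^ 3 * √(1 - o'.e ^ 2) ^ 3) with hk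
  set η := √(1 - o.e ^ 2) with hη
  have h1 : ∀ E, k * (1 - o.e * Real.cos E) * (‖o.orb E‖ ^ 2 - 3 * ⟪o.orb E, o'.N⟫ ^ 2) =
      k * o.a ^ 2 * (1 - 3 * ⟪o.P, o'.N⟫ ^ 2) *
          ((1 - o.e * Real.cos E) * (Real.cos E - o.e) ^ 2) +
        k * o.a ^ 2 * η ^ 2 * (1 - 3 * ⟪cross o.N o.P, o'.N⟫ ^ 2) *
          ((1 - o.e * Real.cos E) * Real.sin E ^ 2) +
        k * o.a ^ 2 * (-6 * η * ⟪o.P, o'.N⟫ * ⟪cross o.N o.P, o'.N⟫) *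
          ((1 - o.e * Real.cos E) * (Real.sin E * (Real.cos E - o.e))) := by
    intro E
    rw [o.normSq_orb, o.inner_orb_left, ← hη]
    have hq := o.one_sub_sq E
    rw [← hη] at hq
    linear_combination k * (1 - o.e * Real.cos E) * o.a ^ 2 * hq
  rw [squareIntegral]
  simp only [integral_kernelDeriv₂, ← hk, h1]
  rw [integral_linear_combination (by fun_prop) (by fun_prop) (by fun_prop),
    integral_kepler_cos_sq, integral_kepler_sin_sq, integral_kepler_sin_mul_cos, hη2]
  have : π ^ 2 * o.a ^ 2 / (o'.a ^ 3 * √(1 - o'.e ^ 2) ^ 3) = k * o.a ^ 2 * π := by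
    rw [hk]; ring
  rw [this]
  ring

/-- The averaged quadrupole interaction of two Kepler ellipses. -/
theorem MassData.fAvOrder_two_eq (D : MassData) (s : Config) (i j : ℕ) :
    D.fAvOrder 2 s i j = -(D.m i * D.m j) / 8 * (s i).a ^ 2 /
      ((s j).a ^ 3 * √(1 - (s j).e ^ 2) ^ 3) *
        (2 + 3 * (s i).e ^ 2 - 3 * ((1 + 4 * (s i).e ^ 2) * ⟪(s i).P, (s j).N⟫ ^ 2 +
          (1 - (s i).e ^ 2) * ⟪cross (s i).N (s i).P, (s j).N⟫ ^ 2)) := by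
  rw [fAvOrder_two, squareIntegral_kernelDeriv₂]
  have := (s j).a_pos
  have hη : 0 < √(1 - (s j).e ^ 2) := Real.sqrt_pos.2 (MassData.one_sub_e_sq_pos (s j))
  have := Real.pi_pos
  field_simp
  ring

/-! ### The quadrupole interaction of the two outermost planets in the variables `P_*` -/

/-- The scalar product of `S_{n-1}` and `S_n`, of lengths `X` and `c`, with `k = cos ϑ_{n-1}`. -/
def pairing (X c Θ k : ℝ) : ℝ := Θ ^ 2 - √(X ^ 2 - Θ ^ 2) * √(c ^ 2 - Θ ^ 2) * k

/-- The square of the length of `C_{n-1}`. -/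
def innerSq (X c Θ k : ℝ) : ℝ := X ^ 2 + c ^ 2 - 2 * pairing X c Θ k

/-- The quadrupole interaction, up to a factor depending on `Λ_{n-1}`, `Λ_n` and `χ_{n-1}`. -/
def quadShape (L X c Θ k : ℝ) : ℝ :=
  5 - 6 * innerSq X c Θ k / L ^ 2 - 15 * Θ ^ 2 / c ^ 2 * (1 - innerSq X c Θ k / L ^ 2) +
    3 * (pairing X c Θ k - c ^ 2) ^ 2 / (c ^ 2 * L ^ 2)

namespace MassData

variable (D : MassData)

/-- The factor of `quadShape` in the quadrupole interaction of the planets `i` and `j`. -/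
def quadFactor (i j : ℕ) (L L' c : ℝ) : ℝ :=
  -(D.m i * D.m j) / 8 * ((L / D.mr i) ^ 2 / D.Mr i) ^ 2 /
    (((L' / D.mr j) ^ 2 / D.Mr j) ^ 3 * (c / L') ^ 3)

variable {D} {s : Config} {k n : ℕ}

theorem a_eq (i : ℕ) : (s i).a = (D.Lam s i / D.mr i) ^ 2 / D.Mr i := by
  have h1 := D.mr_pos i
  have h2 := D.Mr_pos i
  have h3 := (s i).a_pos
  have h : √(D.Mr i * (s i).a) ^ 2 = D.Mr i * (s i).a := Real.sq_sqrt (by positivity)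
  rw [Lam, mul_div_cancel_left₀ _ h1.ne', h]
  field_simp

theorem norm_nodeN (hk : 1 ≤ k) (hkn : k < n) :
    ‖D.nodeN n s k‖ = √(D.chi n s (k - 1) ^ 2 - D.Theta n s k ^ 2) := by
  rw [← norm_nodeN_sq hk hkn, Real.sqrt_sq (norm_nonneg _)]

theorem norm_nodeNu_succ (hk : 1 ≤ k) :
    ‖D.nodeNu n s (k + 1)‖ = √(D.chi n s k ^ 2 - D.Theta n s k ^ 2) := by
  rw [← norm_nodeNu_succ_sq hk, Real.sqrt_sq (norm_nonneg _)]

/-- The scalar product of `n_k = S_k × P_k` and `ν_{k+1} = P_k × S_{k+1}` is `Θ_k² - ⟪S_k,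
S_{k+1}⟫`; it is also the product of their lengths times `cos ϑ_k`. -/
theorem inner_S_succ (hk : 1 ≤ k) (hkn : k < n) :
    ⟪D.S n s k, D.S n s (k + 1)⟫ =
      pairing (D.chi n s (k - 1)) (D.chi n s k) (D.Theta n s k) (D.vartheta n s k).cos := by
  have h := inner_eq_of_angleAbout (w := (s k).P) (u := D.nodeN n s k) (v := D.nodeNu n s (k + 1))
    (by rw [nodeN_of_lt hkn, real_inner_comm, inner_cross_self_right])
    (by rw [nodeNu_succ hk, real_inner_comm, inner_cross_self_left]) (P_ne_zero _)
  rw [← vartheta_of_pos hk, norm_nodeN hk hkn, norm_nodeNu_succ hk, nodeN_of_lt hkn,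
    nodeNu_succ hk, inner_cross_cross, inner_S_P D s hkn.le, real_inner_comm _ (s k).P,
    ← Theta_of_pos hk, ← normSq_eq, (s k).norm_P] at h
  rw [pairing]
  linear_combination -h

theorem normSq_angMom (hk : 1 ≤ k) (hkn : k < n) :
    ‖D.angMom s k‖ ^ 2 =
      innerSq (D.chi n s (k - 1)) (D.chi n s k) (D.Theta n s k) (D.vartheta n s k).cos := by
  have h : D.angMom s k = D.S n s k - D.S n s (k + 1) := by
    rw [S_eq_add D s hkn.le, add_sub_cancel_right]
  rw [h, norm_sub_sq_real, inner_S_succ hk hkn, innerSq, chi, chi, Nat.sub_add_cancel hk]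
  ring

/-- For the last pair, `S_{k+1}` is the outer angular momentum. So `Θ` gives the component of the
outer normal along the inner perihelion, and `pairing` gives the component along the inner normal.
The third component follows because the outer normal is a unit vector. -/
theorem fAvOrder_two_eq_quadShape (hk : 1 ≤ k) :
    D.fAvOrder 2 s k (k + 1) = D.quadFactor k (k + 1) (D.Lam s k) (D.Lam s (k + 1))
        (D.chi (k + 1) s k) *
      quadShape (D.Lam s k) (D.chi (k + 1) s (k - 1)) (D.chi (k + 1) s k) (D.Theta (k + 1) s k)
        (D.vartheta (k + 1) s k).cos := by
  set L := D.Lam s k with hL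
  set L' := D.Lam s (k + 1) with hL'
  set c := D.chi (k + 1) s k with hc
  have hLp : 0 < L := D.Lam_pos s k
  have hLp' : 0 < L' := D.Lam_pos s (k + 1)
  have hS' : D.S (k + 1) s (k + 1) = D.angMom s (k + 1) := S_self D s
  have hcn : c = ‖D.angMom s (k + 1)‖ := by rw [hc, chi, hS']
  have hcp : 0 < c := by rw [hcn]; exact D.norm_angMom_pos s _
  have hη' : √(1 - (s (k + 1)).e ^ 2) = c / L' := by
    rw [hcn, norm_angMom, mul_div_cancel_left₀ _ hLp'.ne']
  have hN' : D.angMom s (k + 1) = c • (s (k + 1)).N := by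
    rw [hcn, norm_angMom]
    rfl
  have hη : L ^ 2 * (1 - (s k).e ^ 2) = ‖D.angMom s k‖ ^ 2 := by
    rw [norm_angMom, mul_pow, Real.sq_sqrt (one_sub_e_sq_pos _).le]
  have hG := normSq_angMom (D := D) (s := s) hk (Nat.lt_succ_self k)
  have hGp := D.norm_angMom_pos s k
  set G := ‖D.angMom s k‖ with hGd
  have hN : D.angMom s k = G • (s k).N := by
    rw [hGd, norm_angMom]
    rfl
  have hα : c * ⟪(s k).P, (s (k + 1)).N⟫ = D.Theta (k + 1) s k := by
    rw [Theta_of_pos hk, hS', hN', real_inner_smul_left, real_inner_comm]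
  have hν : G * c * ⟪(s (k + 1)).N, (s k).N⟫ =
      pairing (D.chi (k + 1) s (k - 1)) c (D.Theta (k + 1) s k) (D.vartheta (k + 1) s k).cos -
        c ^ 2 := by
    rw [hc, ← inner_S_succ hk (Nat.lt_succ_self k), S_eq_add D s (Nat.le_succ k), inner_add_left,
      hS', ← normSq_eq, ← hcn, hN, hN', real_inner_smul_left, inner_smul_right, ← hc,
      real_inner_comm]
    ring
  have hfr := normSq_eq_frame (s k) (s (k + 1)).N
  rw [(s (k + 1)).norm_N] at hfr
  rw [fAvOrder_two_eq, hη', a_eq (D := D) k, a_eq (D := D) (k + 1), ← hL, ← hL', quadFactor]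
  congr 1
  rw [quadShape, ← hG, ← hν, ← hα]
  rw [real_inner_comm] at hfr
  rw [real_inner_comm (s (k + 1)).N (cross (s k).N (s k).P)]
  have he : (s k).e ^ 2 = 1 - G ^ 2 / L ^ 2 := by
    field_simp
    linear_combination -hη
  rw [he]
  set α := ⟪(s k).P, (s (k + 1)).N⟫
  set γ := ⟪(s (k + 1)).N, cross (s k).N (s k).P⟫
  set ν := ⟪(s (k + 1)).N, (s k).N⟫
  field_simp
  linear_combination (3 * G ^ 2) * hfr

end MassData

/-! ### The quadrupole interaction as a sum of two squares -/

section SumOfSquares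

open Set Filter Topology

/-- The product of the lengths of the nodes `n_{n-1}` and `ν_n`. -/
def nodeProd (y : (Fin 4 → ℝ) × ℝ × ℝ) : ℝ :=
  √(y.1 2 ^ 2 - y.2.1 ^ 2) * √(y.1 3 ^ 2 - y.2.1 ^ 2)

/-- The square of the length of `C_{n-1}` at the point `y`, where `ϑ = π + y.2.2`. -/
def innerSqAt (y : (Fin 4 → ℝ) × ℝ × ℝ) : ℝ := innerSq (y.1 2) (y.1 3) y.2.1 (-Real.cos y.2.2)

/-- The excess of `|C_{n-1}|²` over its value in the planar prograde configuration. -/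
def excess (y : (Fin 4 → ℝ) × ℝ × ℝ) : ℝ := innerSqAt y - (y.1 2 - y.1 3) ^ 2

/-- The difference quotient of `quadShape` with respect to `excess`. -/
def slope (y : (Fin 4 → ℝ) × ℝ × ℝ) : ℝ :=
  6 / y.1 0 ^ 2 + 3 * (y.1 2 - y.1 3) / (y.1 3 * y.1 0 ^ 2) -
    3 * excess y / (4 * y.1 3 ^ 2 * y.1 0 ^ 2)

/-- The coefficient of `Θ²`. -/
def coefAction (y : (Fin 4 → ℝ) × ℝ × ℝ) : ℝ :=
  2 * (y.1 2 - y.1 3) ^ 2 / (y.1 2 * y.1 3 - y.2.1 ^ 2 + nodeProd y) * slope y +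
    15 / y.1 3 ^ 2 * (1 - innerSqAt y / y.1 0 ^ 2)

/-- The coefficient of `sin² (v / 2)`. -/
def coefAngle (y : (Fin 4 → ℝ) × ℝ × ℝ) : ℝ := 4 * nodeProd y * slope y

/-- Coordinates in which the quadrupole interaction is a sum of two squares. -/
def quadMap (y : (Fin 4 → ℝ) × ℝ × ℝ) : ℝ × ℝ :=
  (y.2.1 * √(coefAction y), Real.sin (y.2.2 / 2) * √(coefAngle y))

/-- A neighbourhood of the planar prograde configurations. -/
def quadDomain : Set ((Fin 4 → ℝ) × ℝ × ℝ) :=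
  {y | y.1 ∈ admissibleActions ∧ y.2.1 ^ 2 < y.1 3 ^ 2 ∧ |y.2.2| < π ∧
    excess y < 8 * y.1 3 ^ 2 + 4 * y.1 3 * (y.1 2 - y.1 3) ∧ innerSqAt y < y.1 0 ^ 2}

theorem innerSqAt_eq (y : (Fin 4 → ℝ) × ℝ × ℝ) :
    innerSqAt y = y.1 2 ^ 2 + y.1 3 ^ 2 - 2 * (y.2.1 ^ 2 + nodeProd y * Real.cos y.2.2) := by
  rw [innerSqAt, innerSq, pairing, nodeProd]
  ring

theorem continuous_innerSqAt : Continuous innerSqAt := by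
  simp only [funext innerSqAt_eq, nodeProd]
  fun_prop

theorem isOpen_quadDomain : IsOpen quadDomain := by
  have h := continuous_innerSqAt
  have h2 : Continuous excess := by
    unfold excess
    fun_prop
  have o1 : IsOpen {y : (Fin 4 → ℝ) × ℝ × ℝ | 0 < y.1 3} := isOpen_lt (by fun_prop) (by fun_prop)
  have o2 : IsOpen {y : (Fin 4 → ℝ) × ℝ × ℝ | y.1 3 < y.1 1} :=
    isOpen_lt (by fun_prop) (by fun_prop)
  have o3 : IsOpen {y : (Fin 4 → ℝ) × ℝ × ℝ | 0 < y.1 2 - y.1 3} :=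
    isOpen_lt (by fun_prop) (by fun_prop)
  have o4 : IsOpen {y : (Fin 4 → ℝ) × ℝ × ℝ | y.1 2 - y.1 3 < y.1 0} :=
    isOpen_lt (by fun_prop) (by fun_prop)
  have o5 : IsOpen {y : (Fin 4 → ℝ) × ℝ × ℝ | y.2.1 ^ 2 < y.1 3 ^ 2} :=
    isOpen_lt (by fun_prop) (by fun_prop)
  have o6 : IsOpen {y : (Fin 4 → ℝ) × ℝ × ℝ | |y.2.2| < π} :=
    isOpen_lt (by fun_prop) (by fun_prop)
  have o7 : IsOpen {y : (Fin 4 → ℝ) × ℝ × ℝ |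
      excess y < 8 * y.1 3 ^ 2 + 4 * y.1 3 * (y.1 2 - y.1 3)} :=
    isOpen_lt h2 (by fun_prop)
  have o8 : IsOpen {y : (Fin 4 → ℝ) × ℝ × ℝ | innerSqAt y < y.1 0 ^ 2} :=
    isOpen_lt h (by fun_prop)
  exact (o1.inter (o2.inter (o3.inter o4))).inter (o5.inter (o6.inter (o7.inter o8)))

theorem nodeProd_zero {I : Fin 4 → ℝ} (hI : I ∈ admissibleActions) :
    nodeProd (I, 0) = I 2 * I 3 := by
  obtain ⟨h1, h2, h3, h4⟩ := hI
  simp [nodeProd, Real.sqrt_sq h1.le, Real.sqrt_sq (by linarith : 0 ≤ I 2)]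

theorem innerSqAt_zero {I : Fin 4 → ℝ} (hI : I ∈ admissibleActions) :
    innerSqAt (I, 0) = (I 2 - I 3) ^ 2 := by
  rw [innerSqAt_eq, nodeProd_zero hI]
  simp
  ring

theorem mem_quadDomain_zero {I : Fin 4 → ℝ} (hI : I ∈ admissibleActions) :
    (I, (0 : ℝ × ℝ)) ∈ quadDomain := by
  have h := innerSqAt_zero hI
  have hI' := hI
  obtain ⟨h1, h2, h3, h4⟩ := hI
  refine ⟨hI', ?_, by simpa using Real.pi_pos, ?_, ?_⟩
  · simpa using pow_pos h1 2
  · rw [excess, h]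
    simp only [sub_self]
    positivity
  · rw [h]
    exact pow_lt_pow_left₀ h4 h3.le two_ne_zero

variable {y : (Fin 4 → ℝ) × ℝ × ℝ}

theorem sq_lt_of_mem (hy : y ∈ quadDomain) : y.2.1 ^ 2 < y.1 2 ^ 2 := by
  obtain ⟨⟨h1, -, h3, -⟩, h5, -⟩ := hy
  exact h5.trans (pow_lt_pow_left₀ (by linarith) h1.le two_ne_zero)

theorem nodeProd_pos (hy : y ∈ quadDomain) : 0 < nodeProd y :=
  mul_pos (Real.sqrt_pos.2 (sub_pos.2 (sq_lt_of_mem hy))) (Real.sqrt_pos.2 (sub_pos.2 hy.2.1))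

theorem nodeProd_sq (hy : y ∈ quadDomain) :
    nodeProd y ^ 2 = (y.1 2 ^ 2 - y.2.1 ^ 2) * (y.1 3 ^ 2 - y.2.1 ^ 2) := by
  rw [nodeProd, mul_pow, Real.sq_sqrt (sub_pos.2 (sq_lt_of_mem hy)).le,
    Real.sq_sqrt (sub_pos.2 hy.2.1).le]

theorem denominator_pos (hy : y ∈ quadDomain) :
    0 < y.1 2 * y.1 3 - y.2.1 ^ 2 + nodeProd y := by
  have := nodeProd_pos hy
  obtain ⟨⟨h1, -, h3, -⟩, h5, -⟩ := hy
  nlinarith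

theorem slope_pos (hy : y ∈ quadDomain) : 0 < slope y := by
  obtain ⟨⟨h1, h2, h3, h4⟩, -, -, h7, -⟩ := hy
  have h0 : 0 < y.1 0 := h3.trans h4
  have : slope y = 3 * (8 * y.1 3 ^ 2 + 4 * y.1 3 * (y.1 2 - y.1 3) - excess y) /
      (4 * y.1 3 ^ 2 * y.1 0 ^ 2) := by
    rw [slope]
    field_simp
    ring
  rw [this]
  have := sub_pos.2 h7
  positivity

theorem coefAction_pos (hy : y ∈ quadDomain) : 0 < coefAction y := by
  have h1 := slope_pos hy
  have h2 := denominator_pos hy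
  obtain ⟨⟨h3, -, h5, h6⟩, -, -, -, h9⟩ := hy
  have h0 : 0 < y.1 0 := h5.trans h6
  have : 0 < 1 - innerSqAt y / y.1 0 ^ 2 := by
    rw [sub_pos, div_lt_one (by positivity)]
    exact h9
  unfold coefAction
  positivity

theorem coefAngle_pos (hy : y ∈ quadDomain) : 0 < coefAngle y := by
  have := slope_pos hy
  have := nodeProd_pos hy
  unfold coefAngle
  positivity

/-- With `X = y.1 2`, `c = y.1 3`, `Θ = y.2.1`, `v = y.2.2`, the excess is `2 (X c - Θ² - nodeProd
cos v)`. The half-angle formula splits off the sine term. The rest is rationalized by `(X c - Θ²)² -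
nodeProd² = Θ² (X - c)²`, which exhibits the factor `Θ²`. -/
theorem excess_eq (hy : y ∈ quadDomain) :
    excess y = y.2.1 ^ 2 *
      (2 * (y.1 2 - y.1 3) ^ 2 / (y.1 2 * y.1 3 - y.2.1 ^ 2 + nodeProd y)) +
        Real.sin (y.2.2 / 2) ^ 2 * (4 * nodeProd y) := by
  have h := denominator_pos hy
  have h2 := nodeProd_sq hy
  have h3 : Real.cos y.2.2 = 1 - 2 * Real.sin (y.2.2 / 2) ^ 2 := by
    have e : y.2.2 = 2 * (y.2.2 / 2) := by ring
    conv_lhs => rw [e, Real.cos_two_mul, Real.cos_sq']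
    ring
  rw [excess, innerSqAt_eq, h3]
  field_simp
  linear_combination (-2) * h2

theorem excess_eq_zero_iff (hy : y ∈ quadDomain) : excess y = 0 ↔ y.2 = (0, 0) := by
  have hd := denominator_pos hy
  have hn := nodeProd_pos hy
  have hg : 0 < y.1 2 - y.1 3 := hy.1.2.2.1
  rw [excess_eq hy]
  set q := 2 * (y.1 2 - y.1 3) ^ 2 / (y.1 2 * y.1 3 - y.2.1 ^ 2 + nodeProd y) with hq
  have hq0 : 0 < q := by positivity
  constructor
  · intro h
    have h1 : y.2.1 ^ 2 * q = 0 := by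
      refine le_antisymm ?_ (by positivity)
      rw [← h]
      exact le_add_of_nonneg_right (by positivity)
    have h2 : Real.sin (y.2.2 / 2) ^ 2 * (4 * nodeProd y) = 0 := by rwa [h1, zero_add] at h
    have h3 : y.2.1 = 0 := by simpa [hq0.ne'] using h1
    have h4 : Real.sin (y.2.2 / 2) = 0 := by simpa [hn.ne'] using h2
    have h5 := abs_lt.1 hy.2.2.1
    have h6 := (Real.sin_eq_zero_iff_of_lt_of_lt (by linarith [h5.1, Real.pi_pos])
      (by linarith [h5.2, Real.pi_pos])).1 h4
    exact Prod.ext h3 (by simpa using h6)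
  · intro h
    simp [h]

/-- For fixed `Θ` the shape is a quadratic polynomial in `|C_{n-1}|²`. Its deviation from the planar
value is `-(excess * slope)` minus a positive multiple of `Θ²`, and `excess_eq` makes the first
product a sum of two squares as well. -/
theorem quadShape_eq (hy : y ∈ quadDomain) :
    quadShape (y.1 0) (y.1 2) (y.1 3) y.2.1 (-Real.cos y.2.2) =
      5 - 3 * (y.1 2 - y.1 3) ^ 2 / y.1 0 ^ 2 - ((quadMap y).1 ^ 2 + (quadMap y).2 ^ 2) := by
  have e1 : (quadMap y).1 ^ 2 + (quadMap y).2 ^ 2 = excess y * slope y +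
      15 * y.2.1 ^ 2 / y.1 3 ^ 2 * (1 - innerSqAt y / y.1 0 ^ 2) := by
    rw [quadMap, mul_pow, mul_pow, Real.sq_sqrt (coefAction_pos hy).le,
      Real.sq_sqrt (coefAngle_pos hy).le, excess_eq hy, coefAction, coefAngle]
    ring
  have e2 : innerSq (y.1 2) (y.1 3) y.2.1 (-Real.cos y.2.2) = excess y + (y.1 2 - y.1 3) ^ 2 := by
    rw [excess, innerSqAt]
    ring
  have e3 : pairing (y.1 2) (y.1 3) y.2.1 (-Real.cos y.2.2) =
      (y.1 2 ^ 2 + y.1 3 ^ 2 - (excess y + (y.1 2 - y.1 3) ^ 2)) / 2 := by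
    rw [← e2, innerSq]
    ring
  have e4 : innerSqAt y = excess y + (y.1 2 - y.1 3) ^ 2 := e2
  obtain ⟨⟨h3, -, h5, h6⟩, -⟩ := hy
  have h0 : 0 < y.1 0 := h5.trans h6
  rw [e1, quadShape, e2, e3, e4, slope]
  field_simp
  ring

theorem quadMap_zero (I : Fin 4 → ℝ) : quadMap (I, 0) = 0 := by
  simp [quadMap]

theorem analyticAt_nodeProd (hy : y ∈ quadDomain) : AnalyticAt ℝ nodeProd y := by
  have a : ∀ i, AnalyticAt ℝ (fun y : (Fin 4 → ℝ) × ℝ × ℝ => y.1 i) y := fun i =>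
    ((ContinuousLinearMap.proj (R := ℝ) (φ := fun _ : Fin 4 => ℝ) i).comp
      (ContinuousLinearMap.fst ℝ (Fin 4 → ℝ) (ℝ × ℝ))).analyticAt y
  have b := a 2
  have c := a 3
  exact (analyticAt_sqrt_comp (f := fun y : (Fin 4 → ℝ) × ℝ × ℝ => y.1 2 ^ 2 - y.2.1 ^ 2)
    (by fun_prop) (sub_pos.2 (sq_lt_of_mem hy)).ne').mul
    (analyticAt_sqrt_comp (f := fun y : (Fin 4 → ℝ) × ℝ × ℝ => y.1 3 ^ 2 - y.2.1 ^ 2)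
      (by fun_prop) (sub_pos.2 hy.2.1).ne')

theorem analyticAt_coef (hy : y ∈ quadDomain) :
    AnalyticAt ℝ coefAction y ∧ AnalyticAt ℝ coefAngle y := by
  have hn := analyticAt_nodeProd hy
  have a : ∀ i, AnalyticAt ℝ (fun y : (Fin 4 → ℝ) × ℝ × ℝ => y.1 i) y := fun i =>
    ((ContinuousLinearMap.proj (R := ℝ) (φ := fun _ : Fin 4 => ℝ) i).comp
      (ContinuousLinearMap.fst ℝ (Fin 4 → ℝ) (ℝ × ℝ))).analyticAt y
  have a0 := a 0
  have a2 := a 2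
  have a3 := a 3
  have h3 := hy.1.1
  have h0 : 0 < y.1 0 := hy.1.2.2.1.trans hy.1.2.2.2
  have hd := denominator_pos hy
  have hi : AnalyticAt ℝ innerSqAt y := by
    rw [funext innerSqAt_eq]
    fun_prop
  have he : AnalyticAt ℝ excess y := by
    unfold excess
    fun_prop
  have hs : AnalyticAt ℝ slope y := by
    unfold slope
    fun_prop (disch := positivity)
  constructor
  · unfold coefAction
    fun_prop (disch := positivity)
  · unfold coefAngle
    fun_prop

theorem analyticOnNhd_quadMap : AnalyticOnNhd ℝ quadMap quadDomain := fun y hy => by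
  have h1 := analyticAt_sqrt_comp (analyticAt_coef hy).1 (coefAction_pos hy).ne'
  have h2 := analyticAt_sqrt_comp (analyticAt_coef hy).2 (coefAngle_pos hy).ne'
  have h3 : AnalyticAt ℝ (fun y : (Fin 4 → ℝ) × ℝ × ℝ => y.2.1 * √(coefAction y)) y := by fun_prop
  have h4 : AnalyticAt ℝ (fun y : (Fin 4 → ℝ) × ℝ × ℝ =>
    Real.sin (y.2.2 / 2) * √(coefAngle y)) y := by fun_prop
  exact h3.prod h4

/-- At the origin the fibre differential is diagonal, with entries `F` and `G / 2`. -/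
theorem fiberDet_mul_sin_mul {P : Type*} [NormedAddCommGroup P] [NormedSpace ℝ P]
    {F G : P × ℝ × ℝ → ℝ} {I : P} (hF : DifferentiableAt ℝ F (I, 0))
    (hG : DifferentiableAt ℝ G (I, 0)) :
    fiberDet (fun y => (y.2.1 * F y, Real.sin (y.2.2 / 2) * G y)) (I, 0) =
      F (I, 0) * G (I, 0) / 2 := by
  have p1 : HasFDerivAt (fun y : P × ℝ × ℝ => y.2.1) _ (I, (0 : ℝ × ℝ)) :=
    (hasFDerivAt_fst (𝕜 := ℝ)).comp _ (hasFDerivAt_snd (𝕜 := ℝ))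
  have p2 : HasFDerivAt (fun y : P × ℝ × ℝ => y.2.2) _ (I, (0 : ℝ × ℝ)) :=
    (hasFDerivAt_snd (𝕜 := ℝ)).comp _ (hasFDerivAt_snd (𝕜 := ℝ))
  have p3 : HasFDerivAt (fun y : P × ℝ × ℝ => y.2.2 / 2) _ (I, (0 : ℝ × ℝ)) :=
    (p2.const_mul (2 : ℝ)⁻¹).congr_of_eventuallyEq (Eventually.of_forall fun y => by ring)
  have h : HasFDerivAt (fun y : P × ℝ × ℝ => (y.2.1 * F y, Real.sin (y.2.2 / 2) * G y)) _
      (I, (0 : ℝ × ℝ)) :=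
    (p1.mul hF.hasFDerivAt).prodMk ((p3.sin).mul hG.hasFDerivAt)
  simp [fiberDet, h.fderiv]
  ring

theorem fiberDet_quadMap_pos {I : Fin 4 → ℝ} (hI : I ∈ admissibleActions) :
    0 < fiberDet quadMap (I, 0) := by
  have hy := mem_quadDomain_zero hI
  have h1 := analyticAt_sqrt_comp (analyticAt_coef hy).1 (coefAction_pos hy).ne'
  have h2 := analyticAt_sqrt_comp (analyticAt_coef hy).2 (coefAngle_pos hy).ne'
  have h : fiberDet quadMap (I, 0) = _ :=
    fiberDet_mul_sin_mul h1.differentiableAt h2.differentiableAt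
  rw [h]
  have := Real.sqrt_pos.2 (coefAction_pos hy)
  have := Real.sqrt_pos.2 (coefAngle_pos hy)
  positivity

end SumOfSquares

/-! ### Configurations with prescribed outer variables -/

theorem exists_angleAbout_eq {w u : E3} (hu : ⟪w, u⟫ = 0) (hw0 : w ≠ 0) (hu0 : u ≠ 0) {l : ℝ}
    (hl : 0 < l) (θ : Real.Angle) : ∃ v : E3, ⟪w, v⟫ = 0 ∧ ‖v‖ = l ∧ angleAbout w u v = θ := by
  have hw := norm_pos_iff.2 hw0
  have hun := norm_pos_iff.2 hu0
  have hc : 0 < l / (‖w‖ * ‖u‖) := by positivity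
  refine ⟨_, ?_, ?_, angleAbout_eq hu hw0 hu0 hc θ⟩
  · rw [inner_smul_right, inner_add_right, inner_smul_right, inner_smul_right, hu,
      real_inner_comm, inner_cross_self_left]
    ring
  · refine (sq_eq_sq₀ (norm_nonneg _) hl.le).1 ?_
    have h1 : ⟪u, cross w u⟫ = 0 := by rw [real_inner_comm, inner_cross_self_right]
    have h2 : ‖cross w u‖ = ‖w‖ * ‖u‖ := norm_cross_of_orth hu
    have h3 := Real.Angle.cos_sq_add_sin_sq θ
    rw [norm_smul, mul_pow, norm_add_sq_real, norm_smul, norm_smul, inner_smul_right,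
      real_inner_smul_left, h1, h2, Real.norm_of_nonneg hc.le, Real.norm_eq_abs, Real.norm_eq_abs,
      mul_pow, mul_pow, sq_abs, sq_abs]
    field_simp
    linear_combination ‖w‖ * ‖u‖ ^ 2 * h3

/-- The solution is `(t w - w × m) / ‖w‖²`. It recovers a vector from a node and a `Θ`. -/
theorem exists_cross_eq {w m : E3} (hm : ⟪w, m⟫ = 0) (hw0 : w ≠ 0) (t : ℝ) :
    ∃ x : E3, cross w x = m ∧ ⟪w, x⟫ = t ∧ ‖w‖ ^ 2 * ‖x‖ ^ 2 = t ^ 2 + ‖m‖ ^ 2 := by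
  have hw := norm_pos_iff.2 hw0
  have h1 : cross w ((‖w‖ ^ 2)⁻¹ • (t • w - cross w m)) = m := by
    rw [cross_smul_right, cross_sub_right, cross_smul_right, cross_self, smul_zero,
      cross_cross_right, hm, zero_smul, ← normSq_eq, zero_sub, zero_sub, neg_neg, smul_smul,
      inv_mul_cancel₀ (by positivity), one_smul]
  have h2 : ⟪w, (‖w‖ ^ 2)⁻¹ • (t • w - cross w m)⟫ = t := by
    rw [inner_smul_right, inner_sub_right, inner_smul_right, real_inner_comm (cross w m) w,
      inner_cross_self_left, ← normSq_eq]
    field_simp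
    ring
  refine ⟨_, h1, h2, ?_⟩
  have h3 := norm_cross_sq w ((‖w‖ ^ 2)⁻¹ • (t • w - cross w m))
  rw [h1, h2] at h3
  linear_combination -h3

theorem norm_frame1 : ‖frame1‖ = 1 := by simp [frame1]

theorem norm_frame3 : ‖frame3‖ = 1 := by simp [frame3]

theorem inner_frame3_frame1 : ⟪frame3, frame1⟫ = 0 := by simp [frame3, frame1, inner_coord]

theorem cross_ne_zero {u v : E3} (h : ⟪u, v⟫ = 0) (hu : u ≠ 0) (hv : v ≠ 0) : cross u v ≠ 0 := by
  rw [← norm_ne_zero_iff, norm_cross_of_orth h]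
  exact mul_ne_zero (norm_ne_zero_iff.2 hu) (norm_ne_zero_iff.2 hv)

/-- Vectors `P = P_{n-1}`, `S' = S_n`, `P' = P_n` with prescribed outer variables, for a given
vector `S = S_{n-1}` and a given node `u = ν_{n-1}`. -/
theorem exists_outer_vectors {S u : E3} (hS0 : S ≠ 0) (hu0 : u ≠ 0) (hu : ⟪S, u⟫ = 0) {c Θ : ℝ}
    (hc : 0 < c) (hX : Θ ^ 2 < ‖S‖ ^ 2) (hcT : Θ ^ 2 < c ^ 2) (κ ϑ κ' : Real.Angle) :
    ∃ P S' P' : E3, ‖P‖ = 1 ∧ ‖P'‖ = 1 ∧ ‖S'‖ = c ∧ ⟪S, P⟫ = Θ ∧ ⟪S', P⟫ = Θ ∧ ⟪S', P'⟫ = 0 ∧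
      cross S P ≠ 0 ∧ cross P S' ≠ 0 ∧ angleAbout S u (cross S P) = κ ∧
      angleAbout P (cross S P) (cross P S') = ϑ ∧ angleAbout S' (cross P S') P' = κ' ∧
      ⟪S, S'⟫ = pairing ‖S‖ c Θ ϑ.cos := by
  have hSn := norm_pos_iff.2 hS0
  have hq := Real.sqrt_pos.2 (sub_pos.2 hX)
  have hρ := Real.sqrt_pos.2 (sub_pos.2 hcT)
  -- `v` will be the node `S × P`; its length `√(‖S‖² - Θ²)` is what forces `P` to be a unit vector.
  -- In the same way `v'` below will be `P × S'`.
  obtain ⟨v, hSv, hv, hκ⟩ := exists_angleAbout_eq hu hS0 hu0 hq κ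
  obtain ⟨P, hSP, hΘ, hP⟩ := exists_cross_eq hSv hS0 Θ
  rw [hv, Real.sq_sqrt (sub_pos.2 hX).le] at hP
  have hP1 : ‖P‖ = 1 := by
    refine (sq_eq_sq₀ (norm_nonneg _) zero_le_one).1 (mul_left_cancel₀ (pow_pos hSn 2).ne' ?_)
    rw [hP]
    ring
  have hP0 : P ≠ 0 := norm_ne_zero_iff.1 (by rw [hP1]; exact one_ne_zero)
  have hPv : ⟪P, v⟫ = 0 := by rw [← hSP, real_inner_comm, inner_cross_self_right]
  have hv0 : v ≠ 0 := norm_ne_zero_iff.1 (by rw [hv]; exact hq.ne')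
  obtain ⟨v', hPv', hv', hϑ⟩ := exists_angleAbout_eq hPv hP0 hv0 hρ ϑ
  obtain ⟨S', hPS', hΘ', hS'⟩ := exists_cross_eq hPv' hP0 Θ
  rw [hv', Real.sq_sqrt (sub_pos.2 hcT).le, hP1] at hS'
  have hS'n : ‖S'‖ = c := by
    refine (sq_eq_sq₀ (norm_nonneg _) hc.le).1 ?_
    linear_combination hS'
  have hS'0 : S' ≠ 0 := norm_ne_zero_iff.1 (by rw [hS'n]; exact hc.ne')
  have hv'0 : v' ≠ 0 := norm_ne_zero_iff.1 (by rw [hv']; exact hρ.ne')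
  have hS'v' : ⟪S', v'⟫ = 0 := by rw [← hPS', real_inner_comm, inner_cross_self_right]
  obtain ⟨P', hSP', hP', hκ'⟩ := exists_angleAbout_eq hS'v' hS'0 hv'0 one_pos κ'
  have hin := inner_eq_of_angleAbout hPv hPv' hP0
  rw [hϑ, hv, hv', ← hSP, ← hPS', inner_cross_cross, ← normSq_eq, hP1, hΘ, hΘ'] at hin
  refine ⟨P, S', P', hP1, hP', hS'n, hΘ, by rw [real_inner_comm, hΘ'], hSP', by rwa [hSP],
    by rwa [hPS'], by rw [hSP, hκ], by rw [hSP, hPS', hϑ], by rw [hPS', hκ'], ?_⟩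
  rw [pairing]
  linear_combination -hin

namespace MassData

variable (D : MassData)

theorem exists_ellipse (i : ℕ) {L : ℝ} {C P : E3} (hC0 : C ≠ 0) (hCL : ‖C‖ < L) (hP : ‖P‖ = 1)
    (hCP : ⟪C, P⟫ = 0) : ∃ o : Ellipse, o.P = P ∧ D.mr i * √(D.Mr i * o.a) = L ∧
      (L * √(1 - o.e ^ 2)) • o.N = C := by
  have h1 := D.mr_pos i
  have h2 := D.Mr_pos i
  have hC := norm_pos_iff.2 hC0
  have hL : 0 < L := hC.trans hCL
  have hq : ‖C‖ / L < 1 := (div_lt_one hL).2 hCL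
  have hq0 : 0 < ‖C‖ / L := by positivity
  have hp : 0 < 1 - (‖C‖ / L) ^ 2 := sub_pos.2 (pow_lt_one₀ hq0.le hq two_ne_zero)
  refine ⟨⟨(L / D.mr i) ^ 2 / D.Mr i, √(1 - (‖C‖ / L) ^ 2), P, ‖C‖⁻¹ • C, by positivity,
    Real.sqrt_pos.2 hp, ?_, hP, ?_, ?_⟩, rfl, ?_, ?_⟩
  · rw [Real.sqrt_lt' one_pos, one_pow]
    exact sub_lt_self _ (by positivity)
  · rw [norm_smul, norm_inv, norm_norm, inv_mul_cancel₀ hC.ne']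
  · rw [inner_smul_right, real_inner_comm, hCP, mul_zero]
  · simp only
    rw [mul_div_cancel₀ _ h2.ne', Real.sqrt_sq (by positivity), mul_div_cancel₀ _ h1.ne']
  · simp only
    rw [Real.sq_sqrt hp.le, sub_sub_cancel, Real.sqrt_sq hq0.le, mul_div_cancel₀ _ hL.ne',
      smul_smul, mul_inv_cancel₀ hC.ne', one_smul]

/-- The ellipses given to the planets other than the two outermost ones. -/
def innerEllipse : Ellipse where
  a := 1
  e := 1 / 2
  P := frame3
  N := frame1
  a_pos := one_pos
  e_pos := by norm_num
  e_lt_one := by norm_num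
  norm_P := norm_frame3
  norm_N := norm_frame1
  orth := inner_frame3_frame1

/-- `S_{n-1}` is put along `frame1`, and all inner planets get normal `frame1` and perihelion
`frame3`. Then every `S_j` with `j ≤ n - 1` is a positive multiple of `frame1`, and the inner nodes
cannot vanish. The bounds on `innerSq` keep the eccentricity of planet `n - 1` in `(0, 1)`. -/
theorem exists_hasCoords (m : ℕ) {w : Phase} (h2 : 0 < w.1 2) (h3 : 0 < w.1 3)
    (h31 : w.1 3 < w.1 1) (h0 : 0 < w.1 0) (hT2 : w.2.2.1 ^ 2 < w.1 2 ^ 2)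
    (hT3 : w.2.2.1 ^ 2 < w.1 3 ^ 2)
    (hG : 0 < innerSq (w.1 2) (w.1 3) w.2.2.1 (Real.cos w.2.2.2))
    (hGL : innerSq (w.1 2) (w.1 3) w.2.2.1 (Real.cos w.2.2.2) < w.1 0 ^ 2) :
    ∃ s : Config, D.Regular (m + 2) s ∧ D.HasCoords (m + 2) s w := by
  have hf1 : frame1 ≠ 0 := norm_ne_zero_iff.1 (by rw [norm_frame1]; exact one_ne_zero)
  have hf3 : frame3 ≠ 0 := norm_ne_zero_iff.1 (by rw [norm_frame3]; exact one_ne_zero)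
  have hnode : ∀ t : ℝ, 0 < t → cross frame3 (t • frame1) ≠ 0 := fun t ht => by
    rw [cross_smul_right]
    exact smul_ne_zero ht.ne' (cross_ne_zero inner_frame3_frame1 hf3 hf1)
  have hnode' : ∀ t : ℝ, 0 < t → cross (t • frame1) frame3 ≠ 0 := fun t ht => by
    rw [cross_comm]
    exact neg_ne_zero.2 (hnode t ht)
  have hSn : ‖w.1 2 • frame1‖ = w.1 2 := by
    rw [norm_smul, norm_frame1, mul_one, Real.norm_of_nonneg h2.le]
  obtain ⟨P, S', P', hP, hP', hS', hSP, hS'P, hS'P', hn1, hn2, hκ, hϑ, hκ', hSS'⟩ :=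
    exists_outer_vectors (S := w.1 2 • frame1) (u := cross frame3 (w.1 2 • frame1))
      (smul_ne_zero h2.ne' hf1) (hnode _ h2) (by rw [real_inner_comm, inner_cross_self_right]) h3
      (by rwa [hSn]) hT3 (w.2.1 2) (w.2.2.2) (w.2.1 3)
  rw [hSn, Real.Angle.cos_coe] at hSS'
  set S := w.1 2 • frame1 with hS
  have hCn : ‖S - S'‖ ^ 2 = innerSq (w.1 2) (w.1 3) w.2.2.1 (Real.cos w.2.2.2) := by
    rw [norm_sub_sq_real, hSn, hS', hSS', innerSq]
    ring
  have hS'0 : S' ≠ 0 := norm_ne_zero_iff.1 (by rw [hS']; exact h3.ne')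
  obtain ⟨o, hoP, hoL, hoC⟩ := D.exists_ellipse (m + 1) (L := w.1 0) (C := S - S') (P := P)
    (fun h => by rw [h, norm_zero] at hCn; norm_num at hCn; exact hG.ne hCn)
    (lt_of_pow_lt_pow_left₀ 2 h0.le (by rwa [hCn])) hP
    (by rw [inner_sub_left, hSP, hS'P, sub_self])
  obtain ⟨o', hoP', hoL', hoC'⟩ := D.exists_ellipse (m + 2) (L := w.1 1) (C := S') (P := P')
    hS'0 (by rwa [hS']) hP' hS'P'
  let s : Config := fun j => if j = m + 2 then o' else if j = m + 1 then o else innerEllipse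
  have s2 : s (m + 2) = o' := if_pos rfl
  have s1 : s (m + 1) = o := by simp [s]
  have s0 : ∀ j ≤ m, s j = innerEllipse := fun j hj => by
    simp [s, show j ≠ m + 2 by omega, show j ≠ m + 1 by omega]
  have L2 : D.Lam s (m + 2) = w.1 1 := by rw [Lam, s2, hoL']
  have L1 : D.Lam s (m + 1) = w.1 0 := by rw [Lam, s1, hoL]
  have S2 : D.S (m + 2) s (m + 2) = S' := by rw [S_self, angMom, L2, s2, hoC']
  have S1 : D.S (m + 2) s (m + 1) = S := by
    rw [S_eq_add D s (by omega), S2, angMom, L1, s1, hoC, sub_add_cancel]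
  have S0 : ∀ j ≤ m + 1, ∃ t : ℝ, 0 < t ∧ D.S (m + 2) s j = t • frame1 := fun j hj => by
    induction hj using Nat.decreasingInduction with
    | self => exact ⟨w.1 2, h2, S1⟩
    | of_succ j hj ih =>
      obtain ⟨t, ht, h⟩ := ih
      refine ⟨D.Lam s j * √(1 - (s j).e ^ 2) + t, ?_, ?_⟩
      · rw [← norm_angMom]
        exact add_pos (D.norm_angMom_pos s j) ht
      · rw [S_eq_add D s (by omega), h, angMom, add_smul, s0 j (by omega)]
        rfl
  have ν2 : D.nodeNu (m + 2) s (m + 2) = cross P S' := by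
    rw [nodeNu_succ (by omega), S2, s1, hoP]
  -- Giving the inner planets the perihelion `frame3` makes this node the same whether or not there
  -- are inner planets.
  have ν1 : D.nodeNu (m + 2) s (m + 1) = cross frame3 S := by
    rcases Nat.eq_zero_or_pos m with rfl | hm
    · rw [nodeNu, if_pos rfl, S1]
    · rw [nodeNu_succ hm, S1, s0 m le_rfl]
      rfl
  have N1 : D.nodeN (m + 2) s (m + 1) = cross S P := by
    rw [nodeN_of_lt (by omega), S1, s1, hoP]
  have N2 : D.nodeN (m + 2) s (m + 2) = P' := by rw [nodeN, if_pos rfl, s2, hoP']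
  refine ⟨s, fun j hj hjn => ⟨?_, ?_⟩, L1, L2, ?_, ?_, ?_, ?_, ?_, ?_⟩
  · rcases Nat.lt_or_ge j (m + 2) with h | h
    · obtain ⟨t, ht, hSj⟩ := S0 j (by omega)
      obtain ⟨i, rfl⟩ : ∃ i, j = i + 1 := ⟨j - 1, by omega⟩
      rcases Nat.eq_zero_or_pos i with rfl | hi
      · rw [nodeNu, if_pos rfl, hSj]
        exact hnode t ht
      · rw [nodeNu_succ hi, hSj, s0 i (by omega)]
        exact hnode t ht
    · obtain rfl : j = m + 2 := by omega
      rwa [ν2]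
  · rcases Nat.lt_or_ge j (m + 1) with h | h
    · obtain ⟨t, ht, hSj⟩ := S0 j (by omega)
      rw [nodeN_of_lt (by omega), hSj, s0 j (by omega)]
      exact hnode' t ht
    · rcases (show j = m + 1 ∨ j = m + 2 by omega) with rfl | rfl
      · rwa [N1]
      · rw [N2, ← norm_ne_zero_iff, hP']
        exact one_ne_zero
  · show ‖D.S (m + 2) s (m + 1)‖ = _
    rw [S1, hSn]
  · show ‖D.S (m + 2) s (m + 2)‖ = _
    rw [S2, hS']
  · show angleAbout (D.S (m + 2) s (m + 1)) (D.nodeNu (m + 2) s (m + 1))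
      (D.nodeN (m + 2) s (m + 1)) = _
    rw [S1, ν1, N1, hκ]
  · show angleAbout (D.S (m + 2) s (m + 2)) (D.nodeNu (m + 2) s (m + 2))
      (D.nodeN (m + 2) s (m + 2)) = _
    rw [S2, ν2, N2, hκ']
  · show D.Theta (m + 2) s (m + 1) = _
    rw [Theta_of_pos (by omega), S2, s1, hoP, hS'P]
  · show D.vartheta (m + 2) s (m + 1) = _
    rw [vartheta_of_pos (by omega), s1, hoP, N1, ν2, hϑ]

end MassData

/-! ### Integrability of the quadrupole interaction near the planar configurations -/

namespace MassData

variable {D : MassData} {m : ℕ} {s : Config} {w : Phase} {y : (Fin 4 → ℝ) × ℝ × ℝ}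

/-- Equal directions mean equality in the triangle inequality, that is `|C_{n-1}| = χ_{n-2} -
χ_{n-1}`. As this difference is positive on the domain, squares may be compared. -/
theorem sameRay_iff_excess (hc : D.HasCoords (m + 2) s w)
    (hy : y ∈ quadDomain) (h1 : w.1 = y.1) (h2 : w.2.2 = (y.2.1, π + y.2.2)) :
    SameRay ℝ (D.angMom s (m + 1)) (D.angMom s (m + 2)) ↔ excess y = 0 := by
  obtain ⟨-, -, c2, c3, -, -, cΘ, cϑ⟩ := hc
  have hX : ‖D.angMom s (m + 1) + D.angMom s (m + 2)‖ = y.1 2 := by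
    rw [← S_self (n := m + 2) D s, ← S_eq_add D s (Nat.le_succ _), ← h1]
    exact c2
  have hc' : ‖D.angMom s (m + 2)‖ = y.1 3 := by
    rw [← S_self (n := m + 2) D s, ← h1]
    exact c3
  have hG : ‖D.angMom s (m + 1)‖ ^ 2 = innerSqAt y := by
    rw [normSq_angMom (n := m + 2) (by omega) (by omega)]
    have e1 : D.chi (m + 2) s (m + 1 - 1) = w.1 2 := c2
    have e2 : D.chi (m + 2) s (m + 1) = w.1 3 := c3
    have e3 : D.Theta (m + 2) s (m + 1) = w.2.2.1 := cΘ
    have e4 : D.vartheta (m + 2) s (m + 1) = (w.2.2.2 : Real.Angle) := cϑ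
    rw [e1, e2, e3, e4, h1, h2, Real.Angle.cos_coe, add_comm π, Real.cos_add_pi, innerSqAt]
  have hpos : 0 ≤ y.1 2 - y.1 3 := hy.1.2.2.1.le
  rw [sameRay_iff_norm_add, hX, hc', excess, ← hG, sub_eq_zero, sq_eq_sq₀ (norm_nonneg _) hpos]
  constructor <;> intro h <;> linarith

theorem fAvOrder_two_of_hasCoords (hc : D.HasCoords (m + 2) s w)
    (hy : y ∈ quadDomain) (h1 : w.1 = y.1) (h2 : w.2.2 = (y.2.1, π + y.2.2)) :
    D.fAvOrder 2 s (m + 1) (m + 2) =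
      D.quadFactor (m + 1) (m + 2) (y.1 0) (y.1 1) (y.1 3) *
        (5 - 3 * (y.1 2 - y.1 3) ^ 2 / y.1 0 ^ 2 -
          ((quadMap y).1 ^ 2 + (quadMap y).2 ^ 2)) := by
  obtain ⟨c0, c1, c2, c3, -, -, cΘ, cϑ⟩ := hc
  have e0 : D.Lam s (m + 1) = w.1 0 := c0
  have e1 : D.chi (m + 2) s (m + 1 - 1) = w.1 2 := c2
  have e2 : D.chi (m + 2) s (m + 1) = w.1 3 := c3
  have e3 : D.Theta (m + 2) s (m + 1) = w.2.2.1 := cΘ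
  have e4 : D.vartheta (m + 2) s (m + 1) = (w.2.2.2 : Real.Angle) := cϑ
  have h := fAvOrder_two_eq_quadShape (D := D) (s := s) (k := m + 1) (by omega)
  rw [c1, e0, e1, e2, e3, e4, h1, h2, Real.Angle.cos_coe, add_comm π, Real.cos_add_pi,
    quadShape_eq hy] at h
  exact h

theorem exists_hasCoords_of_mem_quadDomain (D : MassData) (m : ℕ) (hy : y ∈ quadDomain)
    (h1 : w.1 = y.1) (h2 : w.2.2 = (y.2.1, π + y.2.2)) :
    ∃ s : Config, D.Regular (m + 2) s ∧ D.HasCoords (m + 2) s w := by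
  have hcos : Real.cos w.2.2.2 = -Real.cos y.2.2 := by
    rw [h2, add_comm π, Real.cos_add_pi]
  have hT : w.2.2.1 = y.2.1 := by rw [h2]
  have hg : 0 < innerSqAt y := by
    have h := excess_eq hy
    have h3 := denominator_pos hy
    have h4 := nodeProd_pos hy
    have h5 : 0 < y.1 2 - y.1 3 := hy.1.2.2.1
    have h6 : 0 ≤ excess y := by
      rw [h]
      positivity
    rw [excess] at h6
    have h7 := pow_pos h5 2
    linarith
  obtain ⟨⟨i1, i2, i3, i4⟩, j1, -, -, j4⟩ := id hy
  refine D.exists_hasCoords m (w := w) ?_ ?_ ?_ ?_ ?_ ?_ ?_ ?_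
  · rw [h1]; linarith
  · rwa [h1]
  · rwa [h1]
  · rw [h1]; linarith
  · rw [h1, hT]; exact sq_lt_of_mem hy
  · rwa [h1, hT]
  · rwa [h1, hT, hcos]
  · rwa [h1, hT, hcos]

/-- The quadrupole interaction of the two outermost planets is integrable near the planar prograde
configurations. -/
theorem exists_integrating_coordinates (D : MassData) (m : ℕ) {K : Set (Fin 4 → ℝ)}
    (hK : IsCompact K) (hKA : K ⊆ admissibleActions) :
    ∃ (A : Set (Fin 4 → ℝ)) (r : ℝ) (Φ : Phase → Phase) (h : (Fin 4 → ℝ) → ℝ → ℝ),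
      IsOpen A ∧ K ⊆ A ∧ 0 < r ∧ IsCanonicalChange A r Φ ∧
      ∀ z ∈ phaseDomain A r,
        (∃ s : Config, D.Regular (m + 2) s ∧ D.HasCoords (m + 2) s (Φ z)) ∧
        ∀ s : Config, D.Regular (m + 2) s → D.HasCoords (m + 2) s (Φ z) →
          (SameRay ℝ (D.angMom s (m + 1)) (D.angMom s (m + 2)) ↔ z.2.2 = (0, 0)) ∧
          D.fAvOrder 2 s (m + 1) (m + 2) = h z.1 ((z.2.2.1 ^ 2 + z.2.2.2 ^ 2) / 2) := by
  have hcont : ContinuousOn (fiberDet quadMap) quadDomain := fun y hy =>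
    (analyticAt_fiberDet (analyticOnNhd_quadMap y hy)).continuousAt.continuousWithinAt
  -- The Jacobian of `quadMap` is known to be positive only at the equilibria; the domain is cut
  -- down to the open set where it stays positive.
  obtain ⟨A, r, σ, ρ, hA, hKA', hr, hσ, hσW, hσ0, hinv⟩ := exists_action_coordinates hK
    (hcont.isOpen_inter_preimage isOpen_quadDomain isOpen_Ioi)
    (fun I hI => ⟨mem_quadDomain_zero (hKA hI), fiberDet_quadMap_pos (hKA hI)⟩)
    (analyticOnNhd_quadMap.mono Set.inter_subset_left) (fun I _ => quadMap_zero I)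
    (fun z hz => hz.2)
  obtain ⟨β, hβ, hcan⟩ := exists_canonical_lift hA hσ fun z hz => (hσW z hz).2.1
  have hQ : ∀ z ∈ A ×ˢ disc r, (z.1, σ z) ∈ quadDomain := fun z hz => (hσW z hz).1.1
  -- The energy is constant on circles, so it is read off at the representative `(√(2t), 0)`.
  refine ⟨A, r, actionAngleMap σ β, fun I t =>
    D.quadFactor (m + 1) (m + 2) (I 0) (I 1) (I 3) * (5 - 3 * (I 2 - I 3) ^ 2 / I 0 ^ 2 -
      ((quadMap (I, σ (I, √(2 * t), 0))).1 ^ 2 + (quadMap (I, σ (I, √(2 * t), 0))).2 ^ 2)),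
    hA, hKA', hr, isCanonicalChange_actionAngleMap hσ hβ (fun z hz => (hσW z hz).2.2)
      (fun z hz => (hQ z hz).2.2.1) hcan, fun z hz => ?_⟩
  have hz' : (z.1, z.2.2) ∈ A ×ˢ disc r := hz
  have hy := hQ _ hz'
  refine ⟨exists_hasCoords_of_mem_quadDomain D m hy rfl rfl, fun s _ hc => ⟨?_, ?_⟩⟩
  · rw [sameRay_iff_excess hc hy rfl rfl, excess_eq_zero_iff hy]
    constructor
    · intro h
      have h0 : (z.1, ((0 : ℝ), (0 : ℝ))) ∈ A ×ˢ disc r := ⟨hz.1, zero_mem_disc hr⟩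
      have i1 : ρ (z.1, σ (z.1, z.2.2)) = z.2.2 := (hσW _ hz').2.2
      have i2 : ρ (z.1, σ (z.1, 0, 0)) = (0, 0) := (hσW _ h0).2.2
      have i3 : σ (z.1, 0, 0) = 0 := hσ0 z.1 hz.1
      have h' : σ (z.1, z.2.2) = 0 := h
      rw [← i1, h', ← i2, i3]
    · intro h
      show σ (z.1, z.2.2) = _
      rw [h]
      exact hσ0 z.1 hz.1
  · rw [fAvOrder_two_of_hasCoords hc hy rfl rfl]
    have hn : √(2 * ((z.2.2.1 ^ 2 + z.2.2.2 ^ 2) / 2)) ^ 2 = z.2.2.1 ^ 2 + z.2.2.2 ^ 2 := by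
      rw [Real.sq_sqrt (by positivity)]
      ring
    have hd : (√(2 * ((z.2.2.1 ^ 2 + z.2.2.2 ^ 2) / 2)), (0 : ℝ)) ∈ disc r := by
      show _ ^ 2 + (0 : ℝ) ^ 2 < r ^ 2
      rw [hn]
      simpa using hz.2
    have hi := hinv z.1 hz.1 z.2.2 hz.2 _ hd (by
      show _ = _ ^ 2 + (0 : ℝ) ^ 2
      rw [hn]
      ring)
    show _ * (_ - ((quadMap (z.1, σ (z.1, z.2.2))).1 ^ 2 +
      (quadMap (z.1, σ (z.1, z.2.2))).2 ^ 2)) = _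
    rw [hi]

end MassData

end PStar

end

/-! ### Assembly of the five assertions -/

open PStar in
theorem proposition3p2 (n : ℕ) (hn : 2 ≤ n) (D : MassData) :
    -- the coefficient of order two is a genuine derivative
    (∀ (s : Config) (i j : ℕ), 1 ≤ i → i < j → j ≤ n → ContDiffAt ℝ 2 (D.newtonAv s i j) 0) ∧
    -- (i)
    (∀ i j : ℕ, 1 ≤ i → i < j → j ≤ n →
      ∀ s s' : Config, D.Regular n s → D.Regular n s' →
        D.Lam s i = D.Lam s' i → D.Lam s j = D.Lam s' j →
        (∀ k, i ≤ k → k ≤ min j (n - 1) → D.Theta n s k = D.Theta n s' k) →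
        (∀ k, i - 1 ≤ k → k ≤ min j (n - 1) → D.chi n s k = D.chi n s' k) →
        (∀ k, i ≤ k → k ≤ j - 1 → D.kappa n s k = D.kappa n s' k) →
        (∀ k, i ≤ k → k ≤ min j (n - 1) → D.vartheta n s k = D.vartheta n s' k) →
        D.fAvOrder 2 s i j = D.fAvOrder 2 s' i j ∧ D.fAv s i j = D.fAv s' i j) ∧
    -- (ii)
    (∀ i : ℕ, 1 ≤ i → i ≤ n - 1 →
      ∀ s s' : Config, D.Regular n s → D.Regular n s' →
        D.Lam s i = D.Lam s' i → D.Lam s (i + 1) = D.Lam s' (i + 1) →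
        D.chi n s (i - 1) = D.chi n s' (i - 1) → D.chi n s i = D.chi n s' i →
        D.chi n s (min (i + 1) (n - 1)) = D.chi n s' (min (i + 1) (n - 1)) →
        D.Theta n s i = D.Theta n s' i →
        D.Theta n s (min (i + 1) (n - 1)) = D.Theta n s' (min (i + 1) (n - 1)) →
        D.kappa n s i = D.kappa n s' i →
        D.vartheta n s i = D.vartheta n s' i →
        D.vartheta n s (min (i + 1) (n - 1)) = D.vartheta n s' (min (i + 1) (n - 1)) →
        D.fAvOrder 2 s i (i + 1) = D.fAvOrder 2 s' i (i + 1) ∧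
          D.fAv s i (i + 1) = D.fAv s' i (i + 1)) ∧
    -- (iii)
    (∀ s s' : Config, D.Regular n s → D.Regular n s' →
        D.Lam s (n - 1) = D.Lam s' (n - 1) → D.Lam s n = D.Lam s' n →
        D.chi n s (n - 2) = D.chi n s' (n - 2) → D.chi n s (n - 1) = D.chi n s' (n - 1) →
        D.Theta n s (n - 1) = D.Theta n s' (n - 1) →
        D.vartheta n s (n - 1) = D.vartheta n s' (n - 1) →
        D.fAvOrder 2 s (n - 1) n = D.fAvOrder 2 s' (n - 1) n) ∧
    -- (iv)
    (∀ K : Set (Fin 4 → ℝ), IsCompact K → K ⊆ admissibleActions →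
      ∃ (A : Set (Fin 4 → ℝ)) (r : ℝ) (Φ : Phase → Phase) (h : (Fin 4 → ℝ) → ℝ → ℝ),
        IsOpen A ∧ K ⊆ A ∧ 0 < r ∧ IsCanonicalChange A r Φ ∧
        ∀ z ∈ phaseDomain A r,
          (∃ s : Config, D.Regular n s ∧ D.HasCoords n s (Φ z)) ∧
          ∀ s : Config, D.Regular n s → D.HasCoords n s (Φ z) →
            (SameRay ℝ (D.angMom s (n - 1)) (D.angMom s n) ↔ z.2.2 = (0, 0)) ∧
            D.fAvOrder 2 s (n - 1) n = h z.1 ((z.2.2.1 ^ 2 + z.2.2.2 ^ 2) / 2)) := by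

  obtain ⟨m, rfl⟩ : ∃ m, n = m + 2 := ⟨n - 2, by omega⟩
  have hi : ∀ i j : ℕ, 1 ≤ i → i < j → j ≤ m + 2 →
      ∀ s s' : Config, D.Regular (m + 2) s → D.Regular (m + 2) s' →
        D.Lam s i = D.Lam s' i → D.Lam s j = D.Lam s' j →
        (∀ k, i ≤ k → k ≤ min j (m + 2 - 1) → D.Theta (m + 2) s k = D.Theta (m + 2) s' k) →
        (∀ k, i - 1 ≤ k → k ≤ min j (m + 2 - 1) → D.chi (m + 2) s k = D.chi (m + 2) s' k) →
        (∀ k, i ≤ k → k ≤ j - 1 → D.kappa (m + 2) s k = D.kappa (m + 2) s' k) →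
        (∀ k, i ≤ k → k ≤ min j (m + 2 - 1) →
          D.vartheta (m + 2) s k = D.vartheta (m + 2) s' k) →
        D.fAvOrder 2 s i j = D.fAvOrder 2 s' i j ∧ D.fAv s i j = D.fAv s' i j := by
    intro i j h1 hij hj s s' hs hs' a b c d e f
    exact MassData.fAv_eq_of_newtonAv_eq (MassData.newtonAv_eq hs hs' h1 hij hj a b c d e f)
  refine ⟨fun s i j _ _ _ => (D.analyticAt_newtonAv s i j).contDiffAt, hi, ?_, ?_,
    fun K hK hKA => D.exists_integrating_coordinates m hK hKA⟩
  · intro i h1 hin s s' hs hs' a b c1 c2 c3 t1 t2 k1 v1 v2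
    -- For neighbouring planets the index ranges reduce to their endpoints, which coincide when `i =
    -- n - 1`.
    have hmin : ∀ {k}, k ≤ min (i + 1) (m + 2 - 1) → i ≤ k →
        k = i ∨ k = min (i + 1) (m + 2 - 1) := by
      intro k hk hik
      omega
    refine hi i (i + 1) h1 (by omega) (by omega) s s' hs hs' a b ?_ ?_ ?_ ?_
    · intro k hik hk
      rcases hmin hk hik with rfl | h
      · exact t1
      · rwa [h]
    · intro k hik hk
      rcases Nat.lt_or_ge k i with h | h
      · obtain rfl : k = i - 1 := by omega
        exact c1
      · rcases hmin hk h with rfl | h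
        · exact c2
        · rwa [h]
    · intro k hik hk
      obtain rfl : k = i := by omega
      exact k1
    · intro k hik hk
      rcases hmin hk hik with rfl | h
      · exact v1
      · rwa [h]
  · intro s s' hs hs' a b c1 c2 t v
    -- The explicit formula, unlike the rotation argument, does not involve `κ_{n-1}`.
    have h := MassData.fAvOrder_two_eq_quadShape (D := D) (s := s) (k := m + 1) (by omega)
    have h' := MassData.fAvOrder_two_eq_quadShape (D := D) (s := s') (k := m + 1) (by omega)
    simp only [Nat.add_sub_cancel, show m + 2 - 1 = m + 1 from rfl] at a b c1 c2 t v h h' ⊢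
    rw [show m + 1 + 1 = m + 2 from rfl] at h h'
    rw [h, h', a, b, c1, c2, t, v]
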